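/- Let $1\le k\le n$ be integers. For $\lambda\in\mathbb{R}^n$ put $\sigma_j(\lambda)=\sum_{1\le i_1<\dots<i_j\le n}\lambda_{i_1}\cdots\lambda_{i_j}$ and $\Gamma_k=\{\lambda\in\mathbb{R}^n:\sigma_j(\lambda)>0 \text{ for } j=1,\dots,k\}$; let $\lambda(D^2u)$ be the vector of eigenvalues of the Hessian $D^2u$ and $\sigma_k(D^2u)=\sigma_k(\lambda(D^2u))$. A function $u$ is called $k$-admissible if $\lambda(D^2u(x))\in\Gamma_k$ for all $x\in\Omega$. Let $\Omega\subset\mathbb{R}^n$ be a bounded, uniformly convex domain of class $C^4$ with outer unit normal $\nu$; that is, $\Omega$ is convex, open and non-empty, all principal curvatures of $\partial\Omega$ are at least some $\kappa>0$, and there are $r>0$ and $K$ such that for each $p\in\partial\Omega$ there is a $C^4$ function $\rho$ on the ball $B_r(p)$ with $\Omega\cap B_r(p)=\{\rho<0\}$, $|D\rho|\ge 1$, and all derivatives of $\rho$ of order $0,\dots,4$ bounded by $K$ on $B_r(p)$. (Every bounded $C^4$ domain satisfies the last condition for some $r$ and $K$; these two numbers measure the $C^4$ norm of $\partial\Omega$.)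 Let $f\in C^2(\overline\Omega\times\mathbb{R})$ be positive and let $\varphi\in C^3(\overline\Omega\times\mathbb{R})$, $\varphi=\varphi(x,z)$, be non-increasing in $z$. Let $u\in C^4(\Omega)\cap C^3(\overline\Omega)$ be a $k$-admissible solution of $$\sigma_k(D^2u)=f(x,u)\ \text{ in }\Omega,\qquad u_\nu=\varphi(x,u)\ \text{ on }\partial\Omega .$$ Put $M_0=\sup_\Omega|u|$. Then $$\sup_{\overline\Omega}|D^2u|\le C,$$ where $C$ depends only on $n$, $k$, an upper bound for $\|u\|_{C^1(\overline\Omega)}$, upper bounds for $\|f\|_{C^2(\overline\Omega\times[-M_0,M_0])}$ and $\|\varphi\|_{C^3(\overline\Omega\times[-M_0,M_0])}$, a positive lower bound for $\min_{\overline\Omega\times[-M_0,M_0]}f$, the convexity constant $\kappa$ of $\Omega$, and the constants $r$, $K$ measuring the $C^4$ norm of $\partial\Omega$. -/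

import Mathlib

open Set Metric

noncomputable section

namespace HessianNeumann

/-- `n`-dimensional Euclidean space. -/
abbrev E (n : ℕ) : Type := EuclideanSpace ℝ (Fin n)

/-! ### Elementary symmetric functions, the cones `Γ_k`, eigenvalues of the Hessian -/

/-- The `k`-th elementary symmetric function of `lam ∈ ℝⁿ`. -/
def sigma {n : ℕ} (k : ℕ) (lam : Fin n → ℝ) : ℝ :=
  ∑ s ∈ Finset.powersetCard k (Finset.univ : Finset (Fin n)), ∏ i ∈ s, lam i

/-- The cone `Γ_k = {lam | σ_j(lam) > 0 for j = 1, …, k}`. -/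
def Gam (n k : ℕ) : Set (Fin n → ℝ) :=
  {lam | ∀ j, 1 ≤ j → j ≤ k → 0 < sigma j lam}

open Classical in
/-- The eigenvalues (with multiplicity) of a real symmetric matrix; the value at a matrix that is
not symmetric is irrelevant, since Hessians of `C²` functions are symmetric. -/
def eigenvals {n : ℕ} (A : Matrix (Fin n) (Fin n) ℝ) : Fin n → ℝ :=
  if h : A.IsHermitian then h.eigenvalues else 0

/-- The Hessian matrix `(∂_i ∂_j u (x))` of a function `u` on `S`. At interior points of `S` it is
the ordinary Hessian; at the other points of `S` the derivatives are those within `S`. -/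
def hessian {n : ℕ} (S : Set (E n)) (u : E n → ℝ) (x : E n) : Matrix (Fin n) (Fin n) ℝ :=
  Matrix.of fun i j => iteratedFDerivWithin ℝ 2 u S x
    ![EuclideanSpace.single i 1, EuclideanSpace.single j 1]

/-- `u` is `k`-admissible in `Ω`: `lam(D²u(x)) ∈ Γ_k` for every `x ∈ Ω`. -/
def KAdmissible {n : ℕ} (k : ℕ) (Ω : Set (E n)) (u : E n → ℝ) : Prop :=
  ∀ x ∈ Ω, eigenvals (hessian (closure Ω) u x) ∈ Gam n k

/-! ### Domains of class `C⁴`, normals, curvature -/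

/-- `ρ` is a `C⁴` local defining function of `Ω` in the ball of radius `r` about `p`:
inside that ball `Ω` is `{ρ < 0}`, and `Dρ` has no zero. -/
structure IsLocalDefining {n : ℕ} (Ω : Set (E n)) (p : E n) (r : ℝ) (ρ : E n → ℝ) : Prop where
  pos : 0 < r
  contDiffOn : ContDiffOn ℝ 4 ρ (ball p r)
  mem_iff : ∀ x ∈ ball p r, x ∈ Ω ↔ ρ x < 0
  fderiv_ne : ∀ x ∈ ball p r, fderiv ℝ ρ x ≠ 0

/-- `Ω` has a `C⁴` boundary, of `C⁴` size controlled by `r` and `K`: about each boundary point, in a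
ball of radius `r`, there is a local defining function `ρ` with `|Dρ| ≥ 1` whose derivatives up to
order four are bounded by `K`. A bounded open set is of class `C⁴` in the usual sense if and
only if this holds for some `r > 0` and some `K`. -/
def HasC4Boundary {n : ℕ} (Ω : Set (E n)) (r K : ℝ) : Prop :=
  ∀ p ∈ frontier Ω, ∃ ρ : E n → ℝ, IsLocalDefining Ω p r ρ ∧
    ∀ x ∈ ball p r, 1 ≤ ‖fderiv ℝ ρ x‖ ∧ ∀ j ≤ 4, ‖iteratedFDeriv ℝ j ρ x‖ ≤ K

/-- `ν` is the outer unit normal of `∂Ω` at `p`: `ν = ∇ρ(p) / |∇ρ(p)|` for a local defining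
function `ρ` (which one does not matter). -/
def IsOuterUnitNormal {n : ℕ} (Ω : Set (E n)) (p ν : E n) : Prop :=
  ∃ (r : ℝ) (ρ : E n → ℝ), IsLocalDefining Ω p r ρ ∧ ν = ‖gradient ρ p‖⁻¹ • gradient ρ p

/-- `Ω` is uniformly convex with constant `κ`: it is convex and all principal curvatures of `∂Ω`
are at least `κ`, that is, the second fundamental form `D²ρ(p)(τ, τ) / |Dρ(p)|` at each boundary
point `p` is at least `κ |τ|²` on the tangent space `{τ | Dρ(p) τ = 0}`. -/
def UniformlyConvexWith {n : ℕ} (Ω : Set (E n)) (κ : ℝ) : Prop :=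
  Convex ℝ Ω ∧
    ∀ p ∈ frontier Ω, ∀ (r : ℝ) (ρ : E n → ℝ), IsLocalDefining Ω p r ρ →
      ∀ τ : E n, fderiv ℝ ρ p τ = 0 →
        κ * ‖τ‖ ^ 2 ≤ iteratedFDeriv ℝ 2 ρ p ![τ, τ] / ‖fderiv ℝ ρ p‖

/-! ### `C^m` norms and the boundary value problem -/

/-- The `C^m` norm over `T` of a function `F` on `S ⊇ T` is at most `B`: the derivatives of `F`
(within `S`) of order `0, …, m` are bounded by `B` on `T`. -/
def CNormLE {V : Type*} [NormedAddCommGroup V] [NormedSpace ℝ V]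
    (m : ℕ) (F : V → ℝ) (S T : Set V) (B : ℝ) : Prop :=
  ∀ q ∈ T, ∀ j ≤ m, ‖iteratedFDerivWithin ℝ j F S q‖ ≤ B

/-- `u` solves `σ_k(D²u) = f(x, u)` in `Ω`, `u_ν = φ(x, u)` on `∂Ω`. -/
def SolvesNeumann {n : ℕ} (k : ℕ) (Ω : Set (E n)) (f φ : E n → ℝ → ℝ) (u : E n → ℝ) : Prop :=
  (∀ x ∈ Ω, sigma k (eigenvals (hessian (closure Ω) u x)) = f x (u x)) ∧
    ∀ x ∈ frontier Ω, ∀ ν : E n, IsOuterUnitNormal Ω x ν →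
      fderivWithin ℝ u (closure Ω) x ν = φ x (u x)

end HessianNeumann

end

open HessianNeumann

/-! The equation is used in the form log σ_k(D²u) = F with F = log f(x, u). Because log σ_k is
concave on the Gårding cone (`concaveOn_log_es`, which rests on Newton's inequality and on
`cone_superadditive`), it lies below its tangent at each Hessian. In an eigenframe of D²u(x) with
eigenvalues λ_i the linearization is v ↦ Σ G_i v_ii, where G_i > 0, Σ G_i λ_i = k and Σ G_i is
bounded below (`exists_isFrame`). Applied to a first derivative of u it returns the derivative of F;
applied to u_ξξ it returns at least F_ξξ (`exists_interiorFrame`).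

Three facts drive every maximum principle below. A function whose Hessian is a bounded multiple of
D²u up to a bounded error contributes only O(1 + Σ G_i). The function |Du|² contributes 2 Σ G_i λ_i²
up to a constant, and this sum dominates the largest eigenvalue. Near a boundary point p, uniform
convexity makes a small perturbation H of the defining function ρ strictly convex, so H contributes
at least c Σ G_i (`exists_barrierConst`).

Reduction to the normal direction (`exists_hess_le_normal`): if |u_νν| ≤ M' on ∂Ω, then every u_ξξ
is at most C(1 + M'). An interior maximum of u_ξξ + K₂|Du|² is bounded directly. If the maximum sits
at p ∈ ∂Ω, subtract from u_ξξ a first-order correction `wx` that carries the mixed tangential-normal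
derivatives known from the boundary condition, and add a large multiple of H. The new function has
no interior maximum near p. At a boundary maximum either the value is at most M', or ξ may be taken
tangential. In the latter case the boundary condition differentiated twice along ∂Ω bounds the
derivative of u_ξξ along ∇ρ by C(1 + M') - 2κ u_ξξ, where κ comes from the curvature and φ_z ≤ 0
removes the only bad term. The sign of the derivative at the maximum then bounds u_ξξ.

Normal derivatives (`exists_normal_le`): let w be the boundary condition extended inside, so w = 0
on ∂Ω and its derivative along ∇ρ controls u_νν. The functions ±(1 - βH)w + KH with K = A + M'/2
have no interior maximum near p. The dangerous term Σ G_i |λ_i| is small compared with (1 + M') Σ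
G_i if no eigenvalue is very negative; otherwise all G_i are comparable (`mul_sum_es_erase_le`) and
the gradient term βK Σ G_i H_i² absorbs it. Hence M' may be replaced by C + M'/2, and for the finite
supremum M' this gives M' ≤ 2|C|.

Uniformity of the constant is built in: `Params` holds the numbers on which it may depend, `Setup P`
ranges over all domains, data and solutions they control, and each estimate is an existence
statement in `Params` before a universal one over `Setup`. -/

noncomputable section

namespace HessianNeumann

/-! ### Newton's inequality and superadditivity of σ_{k+1}/σ_k on the Gårding cone. -/

section Symmetric

open Polynomial in
-- Laguerre's inequality p'² ≥ p p'' at 0. Multiplying p by X - r turns p₁² - 2p₀p₂ into p₀² +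
-- r²(p₁² - 2p₀p₂), so the induction only adds squares.
theorem coeff_laguerre_prod (a : ℝ) (R : Multiset ℝ) :
    2 * ((C a * (R.map fun r => X - C r).prod).coeff 0) *
      ((C a * (R.map fun r => X - C r).prod).coeff 2) ≤
      ((C a * (R.map fun r => X - C r).prod).coeff 1) ^ 2 := by
  induction R using Multiset.induction_on with
  | empty => simp [coeff_C]
  | cons r R ih =>
    set q := C a * (R.map fun r => X - C r).prod with hq
    have h : C a * ((r ::ₘ R).map fun r => X - C r).prod = X * q - C r * q := by
      rw [Multiset.map_cons, Multiset.prod_cons, hq]; ring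
    rw [h]
    simp only [coeff_sub, coeff_C_mul, coeff_X_mul_zero, coeff_X_mul]
    nlinarith [sq_nonneg (q.coeff 0), mul_nonneg (sq_nonneg r) (sub_nonneg.2 ih)]

open Polynomial in
theorem Splits.coeff_laguerre {p : ℝ[X]} (hp : p.Splits) :
    2 * p.coeff 0 * p.coeff 2 ≤ p.coeff 1 ^ 2 := by
  rw [hp.eq_prod_roots]
  exact coeff_laguerre_prod _ _

open Polynomial in
theorem Splits.real_derivative {p : ℝ[X]} (hp : p.Splits) : (derivative p).Splits := by
  rw [splits_iff_card_roots] at hp ⊢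
  refine le_antisymm (card_roots' _) ?_
  have h1 := card_roots_le_derivative p
  have h2 := natDegree_derivative_le p
  omega

open Polynomial in
theorem Splits.real_iterate_derivative {p : ℝ[X]} (hp : p.Splits) (m : ℕ) :
    (derivative^[m] p).Splits := by
  induction m with
  | zero => simpa
  | succ m ih => rw [Function.iterate_succ_apply']; exact Splits.real_derivative ih

open Polynomial in
-- Derivatives of real-rooted polynomials are real-rooted by Rolle, so Laguerre's inequality applies
-- to the m-th derivative. The factorials give the sharper (m+2)·p_m·p_{m+2} ≤ (m+1)·p_{m+1}²; the
-- weaker form is enough here.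
theorem Splits.coeff_mul_coeff_le {p : ℝ[X]} (hp : p.Splits) (m : ℕ) :
    p.coeff m * p.coeff (m + 2) ≤ p.coeff (m + 1) ^ 2 := by
  have h := Splits.coeff_laguerre (Splits.real_iterate_derivative hp m)
  simp only [coeff_iterate_derivative, nsmul_eq_mul, zero_add] at h
  have e0 : m.descFactorial m = m.factorial := Nat.descFactorial_self m
  have e1 : (1 + m).descFactorial m = (m + 1) * m.factorial := by
    have := Nat.factorial_mul_descFactorial (show m ≤ 1 + m by omega)
    rw [show 1 + m - m = 1 by omega, Nat.factorial_one, one_mul] at this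
    rw [this, add_comm, Nat.factorial_succ]
  have e2 : 2 * (2 + m).descFactorial m = (m + 2) * ((m + 1) * m.factorial) := by
    have := Nat.factorial_mul_descFactorial (show m ≤ 2 + m by omega)
    rw [show 2 + m - m = 2 by omega, Nat.factorial_two] at this
    rw [this, add_comm, Nat.factorial_succ, Nat.factorial_succ]
  have e2' : (2:ℝ) * (((2 + m).descFactorial m : ℕ) : ℝ)
      = (m + 2) * ((m + 1) * (m.factorial : ℝ)) := by exact_mod_cast e2
  rw [e0, e1, add_comm 1 m, add_comm 2 m] at h
  rw [add_comm 2 m] at e2'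
  push_cast at h
  have hf : (0:ℝ) < (m.factorial : ℝ) := by exact_mod_cast m.factorial_pos
  set F := (m.factorial : ℝ)
  set a := p.coeff m
  set b := p.coeff (m + 1)
  set c := p.coeff (m + 2)
  set D := (((m + 2).descFactorial m : ℕ) : ℝ)
  have h' : F ^ 2 * (m + 1) * ((m + 2) * (a * c)) ≤ F ^ 2 * (m + 1) * ((m + 1) * b ^ 2) := by
    calc F ^ 2 * (m + 1) * ((m + 2) * (a * c)) = (2 * D) * F * a * c := by rw [e2']; ring
      _ = 2 * (F * a) * (D * c) := by ring
      _ ≤ _ := h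
      _ = _ := by ring
  have h'' := le_of_mul_le_mul_left h' (by positivity)
  have hm : (0:ℝ) ≤ m := Nat.cast_nonneg m
  by_cases hac : a * c ≤ 0
  · nlinarith [sq_nonneg b]
  · push Not at hac
    nlinarith

variable {ι : Type*}

/-- The `j`-th elementary symmetric function of the variables indexed by `s`. -/
def es (s : Finset ι) (j : ℕ) (lam : ι → ℝ) : ℝ :=
  ∑ t ∈ s.powersetCard j, ∏ i ∈ t, lam i

theorem es_zero (s : Finset ι) (lam : ι → ℝ) : es s 0 lam = 1 := by simp [es]

theorem es_one (s : Finset ι) (lam : ι → ℝ) : es s 1 lam = ∑ i ∈ s, lam i := by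
  simp [es, Finset.powersetCard_one]

theorem es_empty_succ (j : ℕ) (lam : ι → ℝ) : es ∅ (j + 1) lam = 0 := by
  rw [es, Finset.powersetCard_eq_empty.2 (by simp)]; simp

theorem es_eq_zero_of_card_lt {s : Finset ι} {j : ℕ} (h : s.card < j) (lam : ι → ℝ) :
    es s j lam = 0 := by
  rw [es, Finset.powersetCard_eq_empty.2 h]; simp

/-- The coefficients of ∏ (X + λ_i) are the elementary symmetric functions in reverse order. -/
theorem es_newton (s : Finset ι) (j : ℕ) (lam : ι → ℝ) :
    es s j lam * es s (j + 2) lam ≤ es s (j + 1) lam ^ 2 := by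
  by_cases h : s.card < j + 2
  · rw [es_eq_zero_of_card_lt h]; simp; positivity
  push Not at h
  open Polynomial in
  have hp : (∏ i ∈ s, (X + C (lam i)) : ℝ[X]).Splits := by
    refine Polynomial.Splits.prod fun i _ => ?_
    exact Polynomial.Splits.X_add_C _
  have := Splits.coeff_mul_coeff_le hp (s.card - (j + 2))
  rw [Finset.prod_X_add_C_coeff _ _ (by omega), Finset.prod_X_add_C_coeff _ _ (by omega),
    Finset.prod_X_add_C_coeff _ _ (by omega)] at this
  rw [show s.card - (s.card - (j + 2)) = j + 2 by omega,
    show s.card - (s.card - (j + 2) + 2) = j by omega,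
    show s.card - (s.card - (j + 2) + 1) = j + 1 by omega] at this
  unfold es; linarith

/-- The Gårding cone of order `k` in the variables indexed by `s`. -/
def Cone (s : Finset ι) (k : ℕ) : Set (ι → ℝ) := {lam | ∀ j ≤ k, 0 < es s j lam}

theorem mem_cone_of_le {s : Finset ι} {k l : ℕ} (h : l ≤ k) {lam : ι → ℝ} (hl : lam ∈ Cone s k) :
    lam ∈ Cone s l := fun j hj => hl j (hj.trans h)

variable [DecidableEq ι]

theorem es_insert {s : Finset ι} {a : ι} (ha : a ∉ s) (j : ℕ) (lam : ι → ℝ) :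
    es (insert a s) (j + 1) lam = es s (j + 1) lam + lam a * es s j lam := by
  unfold es
  rw [Finset.powersetCard_succ_insert ha, Finset.sum_union, Finset.sum_image, Finset.mul_sum]
  · congr 1
    refine Finset.sum_congr rfl fun t ht => ?_
    rw [Finset.prod_insert]
    exact fun h => ha ((Finset.mem_powersetCard.1 ht).1 h)
  · intro t ht t' ht' h
    have h1 : a ∉ t := fun h => ha ((Finset.mem_powersetCard.1 ht).1 h)
    have h2 : a ∉ t' := fun h => ha ((Finset.mem_powersetCard.1 ht').1 h)
    rw [← Finset.erase_insert h1, ← Finset.erase_insert h2, h]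
  · rw [Finset.disjoint_left]
    intro t ht ht'
    obtain ⟨t', _, rfl⟩ := Finset.mem_image.1 ht'
    exact ha ((Finset.mem_powersetCard.1 ht).1 (Finset.mem_insert_self a t'))

theorem es_erase {s : Finset ι} {a : ι} (ha : a ∈ s) (j : ℕ) (lam : ι → ℝ) :
    es s (j + 1) lam = es (s.erase a) (j + 1) lam + lam a * es (s.erase a) j lam := by
  conv_lhs => rw [← Finset.insert_erase ha]
  exact es_insert (Finset.notMem_erase a s) j lam

theorem sum_mul_es_erase (s : Finset ι) (j : ℕ) (lam : ι → ℝ) :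
    ∑ i ∈ s, lam i * es (s.erase i) j lam = (j + 1) * es s (j + 1) lam := by
  induction s using Finset.induction_on generalizing j with
  | empty => simp [es_empty_succ]
  | insert a s ha ih =>
    have hne : ∀ i ∈ s, a ≠ i := fun i hi h => ha (h ▸ hi)
    rw [Finset.sum_insert ha, Finset.erase_insert ha, es_insert ha]
    cases j with
    | zero =>
      have := ih 0
      simp only [es_zero, mul_one] at this ⊢
      simp only [this]; push_cast; ring
    | succ j =>
      have : ∑ i ∈ s, lam i * es ((insert a s).erase i) (j + 1) lam
          = ∑ i ∈ s, lam i * es (s.erase i) (j + 1) lam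
            + lam a * ∑ i ∈ s, lam i * es (s.erase i) j lam := by
        rw [Finset.mul_sum, ← Finset.sum_add_distrib]
        refine Finset.sum_congr rfl fun i hi => ?_
        rw [Finset.erase_insert_of_ne (hne i hi),
          es_insert (fun h => ha (Finset.mem_of_mem_erase h))]
        ring
      rw [this, ih (j + 1), ih j]
      push_cast; ring

theorem sum_es_erase (s : Finset ι) (j : ℕ) (lam : ι → ℝ) :
    ∑ i ∈ s, es (s.erase i) j lam = ((s.card : ℝ) - j) * es s j lam := by
  induction s using Finset.induction_on generalizing j with
  | empty =>
    cases j with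
    | zero => simp
    | succ j => simp [es_empty_succ]
  | insert a s ha ih =>
    have hne : ∀ i ∈ s, a ≠ i := fun i hi h => ha (h ▸ hi)
    rw [Finset.sum_insert ha, Finset.erase_insert ha, Finset.card_insert_of_notMem ha]
    cases j with
    | zero => simp [es_zero]; ring
    | succ j =>
      have : ∑ i ∈ s, es ((insert a s).erase i) (j + 1) lam
          = ∑ i ∈ s, es (s.erase i) (j + 1) lam
            + lam a * ∑ i ∈ s, es (s.erase i) j lam := by
        rw [Finset.mul_sum, ← Finset.sum_add_distrib]
        refine Finset.sum_congr rfl fun i hi => ?_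
        rw [Finset.erase_insert_of_ne (hne i hi),
          es_insert (fun h => ha (Finset.mem_of_mem_erase h))]
      rw [this, ih (j + 1), ih j, es_insert ha]
      push_cast; ring

/-- This is what makes all derivatives of σ_{k+1} positive. Write x, y, z for σ_k, σ_{k+1}, σ_{k+2}
without λ_a. If y ≤ 0, then y + λ_a x > 0 and z + λ_a y > 0 force xz > -λ_a x y ≥ y², against
Newton. -/
theorem mem_cone_erase {s : Finset ι} {k : ℕ} {lam : ι → ℝ} (h : lam ∈ Cone s (k + 1)) {a : ι}
    (ha : a ∈ s) : lam ∈ Cone (s.erase a) k := by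
  induction k with
  | zero => intro j hj; obtain rfl : j = 0 := by omega
            rw [es_zero]; exact one_pos
  | succ k ih =>
    have ih' := ih (mem_cone_of_le (Nat.le_succ _) h)
    intro j hj
    rcases Nat.lt_or_ge j (k + 1) with hj' | hj'
    · exact ih' j (by omega)
    obtain rfl : j = k + 1 := by omega
    by_contra hneg
    push Not at hneg
    have h1 := h (k + 1) (by omega)
    have h2 := h (k + 2) (by omega)
    have h0 := ih' k le_rfl
    rw [es_erase ha] at h1 h2
    have hN := es_newton (s.erase a) k lam
    set x := es (s.erase a) k lam
    set y := es (s.erase a) (k + 1) lam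
    set z := es (s.erase a) (k + 2) lam
    -- `z > -lam a * y`, `lam a * x > -y`, `x z ≤ y ^ 2`
    have h3 : x * (z + lam a * y) > 0 := mul_pos h0 h2
    nlinarith [mul_nonneg (sub_nonneg.2 hneg) h1.le]

/-- Joint convexity and homogeneity of x²/y, with the denominator allowed to grow. -/
theorem sq_div_add_le {x y x' y' z : ℝ} (hy : 0 < y) (hy' : 0 < y') (hz : y + y' ≤ z) :
    (x + x') ^ 2 / z ≤ x ^ 2 / y + x' ^ 2 / y' := by
  have h1 : (x + x') ^ 2 / z ≤ (x + x') ^ 2 / (y + y') :=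
    div_le_div_of_nonneg_left (sq_nonneg _) (by positivity) hz
  refine h1.trans ?_
  rw [div_add_div _ _ hy.ne' hy'.ne', div_le_div_iff₀ (by positivity) (by positivity)]
  nlinarith [sq_nonneg (x * y' - x' * y), mul_pos hy hy']

/-- Superadditivity of `σ_{k+1}/σ_k` on the Gårding cone, with the convexity of the cone. -/
theorem cone_superadditive (k : ℕ) : ∀ (s : Finset ι) (lam mu : ι → ℝ),
    lam ∈ Cone s (k + 1) → mu ∈ Cone s (k + 1) → (lam + mu) ∈ Cone s (k + 1) ∧
      es s (k + 1) lam / es s k lam + es s (k + 1) mu / es s k mu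
        ≤ es s (k + 1) (lam + mu) / es s k (lam + mu) := by
  induction k with
  | zero =>
    intro s lam mu hl hm
    have h1 := hl 1 le_rfl
    have h2 := hm 1 le_rfl
    have h3 : es s 1 (lam + mu) = es s 1 lam + es s 1 mu := by
      simp [es_one, Finset.sum_add_distrib]
    refine ⟨fun j hj => ?_, ?_⟩
    · rcases Nat.lt_or_ge j 1 with h | h
      · obtain rfl : j = 0 := by omega
        rw [es_zero]; exact one_pos
      · obtain rfl : j = 1 := by omega
        rw [h3]; positivity
    · simp [h3, es_zero]
  | succ k ih =>
    intro s lam mu hl hm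
    have hs := (ih s lam mu (mem_cone_of_le (Nat.le_succ _) hl) (mem_cone_of_le (Nat.le_succ _) hm)).1
    -- the quotient in terms of the quotients with one variable removed
    have key : ∀ nu : ι → ℝ, nu ∈ Cone s (k + 1) → (∀ i ∈ s, nu ∈ Cone (s.erase i) k) →
        ((k + 2 : ℕ) : ℝ) * (es s (k + 2) nu / es s (k + 1) nu) =
          ∑ i ∈ s, (nu i - nu i ^ 2 /
            (nu i + es (s.erase i) (k + 1) nu / es (s.erase i) k nu)) := by
      intro nu h1 h2
      have h3 := sum_mul_es_erase s (k + 1) nu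
      have h4 := h1 (k + 1) le_rfl
      rw [← mul_div_assoc, div_eq_iff h4.ne', Finset.sum_mul]
      push_cast at h3 ⊢
      rw [show (k:ℝ) + 2 = k + 1 + 1 by ring, ← h3]
      refine Finset.sum_congr rfl fun i hi => ?_
      have h5 := h2 i hi k le_rfl
      rw [es_erase hi] at h4 ⊢
      have : nu i + es (s.erase i) (k + 1) nu / es (s.erase i) k nu
        = (es (s.erase i) (k + 1) nu + nu i * es (s.erase i) k nu) / es (s.erase i) k nu := by
        field_simp; ring
      rw [this]
      field_simp
      ring
    have hpos : ∀ nu : ι → ℝ, nu ∈ Cone s (k + 1) → (∀ i ∈ s, nu ∈ Cone (s.erase i) k) →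
        ∀ i ∈ s, 0 < nu i + es (s.erase i) (k + 1) nu / es (s.erase i) k nu := by
      intro nu h1 h2 i hi
      have h4 := h1 (k + 1) le_rfl
      have h5 := h2 i hi k le_rfl
      rw [es_erase hi] at h4
      have : nu i + es (s.erase i) (k + 1) nu / es (s.erase i) k nu
        = (es (s.erase i) (k + 1) nu + nu i * es (s.erase i) k nu) / es (s.erase i) k nu := by
        field_simp; ring
      rw [this]; positivity
    have el : ∀ i ∈ s, lam ∈ Cone (s.erase i) (k + 1) := fun i hi => mem_cone_erase hl hi
    have em : ∀ i ∈ s, mu ∈ Cone (s.erase i) (k + 1) := fun i hi => mem_cone_erase hm hi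
    have hl' := mem_cone_of_le (Nat.le_succ (k + 1)) hl
    have hm' := mem_cone_of_le (Nat.le_succ (k + 1)) hm
    have el' : ∀ i ∈ s, lam ∈ Cone (s.erase i) k := fun i hi => mem_cone_of_le (Nat.le_succ _) (el i hi)
    have em' : ∀ i ∈ s, mu ∈ Cone (s.erase i) k := fun i hi => mem_cone_of_le (Nat.le_succ _) (em i hi)
    have es' : ∀ i ∈ s, lam + mu ∈ Cone (s.erase i) k := fun i hi => mem_cone_erase hs hi
    have hq : es s (k + 2) lam / es s (k + 1) lam + es s (k + 2) mu / es s (k + 1) mu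
        ≤ es s (k + 2) (lam + mu) / es s (k + 1) (lam + mu) := by
      have hk : (0:ℝ) < ((k + 2 : ℕ) : ℝ) := by positivity
      refine le_of_mul_le_mul_left ?_ hk
      rw [mul_add, key lam hl' el', key mu hm' em', key (lam + mu) hs es',
        ← Finset.sum_add_distrib]
      -- The linear parts add up exactly. The induction hypothesis makes the denominators
      -- superadditive, which is the hypothesis of `sq_div_add_le` for the subtracted squares.
      refine Finset.sum_le_sum fun i hi => ?_
      have h := (ih (s.erase i) lam mu (el i hi) (em i hi)).2
      have := sq_div_add_le (x := lam i) (x' := mu i) (hpos lam hl' el' i hi)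
        (hpos mu hm' em' i hi)
        (z := (lam + mu) i + es (s.erase i) (k + 1) (lam + mu) / es (s.erase i) k (lam + mu))
        (by simp only [Pi.add_apply]; linarith)
      simp only [Pi.add_apply] at this ⊢
      linarith
    -- Positivity of the top function at λ + μ is read off from the quotient inequality, since the
    -- function one order lower is already positive.
    refine ⟨fun j hj => ?_, hq⟩
    rcases Nat.lt_or_ge j (k + 2) with h | h
    · exact hs j (by omega)
    obtain rfl : j = k + 2 := by omega
    have h1 : 0 < es s (k + 2) lam / es s (k + 1) lam :=
      div_pos (hl _ le_rfl) (hl _ (Nat.le_succ _))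
    have h2 : 0 < es s (k + 2) mu / es s (k + 1) mu :=
      div_pos (hm _ le_rfl) (hm _ (Nat.le_succ _))
    have h3 := hs (k + 1) le_rfl
    by_contra hn
    push Not at hn
    have := div_nonpos_of_nonpos_of_nonneg hn h3.le
    linarith

end Symmetric
end HessianNeumann

namespace HessianNeumann

/-! ### Concavity of log σ_k and comparison of its partial derivatives. -/

section Concavity

variable {ι : Type*}

theorem es_smul (s : Finset ι) (j : ℕ) (t : ℝ) (lam : ι → ℝ) :
    es s j (t • lam) = t ^ j * es s j lam := by
  unfold es
  rw [Finset.mul_sum]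
  refine Finset.sum_congr rfl fun u hu => ?_
  simp [Finset.prod_mul_distrib, (Finset.mem_powersetCard.1 hu).2]

theorem smul_mem_cone {s : Finset ι} {k : ℕ} {lam : ι → ℝ} (h : lam ∈ Cone s k) {t : ℝ}
    (ht : 0 < t) : t • lam ∈ Cone s k := fun j hj => by
  rw [es_smul]; exact mul_pos (by positivity) (h j hj)

variable [DecidableEq ι]

theorem convex_cone (s : Finset ι) (k : ℕ) : Convex ℝ (Cone s k) := by
  rw [convex_iff_forall_pos]
  intro x hx y hy a b ha hb _
  cases k with
  | zero => intro j hj; obtain rfl : j = 0 := by omega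
            rw [es_zero]; exact one_pos
  | succ k => exact (cone_superadditive k s _ _ (smul_mem_cone hx ha) (smul_mem_cone hy hb)).1

/-- By induction, log σ_{k+1} = log σ_k + log(σ_{k+1}/σ_k). The quotient is superadditive and
homogeneous of degree one, hence concave, and the logarithm is increasing and concave. -/
theorem concaveOn_log_es (s : Finset ι) (k : ℕ) :
    ConcaveOn ℝ (Cone s k) (fun lam => Real.log (es s k lam)) := by
  induction k with
  | zero => simpa [es_zero] using concaveOn_const (0:ℝ) (convex_cone s 0)
  | succ k ih =>
    rw [concaveOn_iff_forall_pos] at ih ⊢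
    refine ⟨convex_cone s _, fun x hx y hy a b ha hb hab => ?_⟩
    have h1 := ih.2 (mem_cone_of_le (Nat.le_succ _) hx) (mem_cone_of_le (Nat.le_succ _) hy)
      ha hb hab
    have h2 := (cone_superadditive k s _ _ (smul_mem_cone hx ha) (smul_mem_cone hy hb)).2
    have hz := convex_cone s (k + 1) hx hy ha.le hb.le hab
    have e : ∀ x ∈ Cone s (k + 1), Real.log (es s (k + 1) x)
        = Real.log (es s k x) + Real.log (es s (k + 1) x / es s k x) := by
      intro x hx
      have p1 := hx (k + 1) le_rfl
      have p2 := hx k (Nat.le_succ _)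
      rw [← Real.log_mul p2.ne' (div_pos p1 p2).ne', mul_div_cancel₀ _ p2.ne']
    have qpos : ∀ x ∈ Cone s (k + 1), 0 < es s (k + 1) x / es s k x := fun x hx =>
      div_pos (hx (k + 1) le_rfl) (hx k (Nat.le_succ _))
    have esc : ∀ (t : ℝ) (x : ι → ℝ), 0 < t → es s (k + 1) (t • x) / es s k (t • x)
        = t * (es s (k + 1) x / es s k x) := by
      intro t x ht
      rw [es_smul, es_smul, pow_succ]
      field_simp
    rw [esc a x ha, esc b y hb] at h2
    have h3 := (strictConcaveOn_log_Ioi.concaveOn).2 (qpos x hx) (qpos y hy) ha.le hb.le hab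
    simp only [smul_eq_mul] at h1 h3 ⊢
    have h4 := Real.log_le_log (by
      have := qpos x hx; have := qpos y hy; positivity) h2
    rw [e x hx, e y hy, e _ hz]
    linarith

theorem hasDerivAt_es (s : Finset ι) (k : ℕ) (lam h : ι → ℝ) :
    HasDerivAt (fun t : ℝ => es s (k + 1) (lam + t • h))
      (∑ i ∈ s, h i * es (s.erase i) k lam) 0 := by
  induction s using Finset.induction_on generalizing k with
  | empty => simpa [es_empty_succ] using hasDerivAt_const (0:ℝ) (0:ℝ)
  | insert a s ha ih =>
    have hne : ∀ i ∈ s, a ≠ i := fun i hi h => ha (h ▸ hi)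
    have hl : HasDerivAt (fun t : ℝ => (lam + t • h) a) (h a) 0 := by
      simpa using ((hasDerivAt_id (0:ℝ)).mul_const (h a)).const_add (lam a)
    simp only [es_insert ha]
    rw [Finset.sum_insert ha, Finset.erase_insert ha]
    cases k with
    | zero =>
      have := (ih 0).add hl
      simp only [es_zero, mul_one] at this ⊢
      exact this.congr_deriv (by ring)
    | succ k =>
      have := (ih (k + 1)).add (hl.mul (ih k))
      refine this.congr_deriv ?_
      simp only [zero_smul, add_zero]
      have : ∑ i ∈ s, h i * es ((insert a s).erase i) (k + 1) lam
          = ∑ i ∈ s, h i * es (s.erase i) (k + 1) lam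
            + lam a * ∑ i ∈ s, h i * es (s.erase i) k lam := by
        rw [Finset.mul_sum, ← Finset.sum_add_distrib]
        refine Finset.sum_congr rfl fun i hi => ?_
        rw [Finset.erase_insert_of_ne (hne i hi),
          es_insert (fun h => ha (Finset.mem_of_mem_erase h))]
        ring
      rw [this]; ring

theorem log_es_le_tangent {s : Finset ι} {k : ℕ} {lam mu : ι → ℝ} (hl : lam ∈ Cone s (k + 1))
    (hm : mu ∈ Cone s (k + 1)) :
    Real.log (es s (k + 1) mu) - Real.log (es s (k + 1) lam) ≤
      ∑ i ∈ s, es (s.erase i) k lam / es s (k + 1) lam * (mu i - lam i) := by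
  have hd := hasDerivAt_es s k lam (mu - lam)
  have h0 : es s (k + 1) (lam + (0:ℝ) • (mu - lam)) ≠ 0 := by
    simpa using (hl (k + 1) le_rfl).ne'
  have hd' := (hd.log h0).tendsto_slope_zero_right
  have : (∑ i ∈ s, (mu - lam) i * es (s.erase i) k lam) / es s (k + 1) (lam + (0:ℝ) • (mu - lam))
      = ∑ i ∈ s, es (s.erase i) k lam / es s (k + 1) lam * (mu i - lam i) := by
    rw [Finset.sum_div]
    refine Finset.sum_congr rfl fun i _ => ?_
    simp; ring
  rw [this] at hd'
  refine ge_of_tendsto hd' ?_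
  filter_upwards [Ioo_mem_nhdsGT (show (0:ℝ) < 1 by norm_num)] with t ht
  have hc := (concaveOn_log_es s (k + 1)).2 hl hm (sub_nonneg.2 ht.2.le) ht.1.le (by ring)
  have e : (1 - t) • lam + t • mu = lam + t • (mu - lam) := by
    ext i; simp; ring
  rw [e] at hc
  simp only [zero_add, zero_smul, add_zero, smul_eq_mul] at hc ⊢
  rw [inv_mul_eq_div, le_div_iff₀ ht.1]
  linarith

theorem es_erase_sub {s : Finset ι} {i j : ι} (hi : i ∈ s) (hj : j ∈ s) (hij : i ≠ j) (m : ℕ)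
    (lam : ι → ℝ) :
    es (s.erase i) (m + 1) lam - es (s.erase j) (m + 1) lam =
      (lam j - lam i) * es ((s.erase i).erase j) m lam := by
  rw [es_erase (Finset.mem_erase.2 ⟨hij.symm, hj⟩), es_erase (Finset.mem_erase.2 ⟨hij, hi⟩),
    Finset.erase_right_comm]
  ring

/-- Split σ_{k+1} at the largest variable λ_a. If the part without λ_a is not positive, there is
nothing to do. If it is, the remaining variables lie in the cone of order k + 1, and Euler's
identity with λ_i ≤ λ_a bounds that part by a multiple of λ_a σ_k(λ|a). -/
theorem card_mul_es_erase_ge {s : Finset ι} {k : ℕ} {lam : ι → ℝ} (hl : lam ∈ Cone s (k + 1))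
    {a : ι} (ha : a ∈ s) (hmax : ∀ i ∈ s, lam i ≤ lam a) :
    es s (k + 1) lam ≤ s.card * (lam a * es (s.erase a) k lam) := by
  have hE := es_erase ha k lam
  have hpos := hl (k + 1) le_rfl
  have hc : (1:ℝ) ≤ s.card := by exact_mod_cast Finset.card_pos.2 ⟨a, ha⟩
  by_cases h : es (s.erase a) (k + 1) lam ≤ 0
  · have : es s (k + 1) lam ≤ lam a * es (s.erase a) k lam := by linarith
    nlinarith
  push Not at h
  have hcone : lam ∈ Cone (s.erase a) (k + 1) := by
    intro j hj
    rcases Nat.lt_or_ge j (k + 1) with hj' | hj'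
    · exact mem_cone_erase hl ha j (by omega)
    · obtain rfl : j = k + 1 := by omega
      exact h
  have h1 := sum_mul_es_erase (s.erase a) k lam
  have h2 := sum_es_erase (s.erase a) k lam
  have h3 : ∑ i ∈ s.erase a, lam i * es ((s.erase a).erase i) k lam ≤
      ∑ i ∈ s.erase a, lam a * es ((s.erase a).erase i) k lam := by
    refine Finset.sum_le_sum fun i hi => ?_
    exact mul_le_mul_of_nonneg_right (hmax i (Finset.mem_of_mem_erase hi))
      (mem_cone_erase hcone hi k le_rfl).le
  rw [← Finset.mul_sum, h1, h2, Finset.card_erase_of_mem ha, Nat.cast_sub (by exact_mod_cast hc)]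
    at h3
  push_cast at h3
  nlinarith [(Nat.cast_nonneg k : (0:ℝ) ≤ k)]

/-- A very negative eigenvalue makes the linearized operator uniformly elliptic. The derivatives are
smallest at λ_a (value A) and largest at λ_b, and these two differ by (λ_a - λ_b)X, where X omits
both variables. Euler's identity expresses Σ_{i≠a} λ_i² σ_m(λ|a,i) through A and σ_{m+2}(λ|a), and
positivity of σ_{m+2} bounds it by C λ_a A. Keeping only the term i = b gives λ_b² X ≤ C λ_a A, and
|λ_b| ≥ ελ_a turns this into λ_a X ≤ C A/ε². -/
theorem mul_sum_es_erase_le {s : Finset ι} {k : ℕ} {lam : ι → ℝ} (hl : lam ∈ Cone s (k + 1))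
    {a b : ι} (ha : a ∈ s) (hb : b ∈ s) (hmax : ∀ i ∈ s, lam i ≤ lam a)
    (hmin : ∀ i ∈ s, lam b ≤ lam i) {ε : ℝ} (hε : 0 < ε) (hab : lam b ≤ -ε * lam a) :
    ∀ i ∈ s, ∑ j ∈ s, es (s.erase j) k lam ≤
      (s.card * (1 + 2 * s.card ^ 2 / ε ^ 2)) * es (s.erase i) k lam := by
  intro i hi
  have hc : (1:ℝ) ≤ s.card := by exact_mod_cast Finset.card_pos.2 ⟨a, ha⟩
  cases k with
  | zero =>
    simp only [es_zero, Finset.sum_const, nsmul_eq_mul, mul_one]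
    have : 0 ≤ 2 * (s.card : ℝ) ^ 2 / ε ^ 2 := by positivity
    nlinarith
  | succ m =>
    have hs1 : 0 < ∑ i ∈ s, lam i := by rw [← es_one]; exact hl 1 (by omega)
    have hla : 0 < lam a := by
      by_contra hn
      push Not at hn
      have := Finset.sum_nonpos fun i hi => (hmax i hi).trans hn
      linarith
    have hlb : lam b < 0 := by nlinarith
    have hne : a ≠ b := by rintro rfl; linarith
    have hbs : b ∈ s.erase a := Finset.mem_erase.2 ⟨hne.symm, hb⟩
    have hdd : ∀ i ∈ s, ∀ j ∈ s, i ≠ j → 0 < es ((s.erase i).erase j) m lam := by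
      intro i hi j hj hij
      exact mem_cone_erase (mem_cone_erase hl hi) (Finset.mem_erase.2 ⟨hij.symm, hj⟩) m le_rfl
    set A := es (s.erase a) (m + 1) lam with hA
    set X := es ((s.erase a).erase b) m lam with hX
    have hXpos : 0 < X := hdd a ha b hb hne
    have hApos : 0 < A := mem_cone_erase hl ha (m + 1) le_rfl
    have hlow : ∀ i ∈ s, A ≤ es (s.erase i) (m + 1) lam := by
      intro i hi
      by_cases h : i = a
      · rw [h]
      · have := es_erase_sub hi ha h m lam
        nlinarith [hmax i hi, hdd i hi a ha h, mul_nonneg (sub_nonneg.2 (hmax i hi))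
          (hdd i hi a ha h).le]
    have hup : ∀ i ∈ s, es (s.erase i) (m + 1) lam ≤ es (s.erase b) (m + 1) lam := by
      intro i hi
      by_cases h : i = b
      · rw [h]
      · have := es_erase_sub hi hb h m lam
        nlinarith [mul_nonneg (sub_nonneg.2 (hmin i hi)) (hdd i hi b hb h).le]
    have hcard : ((m + 2 : ℕ) : ℝ) ≤ s.card := by
      by_contra hn
      push Not at hn
      have := es_eq_zero_of_card_lt (s := s) (j := m + 2) (by exact_mod_cast hn) lam
      have := hl (m + 2) le_rfl
      linarith
    -- the sum of the variables other than `a`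
    set S1 := ∑ i ∈ s.erase a, lam i with hS1
    have hsum : lam a + S1 = ∑ i ∈ s, lam i := Finset.add_sum_erase s lam ha
    have hS1le : S1 ≤ s.card * lam a := by
      have : S1 ≤ ∑ i ∈ s.erase a, lam a :=
        Finset.sum_le_sum fun i hi => hmax i (Finset.mem_of_mem_erase hi)
      rw [Finset.sum_const, nsmul_eq_mul] at this
      refine this.trans (mul_le_mul_of_nonneg_right ?_ hla.le)
      exact_mod_cast Finset.card_le_card (Finset.erase_subset a s)
    have hbn : -(s.card * lam a) + lam a ≤ lam b := by
      have h1 : lam b + ∑ i ∈ s.erase b, lam i = ∑ i ∈ s, lam i := Finset.add_sum_erase s lam hb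
      have : ∑ i ∈ s.erase b, lam i ≤ ∑ i ∈ s.erase b, lam a :=
        Finset.sum_le_sum fun i hi => hmax i (Finset.mem_of_mem_erase hi)
      rw [Finset.sum_const, nsmul_eq_mul, Finset.card_erase_of_mem hb,
        Nat.cast_sub (by exact_mod_cast hc)] at this
      push_cast at this
      nlinarith
    -- the square sum identity
    have hsq : ∑ i ∈ s.erase a, lam i ^ 2 * es ((s.erase a).erase i) m lam =
        S1 * A - ((m + 1 : ℕ) + 1) * es (s.erase a) (m + 2) lam := by
      have := sum_mul_es_erase (s.erase a) (m + 1) lam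
      rw [← this, hS1, Finset.sum_mul, ← Finset.sum_sub_distrib]
      refine Finset.sum_congr rfl fun i hi => ?_
      rw [hA, es_erase hi m lam]; ring
    have hsqle : lam b ^ 2 * X ≤
        ∑ i ∈ s.erase a, lam i ^ 2 * es ((s.erase a).erase i) m lam := by
      refine Finset.single_le_sum (f := fun i => lam i ^ 2 * es ((s.erase a).erase i) m lam)
        (fun i hi => ?_) hbs
      exact mul_nonneg (sq_nonneg _)
        (hdd a ha i (Finset.mem_of_mem_erase hi) (Finset.ne_of_mem_erase hi).symm).le
    have hk := hl (m + 2) le_rfl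
    rw [es_erase ha (m + 1) lam, ← hA] at hk
    push_cast at hsq hcard
    have h1 : lam b ^ 2 * X ≤ 2 * s.card * lam a * A := by
      have e1 : -((m:ℝ) + 1 + 1) * es (s.erase a) (m + 2) lam ≤ (m + 2) * (lam a * A) := by
        nlinarith [(Nat.cast_nonneg m : (0:ℝ) ≤ m)]
      have e2 : ((m:ℝ) + 2) * (lam a * A) ≤ s.card * (lam a * A) :=
        mul_le_mul_of_nonneg_right hcard (by positivity)
      have e3 : S1 * A ≤ s.card * lam a * A := mul_le_mul_of_nonneg_right hS1le hApos.le
      linarith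
    have h2 : ε ^ 2 * lam a * X ≤ 2 * s.card * A := by
      have e1 : (ε * lam a) ^ 2 ≤ lam b ^ 2 := by
        have : 0 < ε * lam a := by positivity
        nlinarith
      have e2 : lam a * (ε ^ 2 * lam a * X) ≤ lam a * (2 * s.card * A) := by
        nlinarith [mul_le_mul_of_nonneg_right e1 hXpos.le]
      exact le_of_mul_le_mul_left e2 hla
    have h3 : es (s.erase b) (m + 1) lam ≤ (1 + 2 * s.card ^ 2 / ε ^ 2) * A := by
      have e1 := es_erase_sub ha hb hne m lam
      have e2 : lam a * X ≤ 2 * s.card * A / ε ^ 2 := by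
        rw [le_div_iff₀ (by positivity)]; linarith
      have e3 : (lam a - lam b) * X ≤ s.card * lam a * X := by
        refine mul_le_mul_of_nonneg_right ?_ hXpos.le
        linarith
      have e4 : (s.card : ℝ) * (lam a * X) ≤ s.card * (2 * s.card * A / ε ^ 2) :=
        mul_le_mul_of_nonneg_left e2 (by positivity)
      have e5 : (s.card : ℝ) * (2 * s.card * A / ε ^ 2) = 2 * s.card ^ 2 / ε ^ 2 * A := by
        ring
      nlinarith
    calc ∑ j ∈ s, es (s.erase j) (m + 1) lam ≤ ∑ j ∈ s, es (s.erase b) (m + 1) lam :=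
          Finset.sum_le_sum hup
      _ = s.card * es (s.erase b) (m + 1) lam := by simp
      _ ≤ s.card * ((1 + 2 * s.card ^ 2 / ε ^ 2) * A) := by gcongr
      _ = (s.card * (1 + 2 * s.card ^ 2 / ε ^ 2)) * A := by ring
      _ ≤ _ := by gcongr; exact hlow i hi

end Concavity

/-! ### Symmetric functions of averaged eigenvalues. -/

section Frame

variable {n k : ℕ}

theorem mem_gam_iff {lam : Fin n → ℝ} : lam ∈ Gam n k ↔ lam ∈ Cone Finset.univ k := by
  constructor
  · intro h j hj
    rcases Nat.eq_zero_or_pos j with rfl | hj'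
    · rw [es_zero]; exact one_pos
    · exact h j hj' hj
  · intro h j _ hj; exact h j hj

theorem sigma_eq_es (lam : Fin n → ℝ) : sigma k lam = es Finset.univ k lam := rfl

theorem es_univ_comp_perm (j : ℕ) (lam : Fin n → ℝ) (π : Equiv.Perm (Fin n)) :
    es Finset.univ j (lam ∘ π) = es Finset.univ j lam := by
  unfold es
  refine Finset.sum_bij (fun t _ => t.map π.toEmbedding) ?_ ?_ ?_ ?_
  · intro t ht; simpa [Finset.mem_powersetCard] using ht
  · intro t _ t' _ h; exact Finset.map_injective _ h
  · intro t ht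
    refine ⟨t.map π.symm.toEmbedding, ?_, ?_⟩
    · simpa [Finset.mem_powersetCard] using ht
    · ext x; simp
  · intro t _; simp

/-- A doubly stochastic average stays in the cone and does not decrease `log σ_k`. -/
theorem doublyStochastic_mulVec_cone {W : Matrix (Fin n) (Fin n) ℝ}
    (hW : W ∈ doublyStochastic ℝ (Fin n)) {lam : Fin n → ℝ} (hl : lam ∈ Cone Finset.univ k) :
    W.mulVec lam ∈ Cone Finset.univ k ∧
      Real.log (es Finset.univ k lam) ≤ Real.log (es Finset.univ k (W.mulVec lam)) := by
  -- Birkhoff's theorem: the average is a convex combination of permutations of λ, and both the cone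
  -- and σ_k are invariant under permutations.
  obtain ⟨w, hw0, hw1, hw⟩ := exists_eq_sum_perm_of_mem_doublyStochastic hW
  have e : W.mulVec lam = ∑ π, w π • (lam ∘ π) := by
    rw [← hw, Matrix.sum_mulVec]
    refine Finset.sum_congr rfl fun π _ => ?_
    rw [Matrix.smul_mulVec, Matrix.permMatrix_mulVec]
  have hm : ∀ π ∈ (Finset.univ : Finset (Equiv.Perm (Fin n))),
      (lam ∘ π) ∈ Cone (Finset.univ : Finset (Fin n)) k := by
    intro π _ j hj; rw [es_univ_comp_perm]; exact hl j hj
  rw [e]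
  refine ⟨(convex_cone _ k).sum_mem (fun π _ => hw0 π) hw1 hm, ?_⟩
  have := (concaveOn_log_es (Finset.univ : Finset (Fin n)) k).le_map_sum (fun π _ => hw0 π) hw1 hm
  simp only [es_univ_comp_perm, smul_eq_mul, ← Finset.sum_mul, hw1, one_mul] at this
  exact this

end Frame
end HessianNeumann

namespace HessianNeumann

/-! ### Eigenframes and the tangent inequality for log σ_k on symmetric matrices. -/

section Frame

variable {n k : ℕ}

theorem exists_eigenbasis {A : Matrix (Fin n) (Fin n) ℝ} (hA : A.IsHermitian) :
    ∃ v : OrthonormalBasis (Fin n) ℝ (E n),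
      ∀ j, A.mulVec (v j).ofLp = eigenvals A j • (v j).ofLp := by
  unfold eigenvals
  rw [dif_pos hA]
  exact ⟨_, fun j => hA.mulVec_eigenvectorBasis j⟩

/-- The bilinear form of a matrix. -/
def bil (A : Matrix (Fin n) (Fin n) ℝ) (a b : E n) : ℝ := a.ofLp ⬝ᵥ A.mulVec b.ofLp

theorem bil_eq_sum (A : Matrix (Fin n) (Fin n) ℝ) (a b : E n) :
    bil A a b = ∑ i, ∑ j, a i * b j * A i j := by
  unfold bil dotProduct Matrix.mulVec dotProduct
  refine Finset.sum_congr rfl fun i _ => ?_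
  rw [Finset.mul_sum]
  exact Finset.sum_congr rfl fun j _ => by ring

theorem dotProduct_eq_inner (a b : E n) : a.ofLp ⬝ᵥ b.ofLp = inner ℝ a b := by
  rw [EuclideanSpace.inner_eq_star_dotProduct, dotProduct_comm]; simp

theorem bil_self_eq_sum {A : Matrix (Fin n) (Fin n) ℝ} {mu : Fin n → ℝ}
    {v : OrthonormalBasis (Fin n) ℝ (E n)}
    (hv : ∀ j, A.mulVec (v j).ofLp = mu j • (v j).ofLp) (a : E n) :
    bil A a a = ∑ j, (inner ℝ a (v j)) ^ 2 * mu j := by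
  have h1 : a.ofLp = ∑ j, (inner ℝ (v j) a) • (v j).ofLp := by
    conv_lhs => rw [← v.sum_repr' a]
    simp
  have h2 : A.mulVec a.ofLp = ∑ j, (inner ℝ (v j) a * mu j) • (v j).ofLp := by
    conv_lhs => rw [h1]
    rw [Matrix.mulVec_sum]
    refine Finset.sum_congr rfl fun j _ => ?_
    rw [Matrix.mulVec_smul, hv, smul_smul]
  rw [bil, h2, dotProduct_sum]
  refine Finset.sum_congr rfl fun j _ => ?_
  rw [dotProduct_smul, dotProduct_eq_inner, real_inner_comm, smul_eq_mul]
  ring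

/-- `e`, `lam`, `G` are an orthonormal eigenbasis of `A`, its eigenvalues, and the derivatives
of `log σ_k` with respect to the eigenvalues. -/
structure IsFrame (k : ℕ) (A : Matrix (Fin n) (Fin n) ℝ) (e : OrthonormalBasis (Fin n) ℝ (E n))
    (lam G : Fin n → ℝ) : Prop where
  bil_eq : ∀ i j, bil A (e i) (e j) = if i = j then lam i else 0
  pos : ∀ i, 0 < G i
  sum_mul : ∑ i, G i * lam i = k
  tangent : ∀ B : Matrix (Fin n) (Fin n) ℝ, B.IsHermitian → eigenvals B ∈ Gam n k →
    Real.log (sigma k (eigenvals B)) - Real.log (sigma k (eigenvals A)) ≤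
      ∑ i, G i * (bil B (e i) (e i) - lam i)
  le_sum : ∀ a, 0 < a → sigma k (eigenvals A) ≤ a → Real.exp (-|Real.log a|) ≤ ∑ i, G i
  max_le : ∀ a, (∀ i, lam i ≤ lam a) → 1 ≤ n * (lam a * G a)
  sum_pos : 0 < ∑ i, lam i
  sum_le : ∀ ε, 0 < ε → ∀ a b, (∀ i, lam i ≤ lam a) → (∀ i, lam b ≤ lam i) →
    lam b ≤ -ε * lam a → ∀ i, ∑ j, G j ≤ (n * (1 + 2 * n ^ 2 / ε ^ 2)) * G i

theorem const_mem_cone (hkn : k ≤ n) {t : ℝ} (ht : 0 < t) :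
    (fun _ => t : Fin n → ℝ) ∈ Cone Finset.univ k := by
  intro j hj
  have : es (Finset.univ : Finset (Fin n)) j (fun _ => t) = (n.choose j : ℝ) * t ^ j := by
    unfold es
    rw [Finset.sum_congr rfl (g := fun _ => t ^ j)]
    · simp
    · intro s hs; simp [(Finset.mem_powersetCard.1 hs).2]
  rw [this]
  have : 0 < n.choose j := Nat.choose_pos (hj.trans hkn)
  positivity

theorem le_es_const (hkn : k ≤ n) {t : ℝ} (ht : 0 < t) :
    t ^ k ≤ es (Finset.univ : Finset (Fin n)) k (fun _ => t) := by
  have : es (Finset.univ : Finset (Fin n)) k (fun _ => t) = (n.choose k : ℝ) * t ^ k := by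
    unfold es
    rw [Finset.sum_congr rfl (g := fun _ => t ^ k)]
    · simp
    · intro s hs; simp [(Finset.mem_powersetCard.1 hs).2]
  rw [this]
  have : (1:ℝ) ≤ n.choose k := by exact_mod_cast Nat.choose_pos hkn
  nlinarith [pow_pos ht k]

/-- Concavity passes from eigenvalues to matrices without differentiating eigenvalues. The diagonal
of B in an eigenbasis of A is a doubly stochastic average of the eigenvalues of B, so averaging
followed by the tangent inequality in ℝⁿ gives the tangent inequality for matrices. -/
theorem exists_isFrame (hk : 1 ≤ k) (hkn : k ≤ n) {A : Matrix (Fin n) (Fin n) ℝ}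
    (hA : A.IsHermitian) (hG : eigenvals A ∈ Gam n k) :
    ∃ e lam G, IsFrame k A e lam G := by
  obtain ⟨v, hv⟩ := exists_eigenbasis hA
  obtain ⟨m, rfl⟩ : ∃ m, k = m + 1 := ⟨k - 1, by omega⟩
  have hc := mem_gam_iff.1 hG
  set lam := eigenvals A with hlam
  set U : Finset (Fin n) := Finset.univ
  have hσ : 0 < es U (m + 1) lam := hc (m + 1) le_rfl
  set G : Fin n → ℝ := fun i => es (U.erase i) m lam / es U (m + 1) lam with hGdef
  have hGm : ∑ i, G i * lam i = (m + 1 : ℕ) := by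
    have := sum_mul_es_erase U m lam
    have e : ∑ i, G i * lam i = (∑ i ∈ U, lam i * es (U.erase i) m lam) / es U (m + 1) lam := by
      rw [Finset.sum_div]
      exact Finset.sum_congr rfl fun i _ => by simp only [hGdef]; ring
    rw [e, this]; field_simp; push_cast; ring
  have htan : ∀ mu ∈ Cone U (m + 1), Real.log (es U (m + 1) mu) - Real.log (es U (m + 1) lam) ≤
      ∑ i, G i * (mu i - lam i) := fun mu hmu => log_es_le_tangent hc hmu
  refine ⟨v, lam, G, ?_, ?_, hGm, ?_, ?_, ?_, ?_, ?_⟩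
  · intro i j
    rw [bil, hv, dotProduct_smul, dotProduct_eq_inner, v.inner_eq_ite]
    split_ifs with h
    · rw [h]; simp
    · simp
  · intro i
    exact div_pos (mem_cone_erase hc (Finset.mem_univ i) m le_rfl) hσ
  · intro B hB hBG
    obtain ⟨w, hw⟩ := exists_eigenbasis hB
    set mu := eigenvals B
    -- Squared inner products of two orthonormal bases: rows and columns sum to one by Parseval.
    let W : Matrix (Fin n) (Fin n) ℝ := Matrix.of fun i j => (inner ℝ (v i) (w j)) ^ 2
    have hW : W ∈ doublyStochastic ℝ (Fin n) := by
      rw [mem_doublyStochastic_iff_sum]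
      refine ⟨fun i j => sq_nonneg _, fun i => ?_, fun j => ?_⟩
      · have := w.sum_sq_norm_inner_left (v i)
        simpa [W] using this
      · have := v.sum_sq_norm_inner_right (w j)
        simpa [W] using this
    have h1 := doublyStochastic_mulVec_cone hW (mem_gam_iff.1 hBG)
    have h2 := htan _ h1.1
    have e : ∀ i, W.mulVec mu i = bil B (v i) (v i) := by
      intro i
      rw [bil_self_eq_sum hw]; rfl
    simp only [e] at h2
    simp only [sigma_eq_es]
    linarith [h1.2]
  · intro a ha hle
    have hle' : es U (m + 1) lam ≤ a := hle
    -- The lower bound for Σ G_i is the tangent inequality tested at (t, …, t): its σ_k is at least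
    -- t^k, and Σ G_i λ_i = k removes λ from the right-hand side. This t is large enough to leave 1
    -- ≤ t Σ G_i.
    set t := Real.exp |Real.log a| with ht
    have htp : 0 < t := Real.exp_pos _
    have h1 := htan _ (const_mem_cone hkn htp)
    have h2 : (m + 1 : ℕ) * |Real.log a| ≤ Real.log (es U (m + 1) fun _ => t) := by
      have := Real.log_le_log (by positivity) (le_es_const hkn htp)
      rwa [Real.log_pow, ht, Real.log_exp] at this
    have h3 : Real.log (es U (m + 1) lam) ≤ Real.log a := Real.log_le_log hσ hle'
    have h4 : ∑ i, G i * (t - lam i) = t * ∑ i, G i - (m + 1 : ℕ) := by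
      rw [← hGm, Finset.mul_sum, ← Finset.sum_sub_distrib]
      exact Finset.sum_congr rfl fun i _ => by ring
    rw [h4] at h1
    push_cast at h1 h2
    have h5 : 1 ≤ t * ∑ i, G i := by
      nlinarith [le_abs_self (Real.log a), (Nat.cast_nonneg m : (0:ℝ) ≤ m),
        mul_nonneg (Nat.cast_nonneg m : (0:ℝ) ≤ m) (abs_nonneg (Real.log a))]
    rw [Real.exp_neg, ← ht, inv_le_iff_one_le_mul₀ htp]
    linarith
  · intro a ha
    have := card_mul_es_erase_ge hc (Finset.mem_univ a) (fun i _ => ha i)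
    simp only [hGdef]
    rw [Finset.card_fin] at this
    rw [← mul_div_assoc, ← mul_div_assoc, le_div_iff₀ hσ]
    linarith
  · have := hc 1 (by omega)
    rwa [es_one] at this
  · intro ε hε a b ha hb hab i
    have := mul_sum_es_erase_le hc (Finset.mem_univ a) (Finset.mem_univ b) (fun i _ => ha i)
      (fun i _ => hb i) hε hab i (Finset.mem_univ i)
    rw [Finset.card_fin] at this
    simp only [hGdef]
    rw [← Finset.sum_div, ← mul_div_assoc]
    exact div_le_div_of_nonneg_right this hσ.le

end Frame
end HessianNeumann

namespace HessianNeumann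

/-! ### Directional derivatives up to the boundary of a convex set, and tests at maxima. -/

section Calculus
open Filter Topology

variable {V : Type*} [NormedAddCommGroup V] [NormedSpace ℝ V]

/-- A convex set with non-empty interior. -/
structure ConvexBody (S : Set V) : Prop where
  convex : Convex ℝ S
  nonempty_interior : (interior S).Nonempty

variable {S : Set V} {x : V} {g h : V → ℝ}

theorem ConvexBody.uniqueDiffOn (hS : ConvexBody S) : UniqueDiffOn ℝ S :=
  uniqueDiffOn_convex hS.convex hS.nonempty_interior

theorem ConvexBody.mem_closure_interior (hS : ConvexBody S) (hx : x ∈ S) :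
    x ∈ closure (interior S) := by
  rw [hS.convex.closure_interior_eq_closure_of_nonempty_interior hS.nonempty_interior]
  exact subset_closure hx

/-- The derivative within `S` in the direction `e`. -/
def pd (S : Set V) (e : V) (g : V → ℝ) (x : V) : ℝ := fderivWithin ℝ g S x e

theorem contDiffWithinAt_pd (hS : ConvexBody S) (hx : x ∈ S) {m n : WithTop ℕ∞}
    (hg : ContDiffWithinAt ℝ n g S x) (hmn : m + 1 ≤ n) (e : V) :
    ContDiffWithinAt ℝ m (pd S e g) S x :=
  hg.fderivWithin_right_apply contDiffWithinAt_const hS.uniqueDiffOn hmn hx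

theorem eventually_contDiffWithinAt (hx : x ∈ S) {n : WithTop ℕ∞} (hn : n ≠ (⊤ : ℕ∞))
    (hg : ContDiffWithinAt ℝ n g S x) : ∀ᶠ y in 𝓝[S] x, ContDiffWithinAt ℝ n g S y := by
  have := hg.eventually hn
  rwa [insert_eq_of_mem hx] at this

theorem pd_congr (hx : x ∈ S) (e : V) (hgh : g =ᶠ[𝓝[S] x] h) : pd S e g x = pd S e h x := by
  unfold pd; rw [hgh.fderivWithin_eq_of_mem hx]

theorem pd_add_vec (e e' : V) (g : V → ℝ) (x : V) :
    pd S (e + e') g x = pd S e g x + pd S e' g x := by simp [pd]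

theorem pd_smul_vec (t : ℝ) (e : V) (g : V → ℝ) (x : V) :
    pd S (t • e) g x = t * pd S e g x := by simp [pd]

theorem pd_neg_vec (e : V) (g : V → ℝ) (x : V) : pd S (-e) g x = -pd S e g x := by simp [pd]

theorem pd_sum_vec {ι : Type*} (s : Finset ι) (e : ι → V) (g : V → ℝ) (x : V) :
    pd S (∑ i ∈ s, e i) g x = ∑ i ∈ s, pd S (e i) g x := by simp [pd]

theorem pd_const (e : V) (c : ℝ) (x : V) : pd S e (fun _ => c) x = 0 := by simp [pd]

theorem pd_add (hS : ConvexBody S) (hx : x ∈ S) (e : V) (hg : DifferentiableWithinAt ℝ g S x)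
    (hh : DifferentiableWithinAt ℝ h S x) :
    pd S e (fun y => g y + h y) x = pd S e g x + pd S e h x := by
  unfold pd; rw [fderivWithin_fun_add (hS.uniqueDiffOn x hx) hg hh]; rfl

theorem pd_mul (hS : ConvexBody S) (hx : x ∈ S) (e : V) (hg : DifferentiableWithinAt ℝ g S x)
    (hh : DifferentiableWithinAt ℝ h S x) :
    pd S e (fun y => g y * h y) x = g x * pd S e h x + pd S e g x * h x := by
  unfold pd; rw [fderivWithin_fun_mul (hS.uniqueDiffOn x hx) hg hh]; simp; ring

theorem pd_const_mul (hS : ConvexBody S) (hx : x ∈ S) (e : V) (c : ℝ)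
    (hg : DifferentiableWithinAt ℝ g S x) :
    pd S e (fun y => c * g y) x = c * pd S e g x := by
  rw [pd_mul hS hx e (differentiableWithinAt_const c) hg, pd_const]; ring

theorem pd_sum (hS : ConvexBody S) (hx : x ∈ S) (e : V) {ι : Type*} (s : Finset ι)
    {g : ι → V → ℝ} (hg : ∀ i ∈ s, DifferentiableWithinAt ℝ (g i) S x) :
    pd S e (fun y => ∑ i ∈ s, g i y) x = ∑ i ∈ s, pd S e (g i) x := by
  unfold pd; rw [fderivWithin_fun_sum (hS.uniqueDiffOn x hx) hg]; simp

theorem pd_comp (hS : ConvexBody S) (hx : x ∈ S) (e : V) {Θ : ℝ → ℝ}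
    (hΘ : DifferentiableAt ℝ Θ (g x)) (hg : DifferentiableWithinAt ℝ g S x) :
    pd S e (fun y => Θ (g y)) x = deriv Θ (g x) * pd S e g x := by
  have := hΘ.hasDerivAt.comp_hasFDerivWithinAt x hg.hasFDerivWithinAt
  unfold pd
  rw [show (fun y => Θ (g y)) = Θ ∘ g from rfl, this.fderivWithin (hS.uniqueDiffOn x hx)]
  simp

theorem eventually_differentiableWithinAt (hx : x ∈ S) {n : WithTop ℕ∞} (hn : 1 ≤ n)
    (hg : ContDiffWithinAt ℝ n g S x) : ∀ᶠ y in 𝓝[S] x, DifferentiableWithinAt ℝ g S y := by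
  filter_upwards [eventually_contDiffWithinAt hx (by simp) (hg.of_le hn)] with y hy
  exact hy.differentiableWithinAt one_ne_zero

theorem pd_pd_add (hS : ConvexBody S) (hx : x ∈ S) (e e' : V) (hg : ContDiffWithinAt ℝ 2 g S x)
    (hh : ContDiffWithinAt ℝ 2 h S x) :
    pd S e (pd S e' (fun y => g y + h y)) x = pd S e (pd S e' g) x + pd S e (pd S e' h) x := by
  have h1 : pd S e' (fun y => g y + h y) =ᶠ[𝓝[S] x] fun y => pd S e' g y + pd S e' h y := by
    filter_upwards [eventually_differentiableWithinAt hx one_le_two hg,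
      eventually_differentiableWithinAt hx one_le_two hh, self_mem_nhdsWithin] with y h1 h2 h3
    exact pd_add hS h3 e' h1 h2
  rw [pd_congr hx e h1, pd_add hS hx e]
  · exact (contDiffWithinAt_pd hS hx hg le_rfl e').differentiableWithinAt one_ne_zero
  · exact (contDiffWithinAt_pd hS hx hh le_rfl e').differentiableWithinAt one_ne_zero

theorem pd_pd_mul (hS : ConvexBody S) (hx : x ∈ S) (e e' : V) (hg : ContDiffWithinAt ℝ 2 g S x)
    (hh : ContDiffWithinAt ℝ 2 h S x) :
    pd S e (pd S e' (fun y => g y * h y)) x = g x * pd S e (pd S e' h) x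
      + pd S e g x * pd S e' h x + pd S e' g x * pd S e h x + pd S e (pd S e' g) x * h x := by
  have h1 : pd S e' (fun y => g y * h y) =ᶠ[𝓝[S] x]
      fun y => g y * pd S e' h y + pd S e' g y * h y := by
    filter_upwards [eventually_differentiableWithinAt hx one_le_two hg,
      eventually_differentiableWithinAt hx one_le_two hh, self_mem_nhdsWithin] with y h1 h2 h3
    exact pd_mul hS h3 e' h1 h2
  have dg := hg.differentiableWithinAt two_ne_zero
  have dh := hh.differentiableWithinAt two_ne_zero
  have dg' := (contDiffWithinAt_pd hS hx hg le_rfl e').differentiableWithinAt one_ne_zero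
  have dh' := (contDiffWithinAt_pd hS hx hh le_rfl e').differentiableWithinAt one_ne_zero
  rw [pd_congr hx e h1, pd_add hS hx e (dg.fun_mul dh') (dg'.fun_mul dh), pd_mul hS hx e dg dh',
    pd_mul hS hx e dg' dh]
  ring

theorem pd_pd_const_mul (hS : ConvexBody S) (hx : x ∈ S) (e e' : V) (c : ℝ)
    (hg : ContDiffWithinAt ℝ 2 g S x) :
    pd S e (pd S e' (fun y => c * g y)) x = c * pd S e (pd S e' g) x := by
  have h0 : pd S e' (fun _ : V => c) = fun _ => 0 := by ext; exact pd_const _ _ _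
  rw [pd_pd_mul hS hx e e' contDiffWithinAt_const hg, pd_const, pd_const, h0, pd_const]; ring

theorem pd_pd_sum (hS : ConvexBody S) (hx : x ∈ S) (e e' : V) {ι : Type*} (s : Finset ι)
    {g : ι → V → ℝ} (hg : ∀ i ∈ s, ContDiffWithinAt ℝ 2 (g i) S x) :
    pd S e (pd S e' (fun y => ∑ i ∈ s, g i y)) x = ∑ i ∈ s, pd S e (pd S e' (g i)) x := by
  classical
  induction s using Finset.induction_on with
  | empty =>
    have h0 : pd S e' (fun _ : V => (0:ℝ)) = fun _ => 0 := by ext; exact pd_const _ _ _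
    simp [h0, pd_const]
  | insert a s ha ih =>
    simp only [Finset.sum_insert ha]
    rw [pd_pd_add hS hx e e' (hg a (by simp)), ih fun i hi => hg i (by simp [hi])]
    exact ContDiffWithinAt.sum fun i hi => hg i (by simp [hi])

theorem pd_pd_comp (hS : ConvexBody S) (hx : x ∈ S) (e e' : V) {Θ : ℝ → ℝ}
    (hΘ : ContDiffAt ℝ 2 Θ (g x)) (hg : ContDiffWithinAt ℝ 2 g S x) :
    pd S e (pd S e' (fun y => Θ (g y))) x = deriv Θ (g x) * pd S e (pd S e' g) x
      + deriv (deriv Θ) (g x) * pd S e g x * pd S e' g x := by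
  have hev : ∀ᶠ t in 𝓝 (g x), DifferentiableAt ℝ Θ t := by
    filter_upwards [(hΘ.of_le one_le_two).eventually (by simp)] with t ht
    exact ht.differentiableAt one_ne_zero
  have h1 : pd S e' (fun y => Θ (g y)) =ᶠ[𝓝[S] x] fun y => deriv Θ (g y) * pd S e' g y := by
    filter_upwards [eventually_differentiableWithinAt hx one_le_two hg, self_mem_nhdsWithin,
      hg.continuousWithinAt.eventually hev] with y h1 h2 h3
    exact pd_comp hS h2 e' h3 h1
  have dg := hg.differentiableWithinAt two_ne_zero
  have dg' := (contDiffWithinAt_pd hS hx hg le_rfl e').differentiableWithinAt one_ne_zero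
  have hd : DifferentiableAt ℝ (deriv Θ) (g x) := by
    have : ContDiffAt ℝ 1 (deriv Θ) (g x) := by
      have := (hΘ.fderiv_right (m := 1) le_rfl).clm_apply (contDiffAt_const (c := (1:ℝ)))
      simpa using this
    exact this.differentiableAt one_ne_zero
  have hd' : DifferentiableWithinAt ℝ (fun y => deriv Θ (g y)) S x :=
    hd.comp_differentiableWithinAt x dg
  rw [pd_congr hx e h1, pd_mul hS hx e hd' dg', pd_comp hS hx e hd dg]

theorem pd_pd_eq (hS : ConvexBody S) (hx : x ∈ S) (e e' : V) (hg : ContDiffWithinAt ℝ 2 g S x) :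
    pd S e (pd S e' g) x = fderivWithin ℝ (fderivWithin ℝ g S) S x e e' := by
  have : DifferentiableWithinAt ℝ (fderivWithin ℝ g S) S x :=
    (hg.fderivWithin_right hS.uniqueDiffOn (m := 1) le_rfl hx).differentiableWithinAt one_ne_zero
  unfold pd
  rw [fderivWithin_clm_apply (hS.uniqueDiffOn x hx) this (differentiableWithinAt_const e')]
  simp

theorem pd_pd_comm (hS : ConvexBody S) (hx : x ∈ S) (e e' : V)
    (hg : ContDiffWithinAt ℝ 2 g S x) :
    pd S e (pd S e' g) x = pd S e' (pd S e g) x := by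
  rw [pd_pd_eq hS hx e e' hg, pd_pd_eq hS hx e' e hg]
  exact hg.isSymmSndFDerivWithinAt (by simp) hS.uniqueDiffOn (hS.mem_closure_interior hx) hx e e'

/-- Second-order Taylor expansion within a convex set. -/
theorem taylor_two (hS : ConvexBody S) (hx : x ∈ S) (hg : ContDiffWithinAt ℝ 2 g S x) {ε : ℝ}
    (hε : 0 < ε) : ∀ᶠ y in 𝓝[S] x,
      |g y - g x - pd S (y - x) g x - pd S (y - x) (pd S (y - x) g) x / 2| ≤ ε * ‖y - x‖ ^ 2 := by
  set B := fderivWithin ℝ (fderivWithin ℝ g S) S x with hB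
  have hd : DifferentiableWithinAt ℝ (fderivWithin ℝ g S) S x :=
    (hg.fderivWithin_right hS.uniqueDiffOn (m := 1) le_rfl hx).differentiableWithinAt one_ne_zero
  have h1 := (hasFDerivWithinAt_iff_isLittleO.1 hd.hasFDerivWithinAt).def hε
  have h2 := eventually_differentiableWithinAt hx one_le_two hg
  obtain ⟨δ, hδ, hball⟩ := Metric.mem_nhdsWithin_iff.1 (h1.and h2)
  refine Metric.mem_nhdsWithin_iff.2 ⟨δ, hδ, fun y hy => ?_⟩
  set T := S ∩ closedBall x ‖y - x‖ with hT
  have hTc : Convex ℝ T := hS.convex.inter (convex_closedBall _ _)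
  have hTb : ∀ z ∈ T, z ∈ ball x δ ∩ S := by
    intro z hz
    refine ⟨?_, hz.1⟩
    have h3 : dist z x ≤ ‖y - x‖ := hz.2
    have h4 : ‖y - x‖ < δ := by simpa [dist_eq_norm] using hy.1
    exact lt_of_le_of_lt h3 h4
  -- By symmetry of B the derivative of this remainder is the first-order error of Dg, which is at
  -- most ε‖y - x‖ on the convex set T. The mean value inequality on T finishes the expansion.
  let φ : V → ℝ := fun z => g z - fderivWithin ℝ g S x (z - x) - B (z - x) (z - x) / 2
  have hφ : ∀ z ∈ T, HasFDerivWithinAt φ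
      (fderivWithin ℝ g S z - fderivWithin ℝ g S x - B (z - x)) T z := by
    intro z hz
    have d1 := ((hball (hTb z hz)).2.hasFDerivWithinAt).mono (inter_subset_left : T ⊆ S)
    have d0 : HasFDerivWithinAt (fun z : V => z - x) (ContinuousLinearMap.id ℝ V) T z :=
      (hasFDerivWithinAt_id z T).sub_const x
    have d2 := (fderivWithin ℝ g S x).hasFDerivAt.comp_hasFDerivWithinAt z d0
    have d3 := (B.hasFDerivAt.comp_hasFDerivWithinAt z d0).clm_apply d0
    have := (d1.sub d2).sub (d3.mul_const (1/2 : ℝ))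
    have e : φ = fun z => g z - (fderivWithin ℝ g S x) (z - x)
        - (B (z - x)) (z - x) * (1/2 : ℝ) := by
      ext z; simp only [φ]; ring
    rw [e]
    refine HasFDerivWithinAt.congr_fderiv this ?_
    ext w
    have hs := hg.isSymmSndFDerivWithinAt (by simp) hS.uniqueDiffOn
      (hS.mem_closure_interior hx) hx w (z - x)
    rw [← hB] at hs
    simp only [map_sub, sub_apply] at hs
    simp
    rw [hs]; ring
  have hbd : ∀ z ∈ T, ‖fderivWithin ℝ g S z - fderivWithin ℝ g S x - B (z - x)‖
      ≤ ε * ‖y - x‖ := by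
    intro z hz
    refine (hball (hTb z hz)).1.trans ?_
    have : ‖z - x‖ ≤ ‖y - x‖ := by simpa [dist_eq_norm] using hz.2
    gcongr
  have hxT : x ∈ T := ⟨hx, by simp⟩
  have hyT : y ∈ T := ⟨hy.2, by simp [dist_eq_norm]⟩
  have := hTc.norm_image_sub_le_of_norm_hasFDerivWithin_le hφ hbd hxT hyT
  simp only [φ, sub_self, map_zero, zero_div, sub_zero, Real.norm_eq_abs] at this
  simp only [mem_ofPred_eq]
  rw [pd_pd_eq hS hx _ _ hg, pow_two, ← mul_assoc]
  refine le_trans (le_of_eq ?_) this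
  congr 1
  simp only [pd, ← hB]; ring

theorem pd_pd_smul_vec (hS : ConvexBody S) (hx : x ∈ S) (e : V) (t : ℝ)
    (hg : ContDiffWithinAt ℝ 2 g S x) :
    pd S (t • e) (pd S (t • e) g) x = t ^ 2 * pd S e (pd S e g) x := by
  rw [pd_pd_eq hS hx _ _ hg, pd_pd_eq hS hx _ _ hg]; simp; ring

theorem pd_eq_zero_of_isLocalMax (hx : x ∈ interior S) (hm : IsLocalMax g x) (e : V) :
    pd S e g x = 0 := by
  unfold pd
  rw [fderivWithin_of_mem_nhds (mem_interior_iff_mem_nhds.1 hx), hm.fderiv_eq_zero]; rfl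

theorem pd_pd_nonpos_of_isLocalMax (hS : ConvexBody S) (hx : x ∈ interior S)
    (hg : ContDiffWithinAt ℝ 2 g S x) (hm : IsLocalMax g x) (e : V) :
    pd S e (pd S e g) x ≤ 0 := by
  by_contra hn
  push Not at hn
  set D := pd S e (pd S e g) x
  have hxS := interior_subset hx
  set ε := D / (4 * (‖e‖ ^ 2 + 1)) with hε
  have hεp : 0 < ε := by positivity
  have h1 := taylor_two hS hxS hg hεp
  rw [nhdsWithin_eq_nhds.2 (mem_interior_iff_mem_nhds.1 hx)] at h1
  have hcont : Tendsto (fun t : ℝ => x + t • e) (𝓝[>] 0) (𝓝 x) := by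
    have : Continuous fun t : ℝ => x + t • e := by fun_prop
    have h2 := this.tendsto 0
    simp only [zero_smul, add_zero] at h2
    exact h2.mono_left nhdsWithin_le_nhds
  obtain ⟨t, ⟨h2, h3⟩, ht⟩ := ((hcont.eventually (h1.and hm)).and self_mem_nhdsWithin).exists
  rw [add_sub_cancel_left, pd_pd_smul_vec hS hxS e t hg, pd_smul_vec,
    pd_eq_zero_of_isLocalMax hx hm, norm_smul, mul_pow, Real.norm_eq_abs, sq_abs] at h2
  have h4 := (abs_le.1 h2).1
  have ht' : (0:ℝ) < t ^ 2 := by have : (0:ℝ) < t := ht; positivity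
  have h5 : ε * ‖e‖ ^ 2 ≤ D / 4 := by
    rw [hε, div_mul_eq_mul_div, div_le_div_iff₀ (by positivity) (by norm_num)]
    nlinarith [sq_nonneg ‖e‖]
  nlinarith

/-- At a maximum relative to `S`, derivatives along inward directions are non-positive. -/
theorem pd_nonpos_of_eventually_le (hg : DifferentiableWithinAt ℝ g S x)
    {e : V} (he : ∀ᶠ t in 𝓝[>] (0:ℝ), x + t • e ∈ S ∧ g (x + t • e) ≤ g x) : pd S e g x ≤ 0 := by
  by_contra hn
  push Not at hn
  have h1 := hg.hasFDerivWithinAt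
  set ε := pd S e g x / (2 * (‖e‖ + 1)) with hε
  have hεp : 0 < ε := by positivity
  have h2 := (hasFDerivWithinAt_iff_isLittleO.1 h1).def hεp
  have hcont : Tendsto (fun t : ℝ => x + t • e) (𝓝[>] 0) (𝓝[S] x) := by
    refine tendsto_nhdsWithin_iff.2 ⟨?_, he.mono fun t h => h.1⟩
    have : Continuous fun t : ℝ => x + t • e := by fun_prop
    have h2 := this.tendsto 0
    simp only [zero_smul, add_zero] at h2
    exact h2.mono_left nhdsWithin_le_nhds
  obtain ⟨t, ⟨h3, h4⟩, ht⟩ := (((hcont.eventually h2).and he).and self_mem_nhdsWithin).exists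
  have ht' : (0:ℝ) < t := ht
  rw [add_sub_cancel_left, norm_smul, Real.norm_eq_abs, Real.norm_eq_abs, abs_of_pos ht',
    map_smul, smul_eq_mul] at h3
  have h5 := (abs_le.1 h3).1
  have h6 : ε * ‖e‖ ≤ pd S e g x / 2 := by
    rw [hε, div_mul_eq_mul_div, div_le_div_iff₀ (by positivity) (by norm_num)]
    nlinarith [norm_nonneg e]
  change _ ≤ _ - _ - t * pd S e g x at h5
  nlinarith [h4.2]

/-- Boundary points of `Ω` approaching `y` in a direction tangential to `∂Ω`. -/
theorem exists_seq_frontier_tangent {Ω : Set V} {y τ : V} {r : ℝ} {ρ : V → ℝ}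
    (hr : 0 < r) (hmem : ∀ x ∈ ball y r, x ∈ Ω ↔ ρ x < 0) (hy : ρ y = 0)
    (hρ : DifferentiableAt ℝ ρ y) (hne : fderiv ℝ ρ y ≠ 0) (hτ : fderiv ℝ ρ y τ = 0) :
    ∃ (z : ℕ → V) (t : ℕ → ℝ), (∀ j, 0 < t j) ∧ Tendsto t atTop (𝓝 0) ∧
      (∀ j, z j ∈ frontier Ω) ∧ Tendsto (fun j => (t j)⁻¹ • (z j - y)) atTop (𝓝 τ) := by
  obtain ⟨m, hm⟩ : ∃ m, fderiv ℝ ρ y m = 1 := by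
    obtain ⟨m, hm⟩ : ∃ m, fderiv ℝ ρ y m ≠ 0 := by
      by_contra hcon
      push Not at hcon
      exact hne (by ext m; simpa using hcon m)
    exact ⟨(fderiv ℝ ρ y m)⁻¹ • m, by simp [hm]⟩
  have key : ∀ η : ℝ, 0 < η → ∃ t z, 0 < t ∧ t < η ∧ z ∈ frontier Ω ∧
      ‖t⁻¹ • (z - y) - τ‖ ≤ η * ‖m‖ := by
    intro η hη
    have hD := hρ.hasFDerivAt
    have hline : ∀ s : ℝ, Tendsto (fun t : ℝ => y + t • (τ + s • m)) (𝓝[>] 0) (𝓝 y) := by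
      intro s
      have : Continuous fun t : ℝ => y + t • (τ + s • m) := by fun_prop
      have h2 := this.tendsto 0
      simp only [zero_smul, add_zero] at h2
      exact h2.mono_left nhdsWithin_le_nhds
    have hsl : ∀ s : ℝ, Tendsto (fun t : ℝ => t⁻¹ * ρ (y + t • (τ + s • m))) (𝓝[>] 0) (𝓝 s) := by
      intro s
      have h1 : HasDerivAt (fun t : ℝ => ρ (y + t • (τ + s • m))) s 0 := by
        have h2 : HasDerivAt (fun t : ℝ => y + t • (τ + s • m)) (τ + s • m) 0 := by
          simpa using ((hasDerivAt_id (0:ℝ)).smul_const (τ + s • m)).const_add y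
        have h3 : HasFDerivAt ρ (fderiv ℝ ρ y) (y + (0:ℝ) • (τ + s • m)) := by simpa using hD
        have h4 := h3.comp_hasDerivAt (0:ℝ) h2
        refine h4.congr_deriv ?_
        simp [hτ, hm]
      have := h1.tendsto_slope_zero_right
      simpa [hy] using this
    have e1 := (hsl η).eventually (lt_mem_nhds hη)
    have e2 := (hsl (-η)).eventually (gt_mem_nhds (neg_lt_zero.2 hη))
    have e3 := (hline η).eventually (ball_mem_nhds y hr)
    have e4 := (hline (-η)).eventually (ball_mem_nhds y hr)
    obtain ⟨t, ⟨⟨⟨h1, h2⟩, h3⟩, h4⟩, ht0, htη⟩ :=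
      ((((e1.and e2).and e3).and e4).and (Ioo_mem_nhdsGT hη)).exists
    have p1 : 0 < ρ (y + t • (τ + η • m)) := (mul_pos_iff_of_pos_left (inv_pos.2 ht0)).1 h1
    have p2 : ρ (y + t • (τ + (-η) • m)) < 0 := by
      by_contra hcon
      push Not at hcon
      have := mul_nonneg (inv_pos.2 ht0).le hcon
      linarith
    -- The short transversal segment runs from ρ < 0 to ρ > 0, so by connectedness it meets the
    -- frontier within tη‖m‖ of y + tτ. This gives tangential boundary sequences without a
    -- parametrization of the boundary.
    let γ : ℝ → V := fun s => y + t • (τ + s • m)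
    have hγ : Continuous γ := by fun_prop
    have hpre : IsPreconnected (γ '' Icc (-η) η) :=
      isPreconnected_Icc.image γ hγ.continuousOn
    have hn1 : (γ '' Icc (-η) η ∩ Ω).Nonempty :=
      ⟨γ (-η), ⟨_, ⟨le_rfl, by linarith⟩, rfl⟩, (hmem _ h4).2 p2⟩
    have hn2 : (γ '' Icc (-η) η ∩ Ωᶜ).Nonempty :=
      ⟨γ η, ⟨_, ⟨by linarith, le_rfl⟩, rfl⟩, fun h => by
        have := (hmem _ h3).1 h; linarith⟩
    obtain ⟨_, ⟨s, hs, rfl⟩, hz⟩ : (γ '' Icc (-η) η ∩ frontier Ω).Nonempty := by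
      by_contra hcon
      rw [not_nonempty_iff_eq_empty] at hcon
      have hcov : γ '' Icc (-η) η ⊆ interior Ω ∪ (closure Ω)ᶜ := by
        intro w hw
        by_cases hwc : w ∈ closure Ω
        · left
          by_contra hwi
          have : w ∈ γ '' Icc (-η) η ∩ frontier Ω := ⟨hw, hwc, hwi⟩
          rw [hcon] at this; exact this
        · right; exact hwc
      have hz := hpre (interior Ω) (closure Ω)ᶜ isOpen_interior isClosed_closure.isOpen_compl hcov
        (by
          obtain ⟨w, hw, hwΩ⟩ := hn1
          refine ⟨w, hw, ?_⟩
          rcases hcov hw with h | h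
          · exact h
          · exact absurd (subset_closure hwΩ) h)
        (by
          obtain ⟨w, hw, hwΩ⟩ := hn2
          refine ⟨w, hw, ?_⟩
          rcases hcov hw with h | h
          · exact absurd (interior_subset h) hwΩ
          · exact h)
      obtain ⟨w, _, hw1, hw2⟩ := hz
      exact hw2 (subset_closure (interior_subset hw1))
    refine ⟨t, γ s, ht0, htη, hz, ?_⟩
    have : t⁻¹ • (γ s - y) - τ = s • m := by
      simp only [γ, add_sub_cancel_left, smul_smul, inv_mul_cancel₀ ht0.ne', one_smul]
    rw [this, norm_smul, Real.norm_eq_abs]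
    gcongr
    exact abs_le.2 hs
  choose t z h1 h2 h3 h4 using fun j : ℕ => key (1 / ((j:ℝ) + 1)) (by positivity)
  refine ⟨z, t, h1, ?_, h3, ?_⟩
  · exact squeeze_zero (fun j => (h1 j).le) (fun j => (h2 j).le)
      tendsto_one_div_add_atTop_nhds_zero_nat
  · rw [tendsto_iff_norm_sub_tendsto_zero]
    refine squeeze_zero (fun j => norm_nonneg _) h4 ?_
    simpa using tendsto_one_div_add_atTop_nhds_zero_nat.mul_const ‖m‖

/-- A `C²` function vanishing at points approaching `y` along `τ` has vanishing derivative
along `τ`; if its full derivative vanishes, so does its second derivative along `τ`. -/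
theorem pd_eq_zero_of_seq (hS : ConvexBody S) (hx : x ∈ S) (hg : ContDiffWithinAt ℝ 2 g S x)
    (hg0 : g x = 0) {z : ℕ → V} {t : ℕ → ℝ} {τ : V} (ht : ∀ j, 0 < t j)
    (ht0 : Tendsto t atTop (𝓝 0)) (hz : ∀ j, z j ∈ S) (hgz : ∀ᶠ j in atTop, g (z j) = 0)
    (hτ : Tendsto (fun j => (t j)⁻¹ • (z j - x)) atTop (𝓝 τ)) :
    pd S τ g x = 0 ∧ ((∀ v, pd S v g x = 0) → pd S τ (pd S τ g) x = 0) := by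
  set L := fderivWithin ℝ g S x with hL
  set B := fderivWithin ℝ (fderivWithin ℝ g S) S x with hB
  set d : ℕ → V := fun j => (t j)⁻¹ • (z j - x) with hd
  have hzd : ∀ j, z j - x = t j • d j := fun j => by
    rw [hd, smul_smul, mul_inv_cancel₀ (ht j).ne', one_smul]
  have hzx : Tendsto z atTop (𝓝[S] x) := by
    refine tendsto_nhdsWithin_iff.2 ⟨?_, Eventually.of_forall hz⟩
    have : Tendsto (fun j => x + t j • d j) atTop (𝓝 (x + (0:ℝ) • τ)) :=
      (ht0.smul hτ).const_add x
    simp only [zero_smul, add_zero] at this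
    refine this.congr fun j => ?_
    rw [← hzd]; abel
  have hLd : Tendsto (fun j => L (d j)) atTop (𝓝 (L τ)) := (L.continuous.tendsto τ).comp hτ
  have hBd : Tendsto (fun j => B (d j) (d j)) atTop (𝓝 (B τ τ)) :=
    ((B.continuous.clm_apply continuous_id).tendsto τ).comp hτ
  have hnd : Tendsto (fun j => ‖d j‖ ^ 2) atTop (𝓝 (‖τ‖ ^ 2)) := (hτ.norm).pow 2
  -- The second-order expansion of g at the points z_j = x + t_j d_j, divided once by t_j. Letting j
  -- → ∞ gives Lτ = 0; if L = 0, a second division by t_j gives B(τ, τ) = 0.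
  have key : ∀ ε : ℝ, 0 < ε → ∀ᶠ j in atTop,
      |L (d j) + t j * (B (d j) (d j) / 2)| ≤ t j * (ε * ‖d j‖ ^ 2) := by
    intro ε hε
    filter_upwards [hzx.eventually (taylor_two hS hx hg hε), hgz] with j hj hj0
    rw [hj0, hg0, pd_pd_eq hS hx _ _ hg, ← hB, hzd, norm_smul, Real.norm_eq_abs,
      abs_of_pos (ht j)] at hj
    simp only [pd, ← hL, map_smul, smul_apply, smul_eq_mul] at hj
    have e : (0:ℝ) - 0 - t j * L (d j) - t j * (t j * B (d j) (d j)) / 2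
      = -(t j * (L (d j) + t j * (B (d j) (d j) / 2))) := by ring
    rw [e, abs_neg, abs_mul, abs_of_pos (ht j)] at hj
    refine le_of_mul_le_mul_left (hj.trans (le_of_eq ?_)) (ht j)
    ring
  constructor
  · have h1 : Tendsto (fun j => |L (d j) + t j * (B (d j) (d j) / 2)|) atTop (𝓝 |L τ|) := by
      have := (hLd.add (ht0.mul (hBd.div_const 2))).abs
      simpa using this
    have h2 : Tendsto (fun j => t j * (1 * ‖d j‖ ^ 2)) atTop (𝓝 0) := by
      simpa using ht0.mul hnd
    have := le_of_tendsto_of_tendsto h1 h2 (key 1 one_pos)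
    exact abs_nonpos_iff.1 this
  · intro hv
    rw [pd_pd_eq hS hx _ _ hg, ← hB]
    have hL0 : ∀ v, L v = 0 := hv
    have h3 : ∀ ε : ℝ, 0 < ε → |B τ τ / 2| ≤ ε * ‖τ‖ ^ 2 := by
      intro ε hε
      refine le_of_tendsto_of_tendsto (hBd.div_const 2).abs (hnd.const_mul ε) ?_
      filter_upwards [key ε hε] with j hj
      rw [hL0, zero_add, abs_mul, abs_of_pos (ht j)] at hj
      exact le_of_mul_le_mul_left hj (ht j)
    have h4 : |B τ τ / 2| ≤ 0 := by
      have : Tendsto (fun ε : ℝ => ε * ‖τ‖ ^ 2) (𝓝[>] 0) (𝓝 0) := by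
        have : Continuous fun ε : ℝ => ε * ‖τ‖ ^ 2 := by fun_prop
        simpa using (this.tendsto 0).mono_left nhdsWithin_le_nhds
      refine ge_of_tendsto this ?_
      filter_upwards [self_mem_nhdsWithin] with ε hε using h3 ε hε
    have := abs_nonpos_iff.1 h4
    linarith

end Calculus
end HessianNeumann

namespace HessianNeumann

/-! ### Uniform bounds for 2-jets, modulo bounded multiples of a reference Hessian. -/

section BoundedJets
open Filter Topology

variable {V : Type*} [NormedAddCommGroup V] [NormedSpace ℝ V]

/-- `F` is `C^m` at `q` within `Z`, with derivatives of order at most `m` bounded by `C`. -/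
structure DerivBound (m : ℕ) (C : ℝ) (F : V → ℝ) (Z : Set V) (q : V) : Prop where
  contDiff : ContDiffWithinAt ℝ m F Z q
  bound : ∀ j ≤ m, ‖iteratedFDerivWithin ℝ j F Z q‖ ≤ C

variable {Z : Set V} {q : V} {F : V → ℝ} {C : ℝ} {m : ℕ}

theorem DerivBound.nonneg (h : DerivBound m C F Z q) : 0 ≤ C :=
  (norm_nonneg _).trans (h.bound 0 (Nat.zero_le _))

theorem DerivBound.of_le {m' : ℕ} (h : DerivBound m C F Z q) (hm : m' ≤ m) :
    DerivBound m' C F Z q :=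
  ⟨h.contDiff.of_le (by exact_mod_cast hm), fun j hj => h.bound j (hj.trans hm)⟩

theorem DerivBound.abs_le (h : DerivBound m C F Z q) : |F q| ≤ C := by
  simpa using h.bound 0 (Nat.zero_le _)

theorem DerivBound.abs_pd_le (h : DerivBound (m + 1) C F Z q) (hZ : ConvexBody Z) (hq : q ∈ Z)
    (v : V) : |pd Z v F q| ≤ C * ‖v‖ := by
  have h1 := h.bound 1 (by omega)
  rw [norm_iteratedFDerivWithin_one _ (hZ.uniqueDiffOn q hq)] at h1
  exact (fderivWithin ℝ F Z q).le_of_opNorm_le h1 v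

theorem DerivBound.pd (h : DerivBound (m + 1) C F Z q) (hZ : ConvexBody Z) (hq : q ∈ Z) (v : V) :
    DerivBound m (‖v‖ * C) (pd Z v F) Z q := by
  have hc : ContDiffWithinAt ℝ m (fderivWithin ℝ F Z) Z q :=
    h.contDiff.fderivWithin_right hZ.uniqueDiffOn (by norm_cast) hq
  refine ⟨contDiffWithinAt_pd hZ hq h.contDiff (by norm_cast) v, fun j hj => ?_⟩
  have h1 := norm_iteratedFDerivWithin_clm_apply_const (c := v) hc hZ.uniqueDiffOn hq
    (show (j : WithTop ℕ∞) ≤ m by exact_mod_cast hj)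
  rw [norm_iteratedFDerivWithin_fderivWithin hZ.uniqueDiffOn hq] at h1
  refine h1.trans ?_
  gcongr
  exact h.bound (j + 1) (by omega)

/-- A point of a convex body, with a reference function there. -/
structure PointData (V : Type*) [NormedAddCommGroup V] [NormedSpace ℝ V] where
  S : Set V
  u : V → ℝ
  x : V
  body : ConvexBody S
  mem : x ∈ S
  contDiff : ContDiffWithinAt ℝ 2 u S x

/-- The 2-jet of `g` at the point is bounded by `C`, up to a bounded multiple of the Hessian of
the reference function. -/
structure JetBound (D : PointData V) (C : ℝ) (g : V → ℝ) : Prop where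
  contDiff : ContDiffWithinAt ℝ 2 g D.S D.x
  val : |g D.x| ≤ C
  der : ∀ e, |pd D.S e g D.x| ≤ C * ‖e‖
  hess : ∃ β, |β| ≤ C ∧ ∀ e,
    |pd D.S e (pd D.S e g) D.x - β * pd D.S e (pd D.S e D.u) D.x| ≤ C * ‖e‖ ^ 2

theorem JetBound.nonneg {D : PointData V} {C : ℝ} {g : V → ℝ} (h : JetBound D C g) : 0 ≤ C :=
  (abs_nonneg _).trans h.val

theorem JetBound.mono {D : PointData V} {C C' : ℝ} {g : V → ℝ} (h : JetBound D C g)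
    (hC : C ≤ C') : JetBound D C' g := by
  obtain ⟨β, h1, h2⟩ := h.hess
  exact ⟨h.contDiff, h.val.trans hC, fun e => (h.der e).trans (by gcongr),
    β, h1.trans hC, fun e => (h2 e).trans (by gcongr)⟩

theorem JetBound.const (D : PointData V) (c : ℝ) : JetBound D |c| (fun _ => c) := by
  have h0 : ∀ e, HessianNeumann.pd D.S e (fun _ : V => c) = fun _ => 0 := by
    intro e; ext; exact pd_const _ _ _
  refine ⟨contDiffWithinAt_const, le_rfl, fun e => ?_, 0, by simp, fun e => ?_⟩
  · rw [h0]; simp; positivity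
  · rw [h0, pd_const]; simp; positivity

theorem JetBound.add {D : PointData V} {C C' : ℝ} {g h : V → ℝ} (hg : JetBound D C g)
    (hh : JetBound D C' h) : JetBound D (C + C') (fun y => g y + h y) := by
  obtain ⟨β, h1, h2⟩ := hg.hess
  obtain ⟨β', h1', h2'⟩ := hh.hess
  refine ⟨hg.contDiff.add hh.contDiff, (abs_add_le _ _).trans (add_le_add hg.val hh.val),
    fun e => ?_, β + β', (abs_add_le _ _).trans (add_le_add h1 h1'), fun e => ?_⟩
  · rw [pd_add D.body D.mem e (hg.contDiff.differentiableWithinAt two_ne_zero)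
      (hh.contDiff.differentiableWithinAt two_ne_zero), add_mul]
    exact (abs_add_le _ _).trans (add_le_add (hg.der e) (hh.der e))
  · rw [pd_pd_add D.body D.mem e e hg.contDiff hh.contDiff]
    have := (abs_add_le _ _).trans (add_le_add (h2 e) (h2' e))
    rw [add_mul C]
    refine le_trans (le_of_eq ?_) this
    congr 1; ring

theorem JetBound.mul {D : PointData V} {C C' : ℝ} {g h : V → ℝ} (hg : JetBound D C g)
    (hh : JetBound D C' h) : JetBound D (4 * (C * C')) (fun y => g y * h y) := by
  obtain ⟨β, h1, h2⟩ := hg.hess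
  obtain ⟨β', h1', h2'⟩ := hh.hess
  have hC := hg.nonneg
  have hC' := hh.nonneg
  have hCC := mul_nonneg hC hC'
  have bd : ∀ {a b A B : ℝ}, |a| ≤ A → |b| ≤ B → |a * b| ≤ A * B := by
    intro a b A B ha hb
    rw [abs_mul]; exact mul_le_mul ha hb (abs_nonneg _) ((abs_nonneg _).trans ha)
  refine ⟨hg.contDiff.mul hh.contDiff, (bd hg.val hh.val).trans (by linarith),
    fun e => ?_, g D.x * β' + β * h D.x, ?_, fun e => ?_⟩
  · rw [pd_mul D.body D.mem e (hg.contDiff.differentiableWithinAt two_ne_zero)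
      (hh.contDiff.differentiableWithinAt two_ne_zero)]
    refine (abs_add_le _ _).trans ?_
    have := add_le_add (bd hg.val (hh.der e)) (bd (hg.der e) hh.val)
    refine this.trans ?_
    nlinarith [mul_nonneg hCC (norm_nonneg e)]
  · refine (abs_add_le _ _).trans ((add_le_add (bd hg.val h1') (bd h1 hh.val)).trans ?_)
    linarith
  · rw [pd_pd_mul D.body D.mem e e hg.contDiff hh.contDiff]
    have e1 := bd hg.val (h2' e)
    have e2 := bd (hg.der e) (hh.der e)
    have e3 := bd (h2 e) hh.val
    set w := HessianNeumann.pd D.S e (HessianNeumann.pd D.S e D.u) D.x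
    set gx := g D.x
    set hx := h D.x
    set ge := HessianNeumann.pd D.S e g D.x
    set he := HessianNeumann.pd D.S e h D.x
    set gee := HessianNeumann.pd D.S e (HessianNeumann.pd D.S e g) D.x
    set hee := HessianNeumann.pd D.S e (HessianNeumann.pd D.S e h) D.x
    have e4 : gx * hee + ge * he + ge * he + gee * hx - (gx * β' + β * hx) * w
      = gx * (hee - β' * w) + ge * he + ge * he + (gee - β * w) * hx := by ring
    rw [e4]
    refine (abs_add_le _ _).trans ?_
    have e5 := (abs_add_le (gx * (hee - β' * w) + ge * he) (ge * he)).trans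
      (add_le_add ((abs_add_le _ _).trans (add_le_add e1 e2)) e2)
    refine (add_le_add e5 e3).trans (le_of_eq ?_)
    ring

theorem JetBound.comp {D : PointData V} {C C' : ℝ} {g : V → ℝ} (hg : JetBound D C g)
    {Θ : ℝ → ℝ} (hΘ : ContDiffAt ℝ 2 Θ (g D.x)) (h0 : |Θ (g D.x)| ≤ C')
    (h1 : |deriv Θ (g D.x)| ≤ C') (h2 : |deriv (deriv Θ) (g D.x)| ≤ C') :
    JetBound D (C' * (1 + C + C ^ 2)) (fun y => Θ (g y)) := by
  obtain ⟨β, h3, h4⟩ := hg.hess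
  have hC := hg.nonneg
  have hC' : 0 ≤ C' := (abs_nonneg _).trans h0
  have bd : ∀ {a b A B : ℝ}, |a| ≤ A → |b| ≤ B → |a * b| ≤ A * B := by
    intro a b A B ha hb
    rw [abs_mul]; exact mul_le_mul ha hb (abs_nonneg _) ((abs_nonneg _).trans ha)
  have m1 : C' ≤ C' * (1 + C + C ^ 2) := by nlinarith [mul_nonneg hC' hC, mul_nonneg hC' (sq_nonneg C)]
  have m2 : C' * C ≤ C' * (1 + C + C ^ 2) := by nlinarith [mul_nonneg hC' (sq_nonneg C)]
  have m3 : C' * C + C' * C * C ≤ C' * (1 + C + C ^ 2) := by nlinarith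
  refine ⟨hΘ.comp_contDiffWithinAt _ hg.contDiff, h0.trans m1, fun e => ?_,
    deriv Θ (g D.x) * β, (bd h1 h3).trans m2, fun e => ?_⟩
  · rw [pd_comp D.body D.mem e (hΘ.differentiableAt two_ne_zero)
      (hg.contDiff.differentiableWithinAt two_ne_zero)]
    refine (bd h1 (hg.der e)).trans ?_
    rw [← mul_assoc]; gcongr
  · rw [pd_pd_comp D.body D.mem e e hΘ hg.contDiff]
    have e1 := bd h1 (h4 e)
    have e2 := bd (bd h2 (hg.der e)) (hg.der e)
    set w := HessianNeumann.pd D.S e (HessianNeumann.pd D.S e D.u) D.x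
    set ge := HessianNeumann.pd D.S e g D.x
    set gee := HessianNeumann.pd D.S e (HessianNeumann.pd D.S e g) D.x
    have e3 : deriv Θ (g D.x) * gee + deriv (deriv Θ) (g D.x) * ge * ge
        - deriv Θ (g D.x) * β * w
        = deriv Θ (g D.x) * (gee - β * w) + deriv (deriv Θ) (g D.x) * ge * ge := by ring
    rw [e3]
    refine (abs_add_le _ _).trans ((add_le_add e1 e2).trans ?_)
    calc C' * (C * ‖e‖ ^ 2) + C' * (C * ‖e‖) * (C * ‖e‖)
        = (C' * C + C' * C * C) * ‖e‖ ^ 2 := by ring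
      _ ≤ _ := by gcongr

theorem convexBody_univ : ConvexBody (univ : Set V) := ⟨convex_univ, by simp⟩

theorem pd_eq_pd_univ {S : Set V} {x : V} {g : V → ℝ} (hS : ConvexBody S) (hx : x ∈ S)
    (hg : DifferentiableAt ℝ g x) (e : V) : HessianNeumann.pd S e g x = HessianNeumann.pd univ e g x := by
  unfold HessianNeumann.pd
  rw [hg.fderivWithin (hS.uniqueDiffOn x hx), fderivWithin_univ]

theorem pd_pd_eq_pd_pd_univ {S : Set V} {x : V} {g : V → ℝ} (hS : ConvexBody S) (hx : x ∈ S)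
    (hg : ContDiffAt ℝ 2 g x) (e e' : V) :
    HessianNeumann.pd S e (HessianNeumann.pd S e' g) x
      = HessianNeumann.pd univ e (HessianNeumann.pd univ e' g) x := by
  have h1 : HessianNeumann.pd S e' g =ᶠ[𝓝[S] x] HessianNeumann.pd univ e' g := by
    have h2 : ∀ᶠ y in 𝓝 x, DifferentiableAt ℝ g y := by
      filter_upwards [(hg.of_le one_le_two).eventually (by simp)] with t ht
      exact ht.differentiableAt one_ne_zero
    filter_upwards [nhdsWithin_le_nhds h2, self_mem_nhdsWithin] with y hy hyS
    exact pd_eq_pd_univ hS hyS hy e'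
  rw [pd_congr hx e h1]
  refine pd_eq_pd_univ hS hx ?_ e
  have h3 : ContDiffAt ℝ 1 (HessianNeumann.pd univ e' g) x := by
    have := contDiffWithinAt_pd (m := 1) convexBody_univ (mem_univ x) hg.contDiffWithinAt le_rfl e'
    rwa [contDiffWithinAt_univ] at this
  exact h3.differentiableAt one_ne_zero

theorem DerivBound.jetBound {D : PointData V} {C : ℝ} {g : V → ℝ}
    (h : DerivBound 2 C g univ D.x) : JetBound D C g := by
  have hc : ContDiffAt ℝ 2 g D.x := contDiffWithinAt_univ.1 h.contDiff
  refine ⟨hc.contDiffWithinAt, h.abs_le, fun e => ?_, 0, by simpa using h.nonneg, fun e => ?_⟩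
  · rw [pd_eq_pd_univ D.body D.mem (hc.differentiableAt two_ne_zero)]
    exact h.abs_pd_le convexBody_univ (mem_univ _) e
  · rw [pd_pd_eq_pd_pd_univ D.body D.mem hc, zero_mul, sub_zero]
    have h1 := (h.pd convexBody_univ (mem_univ _) e).abs_pd_le convexBody_univ (mem_univ _) e
    refine h1.trans (le_of_eq ?_); ring

theorem ConvexBody.prod_univ {S : Set V} (hS : ConvexBody S) :
    ConvexBody (S ×ˢ (univ : Set ℝ)) := by
  refine ⟨hS.convex.prod convex_univ, ?_⟩
  rw [interior_prod_eq]
  exact hS.nonempty_interior.prod (by simp)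

/-- Derivative of `y ↦ α (y, u y)`. -/
theorem pd_graph {S : Set V} {x : V} {u : V → ℝ} {α : V × ℝ → ℝ} (hS : ConvexBody S) (hx : x ∈ S)
    (hu : DifferentiableWithinAt ℝ u S x)
    (hα : DifferentiableWithinAt ℝ α (S ×ˢ univ) (x, u x)) (e : V) :
    HessianNeumann.pd S e (fun y => α (y, u y)) x =
      HessianNeumann.pd (S ×ˢ univ) (e, 0) α (x, u x)
      + HessianNeumann.pd S e u x * HessianNeumann.pd (S ×ˢ univ) (0, 1) α (x, u x) := by
  have h1 : HasFDerivWithinAt (fun y => (y, u y))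
      ((ContinuousLinearMap.id ℝ V).prod (fderivWithin ℝ u S x)) S x :=
    (hasFDerivWithinAt_id x S).prodMk hu.hasFDerivWithinAt
  have h2 := hα.hasFDerivWithinAt.comp x h1 (fun y hy => mk_mem_prod hy (mem_univ _))
  unfold HessianNeumann.pd
  rw [show (fun y => α (y, u y)) = α ∘ fun y => (y, u y) from rfl,
    h2.fderivWithin (hS.uniqueDiffOn x hx)]
  simp only [ContinuousLinearMap.comp_apply, ContinuousLinearMap.prod_apply,
    ContinuousLinearMap.id_apply]
  rw [← smul_eq_mul, ← map_smul, ← map_add]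
  simp

theorem contDiffWithinAt_graph {S : Set V} {x : V} {u : V → ℝ} {α : V × ℝ → ℝ} {m : WithTop ℕ∞}
    (hu : ContDiffWithinAt ℝ m u S x) (hα : ContDiffWithinAt ℝ m α (S ×ˢ univ) (x, u x)) :
    ContDiffWithinAt ℝ m (fun y => α (y, u y)) S x :=
  hα.comp x (contDiffWithinAt_id.prodMk hu) (fun _ hy => mk_mem_prod hy (mem_univ _))

/-- The coefficient of D²u is kept explicit as the z-derivative of α because its sign is needed when
α is the boundary datum. -/
theorem DerivBound.abs_hess_graph_le {D : PointData V} {C M : ℝ} {α : V × ℝ → ℝ}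
    (hM : ∀ e, |HessianNeumann.pd D.S e D.u D.x| ≤ M * ‖e‖)
    (h : DerivBound 2 C α (D.S ×ˢ univ) (D.x, D.u D.x)) (e : V) :
    |HessianNeumann.pd D.S e (HessianNeumann.pd D.S e fun y => α (y, D.u y)) D.x
      - HessianNeumann.pd (D.S ×ˢ univ) (0, 1) α (D.x, D.u D.x)
        * HessianNeumann.pd D.S e (HessianNeumann.pd D.S e D.u) D.x|
      ≤ C * (1 + M) ^ 2 * ‖e‖ ^ 2 := by
  have hZ := D.body.prod_univ
  have hq : (D.x, D.u D.x) ∈ D.S ×ˢ (univ : Set ℝ) := ⟨D.mem, mem_univ _⟩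
  set Z := D.S ×ˢ (univ : Set ℝ)
  have hn1 : ∀ e : V, ‖((e, 0) : V × ℝ)‖ = ‖e‖ := fun e => by simp [Prod.norm_def]
  have hn2 : ‖((0, 1) : V × ℝ)‖ = 1 := by simp [Prod.norm_def]
  have bd : ∀ {a b A B : ℝ}, |a| ≤ A → |b| ≤ B → |a * b| ≤ A * B := by
    intro a b A B ha hb
    rw [abs_mul]; exact mul_le_mul ha hb (abs_nonneg _) ((abs_nonneg _).trans ha)
  have b2 : ∀ v w, |HessianNeumann.pd Z v (HessianNeumann.pd Z w α) (D.x, D.u D.x)|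
      ≤ ‖w‖ * C * ‖v‖ := fun v w => (h.pd hZ hq w).abs_pd_le hZ hq v
  have ca : ∀ v, ContDiffWithinAt ℝ 1 (HessianNeumann.pd Z v α) Z (D.x, D.u D.x) :=
    fun v => contDiffWithinAt_pd hZ hq h.contDiff le_rfl v
  have du := D.contDiff.differentiableWithinAt two_ne_zero
  have hev : HessianNeumann.pd D.S e (fun y => α (y, D.u y)) =ᶠ[𝓝[D.S] D.x] fun y =>
      HessianNeumann.pd Z (e, 0) α (y, D.u y)
      + HessianNeumann.pd D.S e D.u y * HessianNeumann.pd Z (0, 1) α (y, D.u y) := by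
    have ht : Tendsto (fun y => (y, D.u y)) (𝓝[D.S] D.x) (𝓝[Z] (D.x, D.u D.x)) := by
      refine tendsto_nhdsWithin_iff.2 ⟨?_, ?_⟩
      · exact (continuousWithinAt_id.prodMk D.contDiff.continuousWithinAt)
      · filter_upwards [self_mem_nhdsWithin] with y hy using ⟨hy, mem_univ _⟩
    filter_upwards [eventually_differentiableWithinAt D.mem one_le_two D.contDiff,
      self_mem_nhdsWithin,
      ht.eventually (eventually_differentiableWithinAt hq one_le_two h.contDiff)] with y h1 h2 h3
    exact pd_graph D.body h2 h1 h3 e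
  have cu := contDiffWithinAt_pd (m := 1) D.body D.mem D.contDiff le_rfl e
  have cg : ∀ v, ContDiffWithinAt ℝ 1 (fun y => HessianNeumann.pd Z v α (y, D.u y)) D.S D.x :=
    fun v => contDiffWithinAt_graph (D.contDiff.of_le one_le_two) (ca v)
  have dg := fun v => (cg v).differentiableWithinAt one_ne_zero
  have dd := cu.differentiableWithinAt one_ne_zero
  have da := fun v => (ca v).differentiableWithinAt one_ne_zero
  rw [pd_congr D.mem e hev, pd_add D.body D.mem e (dg _) (dd.fun_mul (dg _)),
    pd_mul D.body D.mem e dd (dg _), pd_graph D.body D.mem du (da _),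
    pd_graph D.body D.mem du (da _)]
  have t1 := b2 (e, 0) (e, 0)
  have t2 := bd (hM e) (b2 (0, 1) (e, 0))
  have t3 := bd (hM e) ((abs_add_le _ _).trans (add_le_add (b2 (e, 0) (0, 1))
    (bd (hM e) (b2 (0, 1) (0, 1)))))
  rw [hn1] at t1 t2
  rw [hn2] at t2
  rw [hn1, hn2] at t3
  set p := HessianNeumann.pd D.S e D.u D.x
  set w := HessianNeumann.pd D.S e (HessianNeumann.pd D.S e D.u) D.x
  have e3 : ∀ a b c d : ℝ, a + p * b + (p * c + w * d) - d * w = a + p * b + p * c := by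
    intro a b c d; ring
  rw [e3]
  refine (abs_add_le _ _).trans ((add_le_add ((abs_add_le _ _).trans (add_le_add t1 t2)) t3).trans
    (le_of_eq ?_))
  ring

theorem DerivBound.jetBound_graph {D : PointData V} {C M : ℝ} {α : V × ℝ → ℝ}
    (hM : ∀ e, |HessianNeumann.pd D.S e D.u D.x| ≤ M * ‖e‖) (hM0 : 0 ≤ M)
    (h : DerivBound 2 C α (D.S ×ˢ univ) (D.x, D.u D.x)) :
    JetBound D (C * (1 + M) ^ 2) (fun y => α (y, D.u y)) := by
  have hZ := D.body.prod_univ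
  have hq : (D.x, D.u D.x) ∈ D.S ×ˢ (univ : Set ℝ) := ⟨D.mem, mem_univ _⟩
  have hC := h.nonneg
  set Z := D.S ×ˢ (univ : Set ℝ)
  have hn1 : ∀ e : V, ‖((e, 0) : V × ℝ)‖ = ‖e‖ := fun e => by simp [Prod.norm_def]
  have hn2 : ‖((0, 1) : V × ℝ)‖ = 1 := by simp [Prod.norm_def]
  have bd : ∀ {a b A B : ℝ}, |a| ≤ A → |b| ≤ B → |a * b| ≤ A * B := by
    intro a b A B ha hb
    rw [abs_mul]; exact mul_le_mul ha hb (abs_nonneg _) ((abs_nonneg _).trans ha)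
  have b1 : ∀ v, |HessianNeumann.pd Z v α (D.x, D.u D.x)| ≤ C * ‖v‖ :=
    fun v => h.abs_pd_le hZ hq v
  have c1 := contDiffWithinAt_graph D.contDiff h.contDiff
  have du := D.contDiff.differentiableWithinAt two_ne_zero
  have hC1 : C * 1 ≤ C * (1 + M) ^ 2 := by
    refine mul_le_mul_of_nonneg_left ?_ hC; nlinarith
  refine ⟨c1, h.abs_le.trans (by linarith), fun e => ?_,
    HessianNeumann.pd Z (0, 1) α (D.x, D.u D.x), ?_, fun e => ?_⟩
  · rw [pd_graph D.body D.mem du (h.contDiff.differentiableWithinAt two_ne_zero)]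
    refine (abs_add_le _ _).trans ((add_le_add (b1 _) (bd (hM e) (b1 _))).trans ?_)
    rw [hn1, hn2]
    have : 0 ≤ C * ‖e‖ := by positivity
    nlinarith [mul_nonneg this hM0, mul_nonneg this (sq_nonneg M)]
  · refine (b1 _).trans ?_
    rw [hn2]; exact hC1
  · exact h.abs_hess_graph_le hM e

variable {I : Type*} (D : I → PointData V)

/-- The 2-jets of a family of functions are uniformly bounded, up to bounded multiples of the
Hessians of the reference functions. -/
def UnifJet (g : I → V → ℝ) : Prop := ∃ C, ∀ i, JetBound (D i) C (g i)

variable {D} {g h : I → V → ℝ}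

theorem UnifJet.const (c : ℝ) : UnifJet D (fun _ _ => c) := ⟨_, fun i => JetBound.const (D i) c⟩

theorem unifJet_const_of_bound {c : I → ℝ} {C : ℝ} (hc : ∀ i, |c i| ≤ C) :
    UnifJet D (fun i _ => c i) := ⟨C, fun i => (JetBound.const (D i) (c i)).mono (hc i)⟩

theorem UnifJet.add (hg : UnifJet D g) (hh : UnifJet D h) :
    UnifJet D (fun i y => g i y + h i y) := by
  obtain ⟨C, hC⟩ := hg
  obtain ⟨C', hC'⟩ := hh
  exact ⟨_, fun i => (hC i).add (hC' i)⟩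

theorem UnifJet.mul (hg : UnifJet D g) (hh : UnifJet D h) :
    UnifJet D (fun i y => g i y * h i y) := by
  obtain ⟨C, hC⟩ := hg
  obtain ⟨C', hC'⟩ := hh
  exact ⟨_, fun i => (hC i).mul (hC' i)⟩

theorem UnifJet.const_mul (c : ℝ) (hg : UnifJet D g) : UnifJet D (fun i y => c * g i y) :=
  (UnifJet.const c).mul hg

theorem UnifJet.neg (hg : UnifJet D g) : UnifJet D (fun i y => -g i y) := by
  simpa using hg.const_mul (-1)

theorem UnifJet.sub (hg : UnifJet D g) (hh : UnifJet D h) :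
    UnifJet D (fun i y => g i y - h i y) := by
  simpa [sub_eq_add_neg] using hg.add hh.neg

theorem UnifJet.sum {ι : Type*} (s : Finset ι) {g : ι → I → V → ℝ}
    (hg : ∀ l ∈ s, UnifJet D (g l)) : UnifJet D (fun i y => ∑ l ∈ s, g l i y) := by
  classical
  induction s using Finset.induction_on with
  | empty => simpa using UnifJet.const (D := D) 0
  | insert a s ha ih =>
    simp only [Finset.sum_insert ha]
    exact (hg a (by simp)).add (ih fun l hl => hg l (by simp [hl]))

/-- All values lie in one compact interval [c, C] of (0, ∞), where Θ, Θ' and Θ'' are bounded; the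
bound therefore does not depend on the member of the family. -/
theorem UnifJet.comp (hg : UnifJet D g) {c : ℝ} (hc : 0 < c) (hgc : ∀ i, c ≤ g i (D i).x)
    {Θ : ℝ → ℝ} (hΘ : ContDiffOn ℝ 2 Θ (Ioi 0)) : UnifJet D (fun i y => Θ (g i y)) := by
  obtain ⟨C, hC⟩ := hg
  have h1 : ContDiffOn ℝ 1 (deriv Θ) (Ioi 0) := hΘ.deriv_of_isOpen isOpen_Ioi le_rfl
  have h2 : ContinuousOn (deriv (deriv Θ)) (Ioi 0) :=
    h1.continuousOn_deriv_of_isOpen isOpen_Ioi le_rfl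
  have hsub : Icc c C ⊆ Ioi 0 := fun t ht => hc.trans_le ht.1
  obtain ⟨B0, hB0⟩ := isCompact_Icc.exists_bound_of_continuousOn (hΘ.continuousOn.mono hsub)
  obtain ⟨B1, hB1⟩ := isCompact_Icc.exists_bound_of_continuousOn (h1.continuousOn.mono hsub)
  obtain ⟨B2, hB2⟩ := isCompact_Icc.exists_bound_of_continuousOn (h2.mono hsub)
  refine ⟨max B0 (max B1 B2) * (1 + C + C ^ 2), fun i => ?_⟩
  have hm : g i (D i).x ∈ Icc c C := ⟨hgc i, (le_abs_self _).trans (hC i).val⟩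
  refine (hC i).comp (hΘ.contDiffAt (Ioi_mem_nhds (hsub hm))) ?_ ?_ ?_
  · exact (hB0 _ hm).trans (le_max_left _ _)
  · exact (hB1 _ hm).trans ((le_max_left _ _).trans (le_max_right _ _))
  · exact (hB2 _ hm).trans ((le_max_right _ _).trans (le_max_right _ _))

end BoundedJets
end HessianNeumann

namespace HessianNeumann

/-! ### Parameters, admissible data, and the differentiated equation. -/

section Setup
open Filter Topology

theorem pd_third_comm {V : Type*} [NormedAddCommGroup V] [NormedSpace ℝ V] {S : Set V} {x : V}
    {g : V → ℝ} (hS : ConvexBody S) (hx : x ∈ S) (hg : ContDiffWithinAt ℝ 3 g S x) (a b c : V) :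
    pd S a (pd S b (pd S c g)) x = pd S b (pd S c (pd S a g)) x := by
  rw [pd_pd_comm hS hx a b (contDiffWithinAt_pd hS hx hg (by norm_num) c)]
  refine pd_congr hx b ?_
  have h2 : ∀ᶠ y in 𝓝[S] x, ContDiffWithinAt ℝ 2 g S y :=
    eventually_contDiffWithinAt hx (by simp) (hg.of_le (by norm_num))
  filter_upwards [h2, self_mem_nhdsWithin] with y hy hyS
  exact pd_pd_comm hS hyS a c hy

theorem pd_fourth_comm {V : Type*} [NormedAddCommGroup V] [NormedSpace ℝ V] {S : Set V} {x : V}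
    {g : V → ℝ} (hS : ConvexBody S) (hx : x ∈ S) (hg : ContDiffWithinAt ℝ 4 g S x) (a b : V) :
    pd S a (pd S a (pd S b (pd S b g))) x = pd S b (pd S b (pd S a (pd S a g))) x := by
  have h1 : pd S a (pd S b (pd S b g)) =ᶠ[𝓝[S] x] pd S b (pd S b (pd S a g)) := by
    have h2 : ∀ᶠ y in 𝓝[S] x, ContDiffWithinAt ℝ 3 g S y :=
      eventually_contDiffWithinAt hx (by simp) (hg.of_le (by norm_num))
    filter_upwards [h2, self_mem_nhdsWithin] with y hy hyS
    exact pd_third_comm hS hyS hy a b b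
  rw [pd_congr hx a h1]
  exact pd_third_comm hS hx (contDiffWithinAt_pd hS hx hg (by norm_num) a) a b b

/-- The parameters on which the estimate depends. -/
structure Params where
  (n k : ℕ)
  (κ r K M A B m : ℝ)
  one_le_k : 1 ≤ k
  k_le_n : k ≤ n
  κ_pos : 0 < κ
  r_pos : 0 < r
  m_pos : 0 < m

/-- A domain, data, and an admissible solution controlled by the parameters. -/
structure Setup (P : Params) where
  Ω : Set (E P.n)
  f : E P.n → ℝ → ℝ
  φ : E P.n → ℝ → ℝ
  u : E P.n → ℝ
  M₀ : ℝ
  isOpen : IsOpen Ω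
  nonempty : Ω.Nonempty
  isBounded : Bornology.IsBounded Ω
  boundary : HasC4Boundary Ω P.r P.K
  unifConvex : UniformlyConvexWith Ω P.κ
  f_contDiff : ContDiffOn ℝ 2 (Function.uncurry f) (closure Ω ×ˢ univ)
  φ_contDiff : ContDiffOn ℝ 3 (Function.uncurry φ) (closure Ω ×ˢ univ)
  φ_antitone : ∀ x ∈ closure Ω, Antitone (φ x)
  u_contDiff_four : ContDiffOn ℝ 4 u Ω
  u_contDiff_three : ContDiffOn ℝ 3 u (closure Ω)
  admissible : KAdmissible P.k Ω u
  solves : SolvesNeumann P.k Ω f φ u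
  isLUB : IsLUB ((fun x => |u x|) '' Ω) M₀
  u_norm : CNormLE 1 u (closure Ω) (closure Ω) P.M
  f_norm : CNormLE 2 (Function.uncurry f) (closure Ω ×ˢ univ) (closure Ω ×ˢ Icc (-M₀) M₀) P.A
  le_f : ∀ x ∈ closure Ω, ∀ z ∈ Icc (-M₀) M₀, P.m ≤ f x z
  φ_norm : CNormLE 3 (Function.uncurry φ) (closure Ω ×ˢ univ) (closure Ω ×ˢ Icc (-M₀) M₀) P.B

namespace Setup

variable {P : Params} (D : Setup P)

/-- The closure of the domain. -/
def S : Set (E P.n) := closure D.Ω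

theorem subset_S : D.Ω ⊆ D.S := subset_closure

theorem isClosed_S : IsClosed D.S := isClosed_closure

theorem isCompact_S : IsCompact D.S := Metric.isCompact_of_isClosed_isBounded D.isClosed_S
  D.isBounded.closure

theorem subset_interior : D.Ω ⊆ interior D.S := D.isOpen.subset_interior_iff.2 D.subset_S

theorem body : ConvexBody D.S :=
  ⟨D.unifConvex.1.closure, D.nonempty.mono D.subset_interior⟩

theorem frontier_eq : frontier D.Ω = D.S \ D.Ω := by
  rw [frontier, D.isOpen.interior_eq]; rfl

theorem mem_or_frontier {x : E P.n} (hx : x ∈ D.S) : x ∈ D.Ω ∨ x ∈ frontier D.Ω := by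
  rw [frontier_eq]
  by_cases h : x ∈ D.Ω
  · exact Or.inl h
  · exact Or.inr ⟨hx, h⟩

theorem frontier_subset : frontier D.Ω ⊆ D.S := frontier_subset_closure

theorem u_three {x : E P.n} (hx : x ∈ D.S) : ContDiffWithinAt ℝ 3 D.u D.S x :=
  D.u_contDiff_three x hx

theorem u_two {x : E P.n} (hx : x ∈ D.S) : ContDiffWithinAt ℝ 2 D.u D.S x :=
  (D.u_three hx).of_le (by norm_num)

theorem u_four {x : E P.n} (hx : x ∈ D.Ω) : ContDiffWithinAt ℝ 4 D.u D.S x :=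
  ((D.u_contDiff_four x hx).contDiffAt (D.isOpen.mem_nhds hx)).contDiffWithinAt

theorem pd_u_two {x : E P.n} (hx : x ∈ D.S) (e : E P.n) :
    ContDiffWithinAt ℝ 2 (pd D.S e D.u) D.S x :=
  contDiffWithinAt_pd D.body hx (D.u_three hx) (by norm_num) e

theorem pd_pd_u_two {x : E P.n} (hx : x ∈ D.Ω) (e e' : E P.n) :
    ContDiffWithinAt ℝ 2 (pd D.S e (pd D.S e' D.u)) D.S x :=
  contDiffWithinAt_pd D.body (D.subset_S hx) (contDiffWithinAt_pd D.body (D.subset_S hx)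
    (D.u_four hx) (m := 3) (by norm_num) e') (by norm_num) e

theorem pd_pd_u_one {x : E P.n} (hx : x ∈ D.S) (e e' : E P.n) :
    ContDiffWithinAt ℝ 1 (pd D.S e (pd D.S e' D.u)) D.S x :=
  contDiffWithinAt_pd D.body hx (D.pd_u_two hx e') (by norm_num) e

/-- The supremum is taken over the open domain; continuity extends the bound to the closure, so the
bounds on f and φ apply along the solution. -/
theorem u_mem_Icc {x : E P.n} (hx : x ∈ D.S) : D.u x ∈ Icc (-D.M₀) D.M₀ := by
  have hc : ContinuousOn (fun x => |D.u x|) (closure D.Ω) :=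
    D.u_contDiff_three.continuousOn.abs
  have h2 := hc.image_closure
  have h3 : (fun x => |D.u x|) '' D.Ω ⊆ Iic D.M₀ := fun y hy => D.isLUB.1 hy
  have h4 : |D.u x| ∈ Iic D.M₀ :=
    (closure_minimal h3 isClosed_Iic) (h2 ⟨x, hx, rfl⟩)
  exact abs_le.1 h4

theorem u_derivBound {x : E P.n} (hx : x ∈ D.S) : DerivBound 1 P.M D.u D.S x :=
  ⟨(D.u_three hx).of_le (by norm_num), fun j hj => D.u_norm x hx j hj⟩

theorem abs_pd_u_le {x : E P.n} (hx : x ∈ D.S) (e : E P.n) : |pd D.S e D.u x| ≤ P.M * ‖e‖ :=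
  (D.u_derivBound hx).abs_pd_le D.body hx e

theorem M_nonneg (D : Setup P) : 0 ≤ P.M := by
  obtain ⟨x, hx⟩ := D.nonempty
  exact (D.u_derivBound (D.subset_S hx)).nonneg

theorem f_derivBound {x : E P.n} (hx : x ∈ D.S) :
    DerivBound 2 P.A (Function.uncurry D.f) (D.S ×ˢ univ) (x, D.u x) :=
  ⟨D.f_contDiff _ (mk_mem_prod hx (mem_univ _)),
    fun j hj => D.f_norm _ (mk_mem_prod hx (D.u_mem_Icc hx)) j hj⟩

theorem φ_derivBound {x : E P.n} (hx : x ∈ D.S) :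
    DerivBound 3 P.B (Function.uncurry D.φ) (D.S ×ˢ univ) (x, D.u x) :=
  ⟨D.φ_contDiff _ (mk_mem_prod hx (mem_univ _)),
    fun j hj => D.φ_norm _ (mk_mem_prod hx (D.u_mem_Icc hx)) j hj⟩

theorem m_le_f {x : E P.n} (hx : x ∈ D.S) : P.m ≤ D.f x (D.u x) :=
  D.le_f x hx _ (D.u_mem_Icc hx)

theorem f_le_A {x : E P.n} (hx : x ∈ D.S) : D.f x (D.u x) ≤ P.A :=
  (le_abs_self _).trans (D.f_derivBound hx).abs_le

/-- The point data of the solution at a point of the closed domain. -/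
def pt {x : E P.n} (hx : x ∈ D.S) : PointData (E P.n) := ⟨D.S, D.u, x, D.body, hx, D.u_two hx⟩

theorem sum_single (a : E P.n) : ∑ i, a i • (EuclideanSpace.single i 1 : E P.n) = a := by
  have := (EuclideanSpace.basisFun (Fin P.n) ℝ).sum_repr a
  simpa using this

theorem bil_hessian {x : E P.n} (hx : x ∈ D.S) (a b : E P.n) :
    bil (hessian D.S D.u x) a b = pd D.S a (pd D.S b D.u) x := by
  rw [bil_eq_sum, pd_pd_eq D.body hx a b (D.u_two hx)]
  conv_rhs => rw [← sum_single a, ← sum_single b]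
  simp only [map_sum, map_smul, sum_apply, smul_apply, smul_eq_mul, Finset.mul_sum]
  rw [Finset.sum_comm]
  refine Finset.sum_congr rfl fun i _ => Finset.sum_congr rfl fun j _ => ?_
  rw [hessian, Matrix.of_apply, iteratedFDerivWithin_two_apply _ D.body.uniqueDiffOn hx]
  simp; ring

theorem hessian_isHermitian {x : E P.n} (hx : x ∈ D.S) : (hessian D.S D.u x).IsHermitian := by
  ext i j
  simp only [Matrix.conjTranspose_apply, star_trivial]
  rw [hessian, Matrix.of_apply, Matrix.of_apply,
    iteratedFDerivWithin_two_apply _ D.body.uniqueDiffOn hx,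
    iteratedFDerivWithin_two_apply _ D.body.uniqueDiffOn hx]
  have := pd_pd_comm D.body hx (EuclideanSpace.single j 1) (EuclideanSpace.single i 1) (D.u_two hx)
  rw [pd_pd_eq D.body hx _ _ (D.u_two hx), pd_pd_eq D.body hx _ _ (D.u_two hx)] at this
  simpa using this

/-- The logarithm of the right-hand side along the solution. -/
def F (y : E P.n) : ℝ := Real.log (D.f y (D.u y))

theorem f_contDiffWithinAt {x : E P.n} (hx : x ∈ D.S) :
    ContDiffWithinAt ℝ 2 (fun y => D.f y (D.u y)) D.S x :=
  contDiffWithinAt_graph (D.u_two hx) (D.f_derivBound hx).contDiff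

theorem F_contDiffWithinAt {x : E P.n} (hx : x ∈ D.S) : ContDiffWithinAt ℝ 2 D.F D.S x :=
  (D.f_contDiffWithinAt hx).log (P.m_pos.trans_le (D.m_le_f hx)).ne'

/-- An eigenframe of the Hessian of the solution at an interior point, with the differentiated
equation. -/
structure InteriorFrame (x : E P.n) (e : OrthonormalBasis (Fin P.n) ℝ (E P.n))
    (lam G : Fin P.n → ℝ) : Prop extends IsFrame P.k (hessian D.S D.u x) e lam G where
  mem : x ∈ D.Ω
  diag : ∀ i j, pd D.S (e i) (pd D.S (e j) D.u) x = if i = j then lam i else 0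
  third : ∀ ξ, ∑ i, G i * pd D.S (e i) (pd D.S (e i) (pd D.S ξ D.u)) x = pd D.S ξ D.F x
  fourth : ∀ ξ, pd D.S ξ (pd D.S ξ D.F) x ≤
    ∑ i, G i * pd D.S (e i) (pd D.S (e i) (pd D.S ξ (pd D.S ξ D.u))) x
  sum_ge : Real.exp (-|Real.log P.A|) ≤ ∑ i, G i

/-- Freeze the frame and the weights at x. By the tangent inequality and the equation, F - Σ G_i
u_ii has a local maximum at x. Its vanishing gradient is the once differentiated equation and the
sign of its Hessian is the concavity inequality for the twice differentiated one, so σ_k and the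
eigenvalues are never differentiated along the solution. -/
theorem exists_interiorFrame {x : E P.n} (hx : x ∈ D.Ω) :
    ∃ e lam G, D.InteriorFrame x e lam G := by
  have hxS := D.subset_S hx
  obtain ⟨e, lam, G, h⟩ := exists_isFrame P.one_le_k P.k_le_n (D.hessian_isHermitian hxS)
    (D.admissible x hx)
  have hdiag : ∀ i j, pd D.S (e i) (pd D.S (e j) D.u) x = if i = j then lam i else 0 :=
    fun i j => by rw [← D.bil_hessian hxS]; exact h.bil_eq i j
  set Ψ : E P.n → ℝ := fun y => D.F y +
    ∑ i, (-G i) * pd D.S (e i) (pd D.S (e i) D.u) y with hΨ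
  have hmax : IsLocalMax Ψ x := by
    filter_upwards [D.isOpen.mem_nhds hx] with y hy
    have h1 := h.tangent _ (D.hessian_isHermitian (D.subset_S hy)) (D.admissible y hy)
    have h2 := D.solves.1 y hy
    have h3 := D.solves.1 x hx
    change sigma P.k (eigenvals (hessian D.S D.u y)) = _ at h2
    change sigma P.k (eigenvals (hessian D.S D.u x)) = _ at h3
    rw [h2, h3] at h1
    simp only [hΨ, F]
    have h4 : ∑ i, G i * (bil (hessian D.S D.u y) (e i) (e i) - lam i)
        = ∑ i, (-G i) * pd D.S (e i) (pd D.S (e i) D.u) x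
          - ∑ i, (-G i) * pd D.S (e i) (pd D.S (e i) D.u) y := by
      rw [← Finset.sum_sub_distrib]
      refine Finset.sum_congr rfl fun i _ => ?_
      rw [D.bil_hessian (D.subset_S hy), hdiag, if_pos rfl]; ring
    rw [h4] at h1
    linarith
  have hc : ∀ i ∈ Finset.univ, ContDiffWithinAt ℝ 2
      (fun y => (-G i) * pd D.S (e i) (pd D.S (e i) D.u) y) D.S x :=
    fun i _ => contDiffWithinAt_const.mul (D.pd_pd_u_two hx _ _)
  have hcs := ContDiffWithinAt.sum hc
  have hcF := D.F_contDiffWithinAt hxS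
  have hcΨ : ContDiffWithinAt ℝ 2 Ψ D.S x := hcF.add hcs
  refine ⟨e, lam, G, h, hx, hdiag, fun ξ => ?_, fun ξ => ?_, ?_⟩
  · have h1 := pd_eq_zero_of_isLocalMax (D.subset_interior hx) hmax ξ
    rw [hΨ, pd_add D.body hxS ξ (hcF.differentiableWithinAt two_ne_zero)
      (hcs.differentiableWithinAt two_ne_zero), pd_sum D.body hxS ξ _
      (fun i hi => (hc i hi).differentiableWithinAt two_ne_zero)] at h1
    have h2 : ∑ i, pd D.S ξ (fun y => (-G i) * pd D.S (e i) (pd D.S (e i) D.u) y) x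
        = -∑ i, G i * pd D.S (e i) (pd D.S (e i) (pd D.S ξ D.u)) x := by
      rw [← Finset.sum_neg_distrib]
      refine Finset.sum_congr rfl fun i _ => ?_
      rw [pd_const_mul D.body hxS ξ _ ((D.pd_pd_u_two hx _ _).differentiableWithinAt two_ne_zero),
        pd_third_comm D.body hxS (D.u_three hxS)]
      ring
    linarith
  · have h1 := pd_pd_nonpos_of_isLocalMax D.body (D.subset_interior hx) hcΨ hmax ξ
    rw [hΨ, pd_pd_add D.body hxS ξ ξ hcF hcs, pd_pd_sum D.body hxS ξ ξ _ hc] at h1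
    have h2 : ∑ i, pd D.S ξ (pd D.S ξ (fun y => (-G i) * pd D.S (e i) (pd D.S (e i) D.u) y)) x
        = -∑ i, G i * pd D.S (e i) (pd D.S (e i) (pd D.S ξ (pd D.S ξ D.u))) x := by
      rw [← Finset.sum_neg_distrib]
      refine Finset.sum_congr rfl fun i _ => ?_
      rw [pd_pd_const_mul D.body hxS ξ ξ _ (D.pd_pd_u_two hx _ _),
        pd_fourth_comm D.body hxS (D.u_four hx)]
      ring
    linarith
  · refine h.le_sum P.A ?_ ?_
    · exact P.m_pos.trans_le ((D.m_le_f hxS).trans (D.f_le_A hxS))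
    · have h3 := D.solves.1 x hx
      change sigma P.k (eigenvals (hessian D.S D.u x)) = _ at h3
      rw [h3]; exact D.f_le_A hxS

end Setup

end Setup
end HessianNeumann

namespace HessianNeumann

/-! ### The linearized operator on bounded jets, first-order expressions and |Du|². -/

section Linearized
open Filter Topology

theorem norm_single_one {n : ℕ} (l : Fin n) : ‖(EuclideanSpace.single l (1:ℝ) : E n)‖ = 1 := by
  simp

namespace Setup

variable {P : Params} (D : Setup P)

/-- The `l`-th partial derivative of the solution. -/
def du (l : Fin P.n) : E P.n → ℝ := pd D.S (EuclideanSpace.single l 1) D.u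

theorem du_two {x : E P.n} (hx : x ∈ D.S) (l : Fin P.n) : ContDiffWithinAt ℝ 2 (D.du l) D.S x :=
  D.pd_u_two hx _

theorem abs_du_le {x : E P.n} (hx : x ∈ D.S) (l : Fin P.n) : |D.du l x| ≤ P.M := by
  have := D.abs_pd_u_le hx (EuclideanSpace.single l 1)
  rw [norm_single_one, mul_one] at this
  exact this

theorem pd_u_eq_sum (e : E P.n) (x : E P.n) : pd D.S e D.u x = ∑ l, e l * D.du l x := by
  conv_lhs => rw [← sum_single e]
  rw [pd_sum_vec]
  exact Finset.sum_congr rfl fun l _ => pd_smul_vec _ _ _ _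

theorem pd_du {x : E P.n} (hx : x ∈ D.S) (e : E P.n) (l : Fin P.n) :
    pd D.S e (D.du l) x = pd D.S (EuclideanSpace.single l 1) (pd D.S e D.u) x :=
  pd_pd_comm D.body hx _ _ (D.u_two hx)

theorem hess_sum_left {x : E P.n} (a b : E P.n) :
    pd D.S a (pd D.S b D.u) x =
      ∑ l, a l * pd D.S (EuclideanSpace.single l 1) (pd D.S b D.u) x := by
  conv_lhs => rw [← sum_single a]
  rw [pd_sum_vec]
  exact Finset.sum_congr rfl fun l _ => pd_smul_vec _ _ _ _

theorem hess_eq_sum {x : E P.n} (hx : x ∈ D.S) (a b : E P.n) :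
    pd D.S a (pd D.S b D.u) x = ∑ l, b l * pd D.S a (D.du l) x := by
  rw [pd_pd_comm D.body hx _ _ (D.u_two hx), hess_sum_left]
  exact Finset.sum_congr rfl fun l _ => by rw [D.pd_du hx]

/-- The square of the length of the gradient. -/
def gradSq (y : E P.n) : ℝ := ∑ l, D.du l y * D.du l y

theorem gradSq_two {x : E P.n} (hx : x ∈ D.S) : ContDiffWithinAt ℝ 2 D.gradSq D.S x :=
  ContDiffWithinAt.sum fun l _ => (D.du_two hx l).mul (D.du_two hx l)

theorem gradSq_le {x : E P.n} (hx : x ∈ D.S) : D.gradSq x ≤ P.n * P.M ^ 2 := by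
  unfold gradSq
  refine (Finset.sum_le_sum (g := fun _ => P.M ^ 2) fun l _ => ?_).trans (by simp)
  have := D.abs_du_le hx l
  rw [← pow_two, ← sq_abs]
  gcongr

theorem gradSq_nonneg (x : E P.n) : 0 ≤ D.gradSq x :=
  Finset.sum_nonneg fun _ _ => mul_self_nonneg _

theorem pd_gradSq {x : E P.n} (hx : x ∈ D.S) (e : E P.n) :
    pd D.S e D.gradSq x = 2 * ∑ l, D.du l x * pd D.S e (D.du l) x := by
  have hd := fun l => (D.du_two hx l).differentiableWithinAt two_ne_zero
  unfold gradSq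
  rw [pd_sum D.body hx e _ fun l _ => (hd l).fun_mul (hd l), Finset.mul_sum]
  refine Finset.sum_congr rfl fun l _ => ?_
  rw [pd_mul D.body hx e (hd l) (hd l)]; ring

namespace InteriorFrame

variable {D} {x : E P.n} {e : OrthonormalBasis (Fin P.n) ℝ (E P.n)} {lam G : Fin P.n → ℝ}

theorem memS (h : D.InteriorFrame x e lam G) : x ∈ D.S := D.subset_S h.mem

theorem hess_eq (h : D.InteriorFrame x e lam G) (a b : E P.n) :
    pd D.S a (pd D.S b D.u) x = ∑ i, lam i * inner ℝ (e i) a * inner ℝ (e i) b := by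
  have hx := h.memS
  rw [pd_pd_eq D.body hx a b (D.u_two hx)]
  conv_lhs => rw [← e.sum_repr' a, ← e.sum_repr' b]
  simp only [map_sum, map_smul, sum_apply, smul_apply, smul_eq_mul, Finset.mul_sum]
  refine Finset.sum_congr rfl fun i _ => ?_
  rw [Finset.sum_eq_single i]
  · rw [← pd_pd_eq D.body hx _ _ (D.u_two hx), h.diag, if_pos rfl]; ring
  · intro j _ hj
    rw [← pd_pd_eq D.body hx _ _ (D.u_two hx), h.diag, if_neg]; · ring
    tauto
  · simp

theorem pd_du (h : D.InteriorFrame x e lam G) (i l : Fin P.n) :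
    pd D.S (e i) (D.du l) x = lam i * e i l := by
  unfold du
  rw [h.hess_eq, Finset.sum_eq_single i]
  · rw [e.inner_eq_one, EuclideanSpace.inner_single_right]; simp
  · intro j _ hj
    rw [e.inner_eq_zero hj]; ring
  · simp

theorem sum_sq_coord (e : OrthonormalBasis (Fin P.n) ℝ (E P.n)) (i : Fin P.n) :
    ∑ l, e i l ^ 2 = 1 := by
  have h1 := EuclideanSpace.real_norm_sq_eq (e i)
  rw [e.norm_eq_one] at h1
  simpa using h1.symm

theorem abs_coord_le (e : OrthonormalBasis (Fin P.n) ℝ (E P.n)) (i l : Fin P.n) :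
    |e i l| ≤ 1 := by
  have h1 := sum_sq_coord e i
  have h2 := Finset.single_le_sum (f := fun l => e i l ^ 2) (fun l _ => sq_nonneg _)
    (Finset.mem_univ l)
  rw [← sq_le_one_iff_abs_le_one]
  simpa [h1] using h2

theorem sum_nonneg (h : D.InteriorFrame x e lam G) : 0 ≤ ∑ i, G i :=
  (Real.exp_pos _).le.trans h.sum_ge

/-- The linearized operator applied to a function with a bounded jet. -/
theorem abs_lin_jet_le (h : D.InteriorFrame x e lam G) {C : ℝ} {g : E P.n → ℝ}
    (hg : JetBound (D.pt h.memS) C g) :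
    |∑ i, G i * pd D.S (e i) (pd D.S (e i) g) x| ≤ C * (P.k + ∑ i, G i) := by
  obtain ⟨β, h1, h2⟩ := hg.hess
  -- The multiple β of D²u costs only βk, because Σ G_i λ_i = k. This is why jets need to be bounded
  -- only modulo the Hessian of u.
  have e1 : ∑ i, G i * pd D.S (e i) (pd D.S (e i) g) x
      = β * P.k + ∑ i, G i * (pd D.S (e i) (pd D.S (e i) g) x - β * lam i) := by
    rw [← h.sum_mul, Finset.mul_sum, ← Finset.sum_add_distrib]
    exact Finset.sum_congr rfl fun i _ => by ring
  rw [e1]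
  refine (abs_add_le _ _).trans ?_
  rw [mul_add]
  refine add_le_add ?_ ?_
  · rw [abs_mul, Nat.abs_cast]; gcongr
  · refine (Finset.abs_sum_le_sum_abs _ _).trans ?_
    rw [Finset.mul_sum]
    refine Finset.sum_le_sum fun i _ => ?_
    rw [abs_mul, abs_of_pos (h.pos i), mul_comm]
    refine mul_le_mul_of_nonneg_right ?_ (h.pos i).le
    have := h2 (e i)
    rw [e.norm_eq_one] at this
    have hd := h.diag i i
    rw [if_pos rfl] at hd
    change |_ - β * pd D.S (e i) (pd D.S (e i) D.u) x| ≤ _ at this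
    rw [hd, one_pow, mul_one] at this
    exact this

theorem abs_pd_F_le (h : D.InteriorFrame x e lam G) {C : ℝ}
    (hF : JetBound (D.pt h.memS) C D.F) (l : Fin P.n) :
    |∑ i, G i * pd D.S (e i) (pd D.S (e i) (D.du l)) x| ≤ C := by
  have := h.third (EuclideanSpace.single l 1)
  unfold du
  rw [this]
  have := hF.der (EuclideanSpace.single l 1)
  rw [norm_single_one, mul_one] at this
  exact this

/-- The linearized operator applied to a first-order expression in the solution. -/
theorem abs_lin_first_order_le (h : D.InteriorFrame x e lam G) {C : ℝ}
    (hF : JetBound (D.pt h.memS) C D.F) {a : Fin P.n → E P.n → ℝ} {b : E P.n → ℝ}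
    (ha : ∀ l, JetBound (D.pt h.memS) C (a l)) (hb : JetBound (D.pt h.memS) C b) :
    |∑ i, G i * pd D.S (e i) (pd D.S (e i) (fun y => ∑ l, a l y * D.du l y + b y)) x
      - 2 * ∑ i, G i * lam i * ∑ l, e i l * pd D.S (e i) (a l) x|
      ≤ (P.n * (C * C) + (P.n * P.M + 1) * C * P.k) + (P.n * P.M + 1) * C * ∑ i, G i := by
  have hx := h.memS
  have hC := hb.nonneg
  have ca : ∀ l, ContDiffWithinAt ℝ 2 (a l) D.S x := fun l => (ha l).contDiff
  have cl : ∀ l ∈ Finset.univ, ContDiffWithinAt ℝ 2 (fun y => a l y * D.du l y) D.S x :=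
    fun l _ => (ca l).mul (D.du_two hx l)
  have e1 : ∀ i, pd D.S (e i) (pd D.S (e i) (fun y => ∑ l, a l y * D.du l y + b y)) x =
      ∑ l, (a l x * pd D.S (e i) (pd D.S (e i) (D.du l)) x
        + 2 * lam i * (e i l * pd D.S (e i) (a l) x)
        + D.du l x * pd D.S (e i) (pd D.S (e i) (a l)) x)
      + pd D.S (e i) (pd D.S (e i) b) x := by
    intro i
    rw [pd_pd_add D.body hx _ _ (ContDiffWithinAt.sum cl) hb.contDiff,
      pd_pd_sum D.body hx _ _ _ cl]
    congr 1
    refine Finset.sum_congr rfl fun l _ => ?_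
    rw [pd_pd_mul D.body hx _ _ (ca l) (D.du_two hx l), h.pd_du]
    ring
  -- Third derivatives of u occur only as the operator applied to u_l, which is the l-th derivative
  -- of F. The cross terms between Da_l and D²u are the only ones not controlled, so they are
  -- subtracted on the left.
  have e2 : ∑ i, G i * pd D.S (e i) (pd D.S (e i) (fun y => ∑ l, a l y * D.du l y + b y)) x
      - 2 * ∑ i, G i * lam i * ∑ l, e i l * pd D.S (e i) (a l) x
      = ∑ l, a l x * ∑ i, G i * pd D.S (e i) (pd D.S (e i) (D.du l)) x
        + ∑ l, D.du l x * ∑ i, G i * pd D.S (e i) (pd D.S (e i) (a l)) x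
        + ∑ i, G i * pd D.S (e i) (pd D.S (e i) b) x := by
    simp only [e1, Finset.sum_add_distrib, Finset.mul_sum, mul_add]
    have s1 : ∑ l, ∑ i, a l x * (G i * pd D.S (e i) (pd D.S (e i) (D.du l)) x)
        = ∑ i, ∑ l, G i * (a l x * pd D.S (e i) (pd D.S (e i) (D.du l)) x) := by
      rw [Finset.sum_comm]
      exact Finset.sum_congr rfl fun i _ => Finset.sum_congr rfl fun l _ => by ring
    have s2 : ∑ l, ∑ i, D.du l x * (G i * pd D.S (e i) (pd D.S (e i) (a l)) x)
        = ∑ i, ∑ l, G i * (D.du l x * pd D.S (e i) (pd D.S (e i) (a l)) x) := by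
      rw [Finset.sum_comm]
      exact Finset.sum_congr rfl fun i _ => Finset.sum_congr rfl fun l _ => by ring
    have s3 : ∑ i, ∑ l, 2 * (G i * lam i * (e i l * pd D.S (e i) (a l) x))
        = ∑ i, ∑ l, G i * (2 * lam i * (e i l * pd D.S (e i) (a l) x)) :=
      Finset.sum_congr rfl fun i _ => Finset.sum_congr rfl fun l _ => by ring
    rw [s1, s2, s3]; ring
  rw [e2]
  have b1 : |∑ l, a l x * ∑ i, G i * pd D.S (e i) (pd D.S (e i) (D.du l)) x|
      ≤ P.n * (C * C) := by
    refine (Finset.abs_sum_le_sum_abs _ _).trans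
      ((Finset.sum_le_sum (g := fun _ => C * C) fun l _ => ?_).trans (by simp))
    rw [abs_mul]
    exact mul_le_mul (ha l).val (h.abs_pd_F_le hF l) (abs_nonneg _) hC
  have b2 : |∑ l, D.du l x * ∑ i, G i * pd D.S (e i) (pd D.S (e i) (a l)) x|
      ≤ P.n * (P.M * (C * (P.k + ∑ i, G i))) := by
    refine (Finset.abs_sum_le_sum_abs _ _).trans ((Finset.sum_le_sum
      (g := fun _ => P.M * (C * (P.k + ∑ i, G i))) fun l _ => ?_).trans (by simp))
    rw [abs_mul]
    exact mul_le_mul (D.abs_du_le hx l) (h.abs_lin_jet_le (ha l)) (abs_nonneg _) D.M_nonneg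
  have b3 := h.abs_lin_jet_le hb
  refine (abs_add_le _ _).trans ((add_le_add ((abs_add_le _ _).trans (add_le_add b1 b2)) b3).trans
    (le_of_eq ?_))
  ring

/-- The linearized operator applied to `|Du|²`. -/
theorem lin_gradSq_ge (h : D.InteriorFrame x e lam G) {C : ℝ}
    (hF : JetBound (D.pt h.memS) C D.F) :
    2 * ∑ i, G i * lam i ^ 2 - 2 * (P.n * (P.M * C)) ≤
      ∑ i, G i * pd D.S (e i) (pd D.S (e i) D.gradSq) x := by
  have hx := h.memS
  have cl : ∀ l ∈ Finset.univ, ContDiffWithinAt ℝ 2 (fun y => D.du l y * D.du l y) D.S x :=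
    fun l _ => (D.du_two hx l).mul (D.du_two hx l)
  have e1 : ∀ i, pd D.S (e i) (pd D.S (e i) D.gradSq) x =
      2 * ∑ l, D.du l x * pd D.S (e i) (pd D.S (e i) (D.du l)) x + 2 * lam i ^ 2 := by
    intro i
    unfold gradSq
    rw [pd_pd_sum D.body hx _ _ _ cl]
    have : 2 * lam i ^ 2 = ∑ l, 2 * lam i ^ 2 * e i l ^ 2 := by
      rw [← Finset.mul_sum, sum_sq_coord, mul_one]
    rw [this, Finset.mul_sum, ← Finset.sum_add_distrib]
    refine Finset.sum_congr rfl fun l _ => ?_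
    rw [pd_pd_mul D.body hx _ _ (D.du_two hx l) (D.du_two hx l), h.pd_du]
    ring
  have e2 : ∑ i, G i * pd D.S (e i) (pd D.S (e i) D.gradSq) x
      = 2 * ∑ i, G i * lam i ^ 2
        + 2 * ∑ l, D.du l x * ∑ i, G i * pd D.S (e i) (pd D.S (e i) (D.du l)) x := by
    simp only [e1, mul_add, Finset.sum_add_distrib, Finset.mul_sum]
    rw [add_comm, Finset.sum_comm]
    congr 1
    · exact Finset.sum_congr rfl fun i _ => by ring
    · exact Finset.sum_congr rfl fun l _ => Finset.sum_congr rfl fun i _ => by ring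
  have b1 : |∑ l, D.du l x * ∑ i, G i * pd D.S (e i) (pd D.S (e i) (D.du l)) x|
      ≤ P.n * (P.M * C) := by
    refine (Finset.abs_sum_le_sum_abs _ _).trans
      ((Finset.sum_le_sum (g := fun _ => P.M * C) fun l _ => ?_).trans (by simp))
    rw [abs_mul]
    exact mul_le_mul (D.abs_du_le hx l) (h.abs_pd_F_le hF l) (abs_nonneg _) D.M_nonneg
  have := (abs_le.1 b1).1
  rw [e2]; linarith

theorem exists_max (lam : Fin P.n → ℝ) : ∃ a, ∀ i, lam i ≤ lam a := by
  have : Nonempty (Fin P.n) := ⟨⟨0, P.one_le_k.trans P.k_le_n⟩⟩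
  exact Finite.exists_max lam

theorem exists_min (lam : Fin P.n → ℝ) : ∃ a, ∀ i, lam a ≤ lam i := by
  have : Nonempty (Fin P.n) := ⟨⟨0, P.one_le_k.trans P.k_le_n⟩⟩
  exact Finite.exists_min lam

theorem one_le_n : (1:ℝ) ≤ P.n := by exact_mod_cast P.one_le_k.trans P.k_le_n

theorem lam_max_pos (h : D.InteriorFrame x e lam G) {a : Fin P.n} (ha : ∀ i, lam i ≤ lam a) :
    0 < lam a := by
  by_contra hn
  push Not at hn
  have := Finset.sum_nonpos fun i (_ : i ∈ Finset.univ) => (ha i).trans hn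
  linarith [h.sum_pos]

/-- Multiply 1 ≤ n λ_a G_a by λ_a. The good term coming from |Du|² thus bounds all second
derivatives. -/
theorem lam_max_le (h : D.InteriorFrame x e lam G) {a : Fin P.n} (ha : ∀ i, lam i ≤ lam a) :
    lam a ≤ P.n * ∑ i, G i * lam i ^ 2 := by
  have h1 := h.max_le a ha
  have h2 := h.lam_max_pos ha
  have h3 : G a * lam a ^ 2 ≤ ∑ i, G i * lam i ^ 2 :=
    Finset.single_le_sum (f := fun i => G i * lam i ^ 2)
      (fun i _ => mul_nonneg (h.pos i).le (sq_nonneg _)) (Finset.mem_univ a)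
  have h4 := one_le_n (P := P)
  nlinarith

/-- The trace is positive, so a negative eigenvalue is compensated by the others, each at most λ_a.
-/
theorem abs_lam_le (h : D.InteriorFrame x e lam G) {a : Fin P.n} (ha : ∀ i, lam i ≤ lam a)
    (i : Fin P.n) : |lam i| ≤ P.n * lam a := by
  have h2 := h.lam_max_pos ha
  have h4 := one_le_n (P := P)
  rw [abs_le]
  constructor
  · have h5 := Finset.add_sum_erase Finset.univ lam (Finset.mem_univ i)
    have h6 : ∑ j ∈ Finset.univ.erase i, lam j ≤ ∑ j ∈ Finset.univ.erase i, lam a :=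
      Finset.sum_le_sum fun j _ => ha j
    rw [Finset.sum_const, Finset.card_erase_of_mem (Finset.mem_univ i), Finset.card_fin,
      nsmul_eq_mul, Nat.cast_sub (P.one_le_k.trans P.k_le_n)] at h6
    push_cast at h6
    nlinarith [h.sum_pos]
  · nlinarith [ha i]

theorem hess_le (h : D.InteriorFrame x e lam G) {a : Fin P.n} (ha : ∀ i, lam i ≤ lam a)
    (ξ : E P.n) : pd D.S ξ (pd D.S ξ D.u) x ≤ lam a * ‖ξ‖ ^ 2 := by
  rw [h.hess_eq, ← e.sum_sq_inner_right ξ, Finset.mul_sum]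
  refine Finset.sum_le_sum fun i _ => ?_
  nlinarith [mul_le_mul_of_nonneg_right (ha i) (sq_nonneg (inner ℝ (e i) ξ : ℝ))]

theorem abs_hess_le (h : D.InteriorFrame x e lam G) {a : Fin P.n} (ha : ∀ i, lam i ≤ lam a)
    (ξ : E P.n) : |pd D.S ξ (pd D.S ξ D.u) x| ≤ P.n * lam a * ‖ξ‖ ^ 2 := by
  rw [h.hess_eq, ← e.sum_sq_inner_right ξ, Finset.mul_sum]
  refine (Finset.abs_sum_le_sum_abs _ _).trans (Finset.sum_le_sum fun i _ => ?_)
  rw [mul_assoc, ← pow_two, abs_mul, abs_of_nonneg (sq_nonneg (inner ℝ (e i) ξ : ℝ))]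
  exact mul_le_mul_of_nonneg_right (h.abs_lam_le ha i) (sq_nonneg _)

end InteriorFrame

end Setup

/-- A point in the closed domain of a setup. -/
structure SetupPoint (P : Params) where
  D : Setup P
  x : E P.n
  mem : x ∈ D.S

/-- The underlying point data. -/
def SetupPoint.pt {P : Params} (i : SetupPoint P) : PointData (E P.n) := i.D.pt i.mem

theorem exists_jetBound_F (P : Params) :
    ∃ C, ∀ (D : Setup P) (x : E P.n) (hx : x ∈ D.S), JetBound (D.pt hx) C D.F := by
  have h1 : UnifJet (SetupPoint.pt (P := P)) (fun i y => i.D.f y (i.D.u y)) :=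
    ⟨P.A * (1 + P.M) ^ 2, fun i => DerivBound.jetBound_graph (D := i.pt)
      (fun e => i.D.abs_pd_u_le i.mem e) i.D.M_nonneg (i.D.f_derivBound i.mem)⟩
  obtain ⟨C, hC⟩ := h1.comp P.m_pos (fun i => i.D.m_le_f i.mem) (Θ := Real.log)
    (Real.contDiffOn_log.mono fun x hx => (ne_of_gt hx : x ≠ 0))
  exact ⟨C, fun D x hx => hC ⟨D, x, hx⟩⟩

end Linearized
end HessianNeumann

namespace HessianNeumann

/-! ### A strictly convex barrier near each boundary point. -/

section Barrier
open Filter Topology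

/-- A setup together with a boundary point and a controlled local defining function there. -/
structure LocalSetup (P : Params) where
  D : Setup P
  p : E P.n
  ρ : E P.n → ℝ
  mem_frontier : p ∈ frontier D.Ω
  defining : IsLocalDefining D.Ω p P.r ρ
  bound : ∀ x ∈ ball p P.r, 1 ≤ ‖fderiv ℝ ρ x‖ ∧ ∀ j ≤ 4, ‖iteratedFDeriv ℝ j ρ x‖ ≤ P.K

theorem IsLocalDefining.of_mem_ball {n : ℕ} {Ω : Set (E n)} {p y : E n} {r : ℝ} {ρ : E n → ℝ}
    (h : IsLocalDefining Ω p r ρ) (hy : y ∈ ball p r) :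
    IsLocalDefining Ω y (r - dist y p) ρ := by
  have hsub : ball y (r - dist y p) ⊆ ball p r := by
    intro x hx
    have h1 : dist x y < r - dist y p := hx
    have h2 := dist_triangle x y p
    exact mem_ball.2 (by linarith)
  exact ⟨sub_pos.2 hy, h.contDiffOn.mono hsub, fun x hx => h.mem_iff x (hsub hx),
    fun x hx => h.fderiv_ne x (hsub hx)⟩

/-- A bound larger than `1` for the derivatives of the local defining functions. -/
def Params.K1 (P : Params) : ℝ := |P.K| + 1

theorem Params.one_le_K1 (P : Params) : 1 ≤ P.K1 := by
  unfold Params.K1; linarith [abs_nonneg P.K]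

theorem Setup.exists_local {P : Params} (D : Setup P) {p : E P.n} (hp : p ∈ frontier D.Ω) :
    ∃ L : LocalSetup P, L.D = D ∧ L.p = p := by
  obtain ⟨ρ, h1, h2⟩ := D.boundary p hp
  exact ⟨⟨D, p, ρ, hp, h1, h2⟩, rfl, rfl⟩

namespace LocalSetup

variable {P : Params} (L : LocalSetup P)

theorem p_mem : L.p ∈ L.D.S := L.D.frontier_subset L.mem_frontier

theorem p_mem_ball : L.p ∈ ball L.p P.r := mem_ball_self P.r_pos

theorem ρ_contDiffAt {x : E P.n} (hx : x ∈ ball L.p P.r) : ContDiffAt ℝ 4 L.ρ x :=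
  L.defining.contDiffOn.contDiffAt (isOpen_ball.mem_nhds hx)

theorem ρ_derivBound {x : E P.n} (hx : x ∈ ball L.p P.r) : DerivBound 4 P.K1 L.ρ univ x := by
  refine ⟨(L.ρ_contDiffAt hx).contDiffWithinAt, fun j hj => ?_⟩
  rw [iteratedFDerivWithin_univ]
  exact ((L.bound x hx).2 j hj).trans ((le_abs_self _).trans (by unfold Params.K1; linarith))

theorem ρ_neg {x : E P.n} (hx : x ∈ ball L.p P.r) (hΩ : x ∈ L.D.Ω) : L.ρ x < 0 :=
  (L.defining.mem_iff x hx).1 hΩ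

theorem ρ_nonpos {x : E P.n} (hx : x ∈ ball L.p P.r) (hS : x ∈ L.D.S) : L.ρ x ≤ 0 := by
  have h1 : ContinuousAt L.ρ x := (L.ρ_contDiffAt hx).continuousAt
  have h2 : (𝓝[L.D.Ω] x).NeBot := mem_closure_iff_nhdsWithin_neBot.1 hS
  refine le_of_tendsto (h1.mono_left (nhdsWithin_le_nhds (s := L.D.Ω))) ?_
  filter_upwards [nhdsWithin_le_nhds (isOpen_ball.mem_nhds hx), self_mem_nhdsWithin] with y h3 h4
  exact (L.ρ_neg h3 h4).le

theorem ρ_eq_zero {x : E P.n} (hx : x ∈ ball L.p P.r) (hf : x ∈ frontier L.D.Ω) : L.ρ x = 0 := by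
  rw [L.D.frontier_eq] at hf
  refine le_antisymm (L.ρ_nonpos hx hf.1) ?_
  by_contra hn
  push Not at hn
  exact hf.2 ((L.defining.mem_iff x hx).2 hn)

/-- The gradient of the defining function. -/
def grad (x : E P.n) : E P.n := gradient L.ρ x

theorem inner_grad (x e : E P.n) : inner ℝ (L.grad x) e = pd univ e L.ρ x := by
  unfold grad gradient pd
  rw [InnerProductSpace.toDual_symm_apply, fderivWithin_univ]

theorem norm_grad (x : E P.n) : ‖L.grad x‖ = ‖fderiv ℝ L.ρ x‖ := by
  unfold grad gradient; simp

theorem one_le_norm_grad {x : E P.n} (hx : x ∈ ball L.p P.r) : 1 ≤ ‖L.grad x‖ := by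
  rw [norm_grad]; exact (L.bound x hx).1

theorem abs_pd_ρ_le {x : E P.n} (hx : x ∈ ball L.p P.r) (e : E P.n) :
    |pd univ e L.ρ x| ≤ P.K1 * ‖e‖ :=
  (L.ρ_derivBound hx).abs_pd_le convexBody_univ (mem_univ _) e

theorem abs_pd_pd_ρ_le {x : E P.n} (hx : x ∈ ball L.p P.r) (e e' : E P.n) :
    |pd univ e (pd univ e' L.ρ) x| ≤ P.K1 * ‖e'‖ * ‖e‖ := by
  have := ((L.ρ_derivBound hx).pd convexBody_univ (mem_univ _) e').abs_pd_le convexBody_univ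
    (mem_univ _) e
  linarith

/-- Uniform convexity at every boundary point near `p`. -/
theorem le_pd_pd_ρ_of_tangent {y : E P.n} (hy : y ∈ ball L.p P.r) (hf : y ∈ frontier L.D.Ω)
    {τ : E P.n} (hτ : pd univ τ L.ρ y = 0) :
    P.κ * ‖τ‖ ^ 2 * ‖L.grad y‖ ≤ pd univ τ (pd univ τ L.ρ) y := by
  have h1 := L.D.unifConvex.2 y hf _ L.ρ (L.defining.of_mem_ball hy) τ (by
    simpa [pd, fderivWithin_univ] using hτ)
  have h2 := L.one_le_norm_grad hy
  rw [← L.norm_grad, le_div_iff₀ (by linarith)] at h1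
  rw [pd_pd_eq convexBody_univ (mem_univ y) _ _ ((L.ρ_derivBound hy).of_le
    (m' := 2) (by norm_num)).contDiff]
  rw [← iteratedFDerivWithin_univ,
    iteratedFDerivWithin_two_apply _ uniqueDiffOn_univ (mem_univ y)] at h1
  simpa using h1

theorem abs_sub_le_of_pd_bound {g : E P.n → ℝ} {C δ : ℝ} 
    (hg : ∀ x ∈ ball L.p P.r, DifferentiableAt ℝ g x)
    (hb : ∀ x ∈ ball L.p P.r, ∀ e, |pd univ e g x| ≤ C * ‖e‖) (hC : 0 ≤ C) {x : E P.n}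
    (hx : x ∈ ball L.p P.r) (hxδ : ‖x - L.p‖ ≤ δ) : |g x - g L.p| ≤ C * δ := by
  have h1 : ∀ x ∈ ball L.p P.r, ‖fderiv ℝ g x‖ ≤ C := by
    intro x hx
    refine ContinuousLinearMap.opNorm_le_bound _ hC fun e => ?_
    have := hb x hx e
    rwa [pd, fderivWithin_univ] at this
  have := (convex_ball L.p P.r).norm_image_sub_le_of_norm_fderiv_le (𝕜 := ℝ) hg h1
    L.p_mem_ball hx
  rw [Real.norm_eq_abs] at this
  exact this.trans (by gcongr)

theorem ρ_p : L.ρ L.p = 0 := L.ρ_eq_zero L.p_mem_ball L.mem_frontier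

theorem pd_ρ_two {x : E P.n} (hx : x ∈ ball L.p P.r) (e : E P.n) :
    ContDiffAt ℝ 2 (pd univ e L.ρ) x := by
  rw [← contDiffWithinAt_univ]
  exact contDiffWithinAt_pd convexBody_univ (mem_univ _) (n := 4)
    (L.ρ_contDiffAt hx).contDiffWithinAt (by norm_num) e

theorem pd_pd_ρ_two {x : E P.n} (hx : x ∈ ball L.p P.r) (e e' : E P.n) :
    ContDiffAt ℝ 2 (pd univ e (pd univ e' L.ρ)) x := by
  rw [← contDiffWithinAt_univ]
  exact contDiffWithinAt_pd convexBody_univ (mem_univ _) (n := 3)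
    (contDiffWithinAt_pd convexBody_univ (mem_univ _) (n := 4)
      (L.ρ_contDiffAt hx).contDiffWithinAt (by norm_num) e') (by norm_num) e

theorem abs_ρ_le {x : E P.n} (hx : x ∈ ball L.p P.r) : |L.ρ x| ≤ P.K1 * ‖x - L.p‖ := by
  have := L.abs_sub_le_of_pd_bound (g := L.ρ) (C := P.K1)
    (fun x hx => (L.ρ_contDiffAt hx).differentiableAt (by norm_num))
    (fun x hx e => L.abs_pd_ρ_le hx e) (by linarith [P.one_le_K1]) hx le_rfl
  rwa [L.ρ_p, sub_zero] at this

theorem abs_pd_ρ_sub_le {x : E P.n} (hx : x ∈ ball L.p P.r) (e : E P.n) :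
    |pd univ e L.ρ x - pd univ e L.ρ L.p| ≤ P.K1 * ‖e‖ * ‖x - L.p‖ := by
  have hK := P.one_le_K1
  exact L.abs_sub_le_of_pd_bound
    (fun x hx => (L.pd_ρ_two hx e).differentiableAt (by norm_num))
    (fun x hx e' => L.abs_pd_pd_ρ_le hx e' e) (by positivity) hx le_rfl

theorem abs_pd_pd_ρ_sub_le {x : E P.n} (hx : x ∈ ball L.p P.r) (e : E P.n) :
    |pd univ e (pd univ e L.ρ) x - pd univ e (pd univ e L.ρ) L.p|
      ≤ P.K1 * ‖e‖ ^ 2 * ‖x - L.p‖ := by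
  have hK := P.one_le_K1
  refine L.abs_sub_le_of_pd_bound
    (fun x hx => (L.pd_pd_ρ_two hx e e).differentiableAt (by norm_num))
    (fun x hx e' => ?_) (by positivity) hx le_rfl
  have := (((L.ρ_derivBound hx).pd convexBody_univ (mem_univ _) e).pd convexBody_univ
    (mem_univ _) e).abs_pd_le convexBody_univ (mem_univ _) e'
  refine this.trans (le_of_eq ?_); ring

set_option maxHeartbeats 1000000 in
/-- `D²ρ + Λ Dρ ⊗ Dρ` is positive definite at `p`. -/
theorem le_pd_pd_ρ_add (e : E P.n) :
    P.κ / 2 * ‖e‖ ^ 2 ≤ pd univ e (pd univ e L.ρ) L.p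
      + (P.K1 + 2 * P.K1 ^ 2 / P.κ + P.κ / 2) * pd univ e L.ρ L.p ^ 2 := by
  have hκ := P.κ_pos
  have hK := P.one_le_K1
  have hpb := L.p_mem_ball
  have hg1 := L.one_le_norm_grad hpb
  set g := L.grad L.p with hg
  set ν : E P.n := ‖g‖⁻¹ • g with hν
  have hgn : ‖g‖ ≠ 0 := by linarith
  have hνn : ‖ν‖ = 1 := by rw [hν, norm_smul, norm_inv, norm_norm, inv_mul_cancel₀ hgn]
  set b : ℝ := inner ℝ ν e with hb
  set τ : E P.n := e - b • ν with hτ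
  have he : e = τ + b • ν := by rw [hτ]; abel
  have hρe : pd univ e L.ρ L.p = ‖g‖ * b := by
    rw [← L.inner_grad, hb, hν, inner_smul_left, ← hg]
    simp [hgn]
  have hρν : pd univ ν L.ρ L.p = ‖g‖ := by
    rw [← L.inner_grad, hν, inner_smul_right, ← hg, real_inner_self_eq_norm_sq]
    field_simp
  have hτt : pd univ τ L.ρ L.p = 0 := by
    have h1 := hρe
    rw [he, pd_add_vec, pd_smul_vec, hρν] at h1
    linarith
  have hortho : (inner ℝ τ ν : ℝ) = 0 := by
    rw [hτ, inner_sub_left, inner_smul_left, real_inner_self_eq_norm_sq, hνn, hb,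
      real_inner_comm]
    simp
  have hnorm : ‖e‖ ^ 2 = ‖τ‖ ^ 2 + b ^ 2 := by
    conv_lhs => rw [he]
    rw [norm_add_sq_real, inner_smul_right, hortho, norm_smul, hνn, Real.norm_eq_abs]
    simp
  have hconv := L.le_pd_pd_ρ_of_tangent hpb L.mem_frontier hτt
  have c2 : ContDiffWithinAt ℝ 2 L.ρ univ L.p :=
    ((L.ρ_derivBound hpb).of_le (m' := 2) (by norm_num)).contDiff
  have hexp : pd univ e (pd univ e L.ρ) L.p = pd univ τ (pd univ τ L.ρ) L.p
      + 2 * b * pd univ τ (pd univ ν L.ρ) L.p + b ^ 2 * pd univ ν (pd univ ν L.ρ) L.p := by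
    have hs := pd_pd_comm convexBody_univ (mem_univ _) τ ν c2
    rw [pd_pd_eq convexBody_univ (mem_univ _) _ _ c2, pd_pd_eq convexBody_univ (mem_univ _) _ _ c2]
      at hs
    simp only [pd_pd_eq convexBody_univ (mem_univ _) _ _ c2]
    rw [he]
    simp only [map_add, map_smul, add_apply, smul_apply, smul_eq_mul]
    rw [← hs]; ring
  have b1 := L.abs_pd_pd_ρ_le hpb τ ν
  have b2 := L.abs_pd_pd_ρ_le hpb ν ν
  rw [hνn] at b1 b2
  rw [hexp, hnorm, hρe]
  have b1' := abs_le.1 b1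
  have b2' := abs_le.1 b2
  have t1 : P.κ * ‖τ‖ ^ 2 ≤ P.κ * ‖τ‖ ^ 2 * ‖L.grad L.p‖ := by
    have : 0 ≤ P.κ * ‖τ‖ ^ 2 := by positivity
    nlinarith
  have t2 : -(P.κ / 2 * ‖τ‖ ^ 2 + 2 * P.K1 ^ 2 / P.κ * b ^ 2)
      ≤ 2 * b * pd univ τ (pd univ ν L.ρ) L.p := by
    have h1 : |2 * b * pd univ τ (pd univ ν L.ρ) L.p| ≤ 2 * |b| * (P.K1 * ‖τ‖) := by
      rw [abs_mul, abs_mul, abs_two]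
      have : |pd univ τ (pd univ ν L.ρ) L.p| ≤ P.K1 * ‖τ‖ := by simpa using b1
      gcongr
    -- Young's inequality spends half of the tangential convexity κ on the mixed term; the normal
    -- part that arises is paid by the coefficient of Dρ ⊗ Dρ.
    have h2 : 2 * |b| * (P.K1 * ‖τ‖) ≤ P.κ / 2 * ‖τ‖ ^ 2 + 2 * P.K1 ^ 2 / P.κ * b ^ 2 := by
      have h3 : P.κ / 2 * ‖τ‖ ^ 2 + 2 * P.K1 ^ 2 / P.κ * b ^ 2 - 2 * |b| * (P.K1 * ‖τ‖)
          = (P.κ * ‖τ‖ - 2 * P.K1 * |b|) ^ 2 / (2 * P.κ) := by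
        rw [← sq_abs b]; field_simp; ring
      have h4 : 0 ≤ (P.κ * ‖τ‖ - 2 * P.K1 * |b|) ^ 2 / (2 * P.κ) := by positivity
      linarith
    have := (abs_le.1 h1).1
    linarith
  have t3 : -(P.K1 * b ^ 2) ≤ b ^ 2 * pd univ ν (pd univ ν L.ρ) L.p := by
    nlinarith [sq_nonneg b]
  have t4 : (P.K1 + 2 * P.K1 ^ 2 / P.κ + P.κ / 2) * b ^ 2 ≤
      (P.K1 + 2 * P.K1 ^ 2 / P.κ + P.κ / 2) * (‖g‖ * b) ^ 2 := by
    refine mul_le_mul_of_nonneg_left ?_ (by positivity)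
    rw [mul_pow]
    exact le_mul_of_one_le_left (sq_nonneg b) (one_le_pow₀ hg1)
  have t5 : (P.K1 + 2 * P.K1 ^ 2 / P.κ + P.κ / 2) * b ^ 2
      = P.K1 * b ^ 2 + 2 * P.K1 ^ 2 / P.κ * b ^ 2 + P.κ / 2 * b ^ 2 := by ring
  linarith

/-- The barrier. -/
def H (Λ c : ℝ) (y : E P.n) : ℝ :=
  L.ρ y + Λ / 2 * (L.ρ y * L.ρ y) + (-c) * inner ℝ (y - L.p) (y - L.p)

theorem pd_normSq (p e x : E P.n) :
    pd univ e (fun y : E P.n => (inner ℝ (y - p) (y - p) : ℝ)) x = 2 * inner ℝ (x - p) e := by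
  have h : HasFDerivAt (fun y : E P.n => y - p) (ContinuousLinearMap.id ℝ (E P.n)) x :=
    (hasFDerivAt_id x).sub_const p
  have h2 := h.inner ℝ h
  unfold pd
  rw [fderivWithin_univ, h2.fderiv]
  simp [real_inner_comm, two_mul]

theorem pd_pd_normSq (p e x : E P.n) :
    pd univ e (pd univ e (fun y : E P.n => (inner ℝ (y - p) (y - p) : ℝ))) x = 2 * ‖e‖ ^ 2 := by
  have h0 : pd univ e (fun y : E P.n => (inner ℝ (y - p) (y - p) : ℝ))
      = fun y => 2 * inner ℝ (y - p) e := by ext y; exact pd_normSq p e y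
  have h : HasFDerivAt (fun y : E P.n => y - p) (ContinuousLinearMap.id ℝ (E P.n)) x :=
    (hasFDerivAt_id x).sub_const p
  have h2 := (h.inner ℝ (hasFDerivAt_const e x)).const_mul 2
  rw [h0]
  unfold pd
  rw [fderivWithin_univ, h2.fderiv]
  simp

theorem normSq_contDiff (p : E P.n) :
    ContDiff ℝ 2 (fun y : E P.n => (inner ℝ (y - p) (y - p) : ℝ)) :=
  (contDiff_id.sub contDiff_const).inner ℝ (contDiff_id.sub contDiff_const)

theorem H_contDiffAt (Λ c : ℝ) {x : E P.n} (hx : x ∈ ball L.p P.r) :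
    ContDiffAt ℝ 2 (L.H Λ c) x := by
  have h := (L.ρ_contDiffAt hx).of_le (m := 2) (by norm_num)
  exact (h.add (contDiffAt_const.mul (h.mul h))).add
    (contDiffAt_const.mul (normSq_contDiff L.p).contDiffAt)

theorem pd_H_univ (Λ c : ℝ) {x : E P.n} (hx : x ∈ ball L.p P.r) (e : E P.n) :
    pd univ e (L.H Λ c) x =
      (1 + Λ * L.ρ x) * pd univ e L.ρ x - 2 * c * inner ℝ (x - L.p) e := by
  have h : DifferentiableWithinAt ℝ L.ρ univ x :=
    ((L.ρ_contDiffAt hx).differentiableAt (by norm_num)).differentiableWithinAt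
  have hn : DifferentiableWithinAt ℝ (fun y : E P.n => (inner ℝ (y - L.p) (y - L.p) : ℝ)) univ x :=
    ((normSq_contDiff L.p).differentiable two_ne_zero x).differentiableWithinAt
  have hB := convexBody_univ (V := E P.n)
  have hu := mem_univ x
  have h2 := h.fun_mul h
  have h3 := (differentiableWithinAt_const (Λ / 2)).fun_mul h2
  unfold H
  rw [pd_add hB hu e (h.fun_add h3) ((differentiableWithinAt_const (-c)).fun_mul hn),
    pd_add hB hu e h h3, pd_const_mul hB hu e _ h2, pd_mul hB hu e h h,
    pd_const_mul hB hu e _ hn, pd_normSq]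
  ring

theorem pd_pd_H_univ (Λ c : ℝ) {x : E P.n} (hx : x ∈ ball L.p P.r) (e : E P.n) :
    pd univ e (pd univ e (L.H Λ c)) x = (1 + Λ * L.ρ x) * pd univ e (pd univ e L.ρ) x
      + Λ * pd univ e L.ρ x ^ 2 - 2 * c * ‖e‖ ^ 2 := by
  have h : ContDiffWithinAt ℝ 2 L.ρ univ x :=
    ((L.ρ_contDiffAt hx).of_le (m := 2) (by norm_num)).contDiffWithinAt
  have hn : ContDiffWithinAt ℝ 2 (fun y : E P.n => (inner ℝ (y - L.p) (y - L.p) : ℝ)) univ x :=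
    (normSq_contDiff L.p).contDiffAt.contDiffWithinAt
  have hB := convexBody_univ (V := E P.n)
  have hu := mem_univ x
  have h2 := h.mul h
  have h3 := (contDiffWithinAt_const (c := Λ / 2)).mul h2
  unfold H
  rw [pd_pd_add hB hu e e (h.add h3) ((contDiffWithinAt_const (c := -c)).mul hn),
    pd_pd_add hB hu e e h h3, pd_pd_const_mul hB hu e e _ h2, pd_pd_mul hB hu e e h h,
    pd_pd_const_mul hB hu e e _ hn, pd_pd_normSq]
  ring

end LocalSetup

/-- A family of barriers with uniform constants. -/
structure BarrierConst (P : Params) where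
  (Λ c δ : ℝ)
  c_pos : 0 < c
  δ_pos : 0 < δ
  δ_lt : δ < P.r
  H_le : ∀ (L : LocalSetup P), ∀ x ∈ L.D.S, ‖x - L.p‖ ≤ δ → L.H Λ c x ≤ -c * ‖x - L.p‖ ^ 2
  abs_H_le : ∀ (L : LocalSetup P), ∀ x ∈ L.D.S, ‖x - L.p‖ ≤ δ →
    |L.H Λ c x| ≤ (2 * P.K1 + 1) * ‖x - L.p‖
  convex : ∀ (L : LocalSetup P), ∀ x ∈ L.D.S, ‖x - L.p‖ ≤ δ → ∀ e,
    c * ‖e‖ ^ 2 ≤ pd L.D.S e (pd L.D.S e (L.H Λ c)) x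
  abs_pd_le : ∀ (L : LocalSetup P), ∀ x ∈ L.D.S, ‖x - L.p‖ ≤ δ → ∀ e,
    |pd L.D.S e (L.H Λ c) x| ≤ (2 * P.K1 + 1) * ‖e‖
  grad_ge : ∀ (L : LocalSetup P), ∀ x ∈ L.D.S, ‖x - L.p‖ ≤ δ → ∃ v, ‖v‖ = 1 ∧
    1 / 2 ≤ pd L.D.S v (L.H Λ c) x

set_option maxHeartbeats 1000000 in
-- The function ρ is convex along the boundary only. The term Λρ²/2 adds ΛDρ ⊗ Dρ, which supplies
-- convexity in the normal direction, and -c|y - p|² makes the barrier strictly negative away from p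
-- while costing only part of the convexity. Near p the derivatives of ρ are close to their values
-- at p, with a modulus depending on `K1` only.
theorem exists_barrierConst (P : Params) : Nonempty (BarrierConst P) := by
  have hκ := P.κ_pos
  have hK := P.one_le_K1
  have hr := P.r_pos
  set Λ := P.K1 + 2 * P.K1 ^ 2 / P.κ + P.κ / 2 with hΛ
  have hΛ0 : 0 < Λ := by positivity
  set c := P.κ / 16 with hc
  have hc0 : 0 < c := by positivity
  -- The four summands encode the smallness conditions on δ: δ ≤ 1, oscillation of the Hessian below
  -- κ/8, |Λρ| ≤ 1/4, and 2cδ ≤ 1/4.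
  set T := 1 + 8 * (P.K1 + 3 * Λ * P.K1 ^ 2) / P.κ + 4 * (Λ * P.K1) + 8 * c with hT
  have hT0 : 0 < T := by positivity
  set δ := min (P.r / 2) (1 / T) with hδ
  have hδ0 : 0 < δ := by positivity
  have hδr : δ < P.r := by have := min_le_left (P.r / 2) (1 / T); linarith
  have hδT : δ * T ≤ 1 := by
    have : δ ≤ 1 / T := min_le_right _ _
    rwa [le_div_iff₀ hT0] at this
  have p1 : 0 ≤ δ * (8 * (P.K1 + 3 * Λ * P.K1 ^ 2) / P.κ) := by positivity
  have p2 : 0 ≤ δ * (4 * (Λ * P.K1)) := by positivity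
  have p3 : 0 ≤ δ * (8 * c) := by positivity
  have hexp : δ + δ * (8 * (P.K1 + 3 * Λ * P.K1 ^ 2) / P.κ) + δ * (4 * (Λ * P.K1))
      + δ * (8 * c) ≤ 1 := by rw [hT] at hδT; linarith
  have d1 : δ ≤ 1 := by linarith
  have d2 : (P.K1 + 3 * Λ * P.K1 ^ 2) * δ ≤ P.κ / 8 := by
    have : δ * (8 * (P.K1 + 3 * Λ * P.K1 ^ 2) / P.κ) ≤ 1 := by linarith
    rw [← mul_div_assoc, div_le_iff₀ hκ] at this
    linarith
  have d3 : Λ * P.K1 * δ ≤ 1 / 4 := by linarith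
  have d4 : 2 * c * δ ≤ 1 / 4 := by linarith
  have ball_of : ∀ (L : LocalSetup P) (x : E P.n), ‖x - L.p‖ ≤ δ → x ∈ ball L.p P.r := by
    intro L x hx
    rw [mem_ball, dist_eq_norm]; linarith
  have ρsmall : ∀ (L : LocalSetup P) (x : E P.n), ‖x - L.p‖ ≤ δ → |Λ * L.ρ x| ≤ 1 / 4 := by
    intro L x hx
    rw [abs_mul, abs_of_pos hΛ0]
    have := L.abs_ρ_le (ball_of L x hx)
    calc Λ * |L.ρ x| ≤ Λ * (P.K1 * ‖x - L.p‖) := by gcongr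
      _ ≤ Λ * (P.K1 * δ) := by gcongr
      _ ≤ 1 / 4 := by linarith
  have pdH : ∀ (L : LocalSetup P), ∀ x ∈ L.D.S, ‖x - L.p‖ ≤ δ → ∀ e,
      pd L.D.S e (L.H Λ c) x =
        (1 + Λ * L.ρ x) * pd univ e L.ρ x - 2 * c * inner ℝ (x - L.p) e := by
    intro L x hxS hx e
    rw [pd_eq_pd_univ L.D.body hxS
      ((L.H_contDiffAt Λ c (ball_of L x hx)).differentiableAt two_ne_zero),
      L.pd_H_univ Λ c (ball_of L x hx)]
  have hin : ∀ (L : LocalSetup P) (x e : E P.n), ‖x - L.p‖ ≤ δ →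
      |2 * c * inner ℝ (x - L.p) e| ≤ 1 / 4 * ‖e‖ := by
    intro L x e hx
    rw [abs_mul, abs_of_pos (by positivity)]
    calc 2 * c * |inner ℝ (x - L.p) e| ≤ 2 * c * (‖x - L.p‖ * ‖e‖) := by
          gcongr; exact abs_real_inner_le_norm _ _
      _ ≤ 2 * c * (δ * ‖e‖) := by gcongr
      _ = 2 * c * δ * ‖e‖ := by ring
      _ ≤ _ := by gcongr
  refine ⟨⟨Λ, c, δ, hc0, hδ0, hδr, ?_, ?_, ?_, ?_, ?_⟩⟩
  · intro L x hxS hx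
    have h1 := L.ρ_nonpos (ball_of L x hx) hxS
    have h2 := (abs_le.1 (ρsmall L x hx)).1
    unfold LocalSetup.H
    rw [real_inner_self_eq_norm_sq]
    have : L.ρ x * (1 + Λ * L.ρ x / 2) ≤ 0 := mul_nonpos_of_nonpos_of_nonneg h1 (by linarith)
    nlinarith
  · intro L x hxS hx
    have h1 := L.abs_ρ_le (ball_of L x hx)
    have h2 := abs_le.1 (ρsmall L x hx)
    unfold LocalSetup.H
    rw [real_inner_self_eq_norm_sq]
    have e1 : L.ρ x + Λ / 2 * (L.ρ x * L.ρ x) + -c * ‖x - L.p‖ ^ 2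
        = L.ρ x * (1 + Λ * L.ρ x / 2) + -(c * ‖x - L.p‖ * ‖x - L.p‖) := by ring
    rw [e1]
    refine (abs_add_le _ _).trans ?_
    rw [abs_neg, abs_mul, abs_of_nonneg (show 0 ≤ c * ‖x - L.p‖ * ‖x - L.p‖ by positivity)]
    have h3 : |1 + Λ * L.ρ x / 2| ≤ 2 := abs_le.2 ⟨by linarith, by linarith⟩
    have h4 : c * ‖x - L.p‖ ≤ 1 := by
      have : c * ‖x - L.p‖ ≤ c * δ := by gcongr
      linarith
    have h5 : |L.ρ x| * |1 + Λ * L.ρ x / 2| ≤ P.K1 * ‖x - L.p‖ * 2 :=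
      mul_le_mul h1 h3 (abs_nonneg _) (by positivity)
    nlinarith [norm_nonneg (x - L.p)]
  · intro L x hxS hx e
    have hxb := ball_of L x hx
    rw [pd_pd_eq_pd_pd_univ L.D.body hxS (L.H_contDiffAt Λ c hxb), L.pd_pd_H_univ Λ c hxb]
    have h1 := L.le_pd_pd_ρ_add e
    rw [← hΛ] at h1
    have h2 := (abs_le.1 (L.abs_pd_pd_ρ_sub_le hxb e)).1
    have h3 := L.abs_pd_ρ_sub_le hxb e
    have h4 := L.abs_pd_ρ_le hxb e
    have h5 := L.abs_pd_ρ_le L.p_mem_ball e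
    have h6 := L.abs_pd_pd_ρ_le hxb e e
    have h7 := L.abs_ρ_le hxb
    set N := ‖e‖ ^ 2 with hN
    have hN0 : 0 ≤ N := by positivity
    have k1 : P.K1 * N * ‖x - L.p‖ ≤ P.K1 * δ * N := by
      have : P.K1 * N * ‖x - L.p‖ ≤ P.K1 * N * δ := by gcongr
      linarith
    have k2 : |pd univ e L.ρ L.p ^ 2 - pd univ e L.ρ x ^ 2| ≤ 2 * P.K1 ^ 2 * δ * N := by
      have : pd univ e L.ρ L.p ^ 2 - pd univ e L.ρ x ^ 2 =
        -(pd univ e L.ρ x - pd univ e L.ρ L.p) * (pd univ e L.ρ L.p + pd univ e L.ρ x) := by ring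
      rw [this, abs_mul, abs_neg]
      calc _ ≤ (P.K1 * ‖e‖ * ‖x - L.p‖) * (P.K1 * ‖e‖ + P.K1 * ‖e‖) := by
            refine mul_le_mul h3 ((abs_add_le _ _).trans (add_le_add h5 h4)) (abs_nonneg _)
              (by positivity)
        _ ≤ (P.K1 * ‖e‖ * δ) * (P.K1 * ‖e‖ + P.K1 * ‖e‖) := by gcongr
        _ = _ := by rw [hN]; ring
    have k3 : |Λ * L.ρ x * pd univ e (pd univ e L.ρ) x| ≤ Λ * P.K1 ^ 2 * δ * N := by
      rw [abs_mul, abs_mul, abs_of_pos hΛ0]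
      calc _ ≤ Λ * (P.K1 * ‖x - L.p‖) * (P.K1 * ‖e‖ * ‖e‖) := by gcongr
        _ ≤ Λ * (P.K1 * δ) * (P.K1 * ‖e‖ * ‖e‖) := by gcongr
        _ = _ := by rw [hN]; ring
    have k4 := (abs_le.1 k3).1
    have k5 : Λ * (pd univ e L.ρ L.p ^ 2 - pd univ e L.ρ x ^ 2) ≤ Λ * (2 * P.K1 ^ 2 * δ * N) :=
      mul_le_mul_of_nonneg_left ((le_abs_self _).trans k2) hΛ0.le
    have k6 : (P.K1 + 3 * Λ * P.K1 ^ 2) * δ * N ≤ P.κ / 8 * N := by gcongr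
    have k7 : c * N = P.κ / 16 * N := by rw [hc]
    have k8 : 0 ≤ P.κ * N := by positivity
    linarith
  · intro L x hxS hx e
    rw [pdH L x hxS hx]
    have h2 := abs_le.1 (ρsmall L x hx)
    have h4 := L.abs_pd_ρ_le (ball_of L x hx) e
    have h5 : |1 + Λ * L.ρ x| ≤ 2 := abs_le.2 ⟨by linarith, by linarith⟩
    refine (abs_sub _ _).trans ?_
    rw [abs_mul]
    have h6 : |1 + Λ * L.ρ x| * |pd univ e L.ρ x| ≤ 2 * (P.K1 * ‖e‖) :=
      mul_le_mul h5 h4 (abs_nonneg _) (by norm_num)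
    nlinarith [hin L x e hx, norm_nonneg e]
  · intro L x hxS hx
    have hxb := ball_of L x hx
    have hg1 := L.one_le_norm_grad hxb
    have hgn : ‖L.grad x‖ ≠ 0 := by linarith
    refine ⟨‖L.grad x‖⁻¹ • L.grad x, ?_, ?_⟩
    · rw [norm_smul, norm_inv, norm_norm, inv_mul_cancel₀ hgn]
    · rw [pdH L x hxS hx]
      have h2 := abs_le.1 (ρsmall L x hx)
      have h3 := hin L x (‖L.grad x‖⁻¹ • L.grad x) hx
      rw [norm_smul, norm_inv, norm_norm, inv_mul_cancel₀ hgn] at h3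
      have h4 : pd univ (‖L.grad x‖⁻¹ • L.grad x) L.ρ x = ‖L.grad x‖ := by
        rw [← L.inner_grad, inner_smul_right, real_inner_self_eq_norm_sq]
        field_simp
      rw [h4]
      have h5 := (abs_le.1 h3).2
      nlinarith

end Barrier
end HessianNeumann

namespace HessianNeumann

/-! ### Auxiliary functions built from ρ, φ and Du, and their uniform jets. -/

section BoundaryFunctions
open Filter Topology

namespace LocalSetup

variable {P : Params} (L : LocalSetup P)

/-- First derivatives of the defining function. -/
def rd (l : Fin P.n) : E P.n → ℝ := pd univ (EuclideanSpace.single l 1) L.ρ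

/-- Second derivatives of the defining function. -/
def rdd (l m : Fin P.n) : E P.n → ℝ := pd univ (EuclideanSpace.single l 1) (L.rd m)

/-- The square of the length of the gradient of the defining function, and derived functions. -/
def q (y : E P.n) : ℝ := ∑ l, L.rd l y * L.rd l y

/-- The length of the gradient of the defining function. -/
def s (y : E P.n) : ℝ := √(L.q y)

/-- The inverse of `s`. -/
def si (y : E P.n) : ℝ := (√(L.q y))⁻¹

/-- The inverse of `q`. -/
def qi (y : E P.n) : ℝ := (L.q y)⁻¹

/-- The boundary datum along the solution. -/
def φu (y : E P.n) : ℝ := Function.uncurry L.D.φ (y, L.D.u y)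

/-- The `x`-derivatives of the boundary datum along the solution. -/
def φx (l : Fin P.n) (y : E P.n) : ℝ :=
  pd (L.D.S ×ˢ univ) (EuclideanSpace.single l 1, 0) (Function.uncurry L.D.φ) (y, L.D.u y)

/-- The `z`-derivative of the boundary datum along the solution. -/
def φz (y : E P.n) : ℝ :=
  pd (L.D.S ×ˢ univ) (0, 1) (Function.uncurry L.D.φ) (y, L.D.u y)

/-- Derivatives of `s`. -/
def sd (l : Fin P.n) (y : E P.n) : ℝ := (∑ m, L.rd m y * L.rdd l m y) * L.si y

/-- The boundary datum for the unnormalized normal derivative. -/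
def φt (y : E P.n) : ℝ := L.s y * L.φu y

/-- The boundary condition, extended to the interior: it vanishes on the boundary. -/
def w (y : E P.n) : ℝ := ∑ l, L.rd l y * L.D.du l y + -L.φt y

/-- Coefficients of the first derivatives in the mixed second derivatives. -/
def ca (l m : Fin P.n) (y : E P.n) : ℝ := (if l = m then 1 else 0) * (L.s y * L.φz y) - L.rdd l m y

/-- The part of order zero of the mixed second derivatives. -/
def cb (l : Fin P.n) (y : E P.n) : ℝ := L.s y * L.φx l y + L.φu y * L.sd l y

/-- The expression for the mixed second derivatives on the boundary. -/
def cc (l : Fin P.n) (y : E P.n) : ℝ := ∑ m, L.ca l m y * L.D.du m y + L.cb l y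

/-- The normal component of a direction. -/
def θ (ξ : E P.n) (y : E P.n) : ℝ := (∑ m, ξ m * L.rd m y) * L.qi y

/-- The correction term in the test function for the second derivatives, as a first-order
expression in the solution. -/
def wa (ξ : E P.n) (m : Fin P.n) (y : E P.n) : ℝ :=
  2 * (L.θ ξ y * ∑ l, (ξ l - L.θ ξ y * L.rd l y) * L.ca l m y)

/-- The part of order zero of the correction term. -/
def wb (ξ : E P.n) (y : E P.n) : ℝ :=
  2 * (L.θ ξ y * ∑ l, (ξ l - L.θ ξ y * L.rd l y) * L.cb l y)

/-- The correction term in the test function for the second derivatives. -/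
def wx (ξ : E P.n) (y : E P.n) : ℝ := ∑ m, L.wa ξ m y * L.D.du m y + L.wb ξ y

/-- The first-order form of the correction suits the linearized operator; this product form shows
that it vanishes for tangential directions. -/
theorem wx_eq (ξ y : E P.n) :
    L.wx ξ y = 2 * (L.θ ξ y * ∑ l, (ξ l - L.θ ξ y * L.rd l y) * L.cc l y) := by
  unfold wx wa wb cc
  have h1 : ∑ l, (ξ l - L.θ ξ y * L.rd l y) * (∑ m, L.ca l m y * L.D.du m y + L.cb l y)
      = ∑ m, (∑ l, (ξ l - L.θ ξ y * L.rd l y) * L.ca l m y) * L.D.du m y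
        + ∑ l, (ξ l - L.θ ξ y * L.rd l y) * L.cb l y := by
    simp only [mul_add, Finset.sum_add_distrib, Finset.mul_sum, Finset.sum_mul]
    rw [Finset.sum_comm]
    congr 1
    exact Finset.sum_congr rfl fun _ _ => Finset.sum_congr rfl fun _ _ => by ring
  rw [h1, mul_add, mul_add]
  congr 1
  rw [← mul_assoc, Finset.mul_sum]
  exact Finset.sum_congr rfl fun _ _ => by ring

theorem grad_apply (y : E P.n) (l : Fin P.n) : L.grad y l = L.rd l y := by
  have := L.inner_grad y (EuclideanSpace.single l 1)
  rw [EuclideanSpace.inner_single_right] at this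
  simp only [one_mul, conj_trivial] at this
  exact this

theorem q_eq (y : E P.n) : L.q y = ‖L.grad y‖ ^ 2 := by
  rw [EuclideanSpace.real_norm_sq_eq]
  exact Finset.sum_congr rfl fun l _ => by rw [grad_apply]; ring

theorem one_le_q {y : E P.n} (hy : y ∈ ball L.p P.r) : 1 ≤ L.q y := by
  rw [q_eq]; exact one_le_pow₀ (L.one_le_norm_grad hy)

theorem s_eq (y : E P.n) : L.s y = ‖L.grad y‖ := by
  unfold s; rw [q_eq, Real.sqrt_sq (norm_nonneg _)]

theorem pd_ρ_eq_sum (e y : E P.n) : pd univ e L.ρ y = ∑ l, e l * L.rd l y := by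
  conv_lhs => rw [← Setup.sum_single e]
  rw [pd_sum_vec]
  exact Finset.sum_congr rfl fun l _ => pd_smul_vec _ _ _ _

theorem pd_rd_eq_sum (e y : E P.n) (m : Fin P.n) :
    pd univ e (L.rd m) y = ∑ l, e l * L.rdd l m y := by
  conv_lhs => rw [← Setup.sum_single e]
  rw [pd_sum_vec]
  exact Finset.sum_congr rfl fun l _ => pd_smul_vec _ _ _ _

end LocalSetup

/-- A point near a boundary point, and a direction. -/
structure LocalPoint (P : Params) where
  L : LocalSetup P
  x : E P.n
  mem : x ∈ L.D.S
  near : x ∈ ball L.p P.r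
  ξ : E P.n
  norm_le : ‖ξ‖ ≤ 1

/-- The underlying point data. -/
def LocalPoint.pt {P : Params} (i : LocalPoint P) : PointData (E P.n) := i.L.D.pt i.mem

section Uniform

variable {P : Params}

local notation "Dp" => LocalPoint.pt (P := P)

theorem unifJet_rd (l : Fin P.n) : UnifJet Dp (fun i => i.L.rd l) := by
  refine ⟨P.K1, fun i => DerivBound.jetBound ?_⟩
  have := ((i.L.ρ_derivBound i.near).pd convexBody_univ (mem_univ _)
    (EuclideanSpace.single l 1)).of_le (m' := 2) (by norm_num)
  rwa [norm_single_one, one_mul] at this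

/-- A 2-jet of D²ρ: the four derivatives of the boundary are used here. -/
theorem unifJet_rdd (l m : Fin P.n) : UnifJet Dp (fun i => i.L.rdd l m) := by
  refine ⟨P.K1, fun i => DerivBound.jetBound ?_⟩
  have := (((i.L.ρ_derivBound i.near).pd convexBody_univ (mem_univ _)
    (EuclideanSpace.single m 1)).pd convexBody_univ (mem_univ _) (EuclideanSpace.single l 1)).of_le
    (m' := 2) (by norm_num)
  rwa [norm_single_one, norm_single_one, one_mul, one_mul] at this

theorem unifJet_q : UnifJet Dp (fun i => i.L.q) :=
  UnifJet.sum _ fun l _ => (unifJet_rd l).mul (unifJet_rd l)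

theorem unifJet_s : UnifJet Dp (fun i => i.L.s) :=
  unifJet_q.comp one_pos (fun i => i.L.one_le_q i.near) (Θ := Real.sqrt)
    fun _ hx => (Real.contDiffAt_sqrt (ne_of_gt hx)).contDiffWithinAt

theorem unifJet_si : UnifJet Dp (fun i => i.L.si) :=
  unifJet_q.comp one_pos (fun i => i.L.one_le_q i.near) (Θ := fun t => (√t)⁻¹)
    fun _ hx => ((Real.contDiffAt_sqrt (ne_of_gt hx)).inv
      (Real.sqrt_pos.2 hx).ne').contDiffWithinAt

theorem unifJet_qi : UnifJet Dp (fun i => i.L.qi) :=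
  unifJet_q.comp one_pos (fun i => i.L.one_le_q i.near) (Θ := fun t => t⁻¹)
    fun _ hx => (contDiffAt_inv ℝ (ne_of_gt hx)).contDiffWithinAt

theorem unifJet_φu : UnifJet Dp (fun i => i.L.φu) :=
  ⟨P.B * (1 + P.M) ^ 2, fun i => DerivBound.jetBound_graph (D := i.pt)
    (fun e => i.L.D.abs_pd_u_le i.mem e) i.L.D.M_nonneg
    ((i.L.D.φ_derivBound i.mem).of_le (m' := 2) (by norm_num))⟩

/-- A 2-jet of a first derivative of φ uses the C³ bound on φ. -/
theorem unifJet_φx (l : Fin P.n) : UnifJet Dp (fun i => i.L.φx l) :=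
  ⟨_, fun i => DerivBound.jetBound_graph (D := i.pt)
    (fun e => i.L.D.abs_pd_u_le i.mem e) i.L.D.M_nonneg
    ((i.L.D.φ_derivBound i.mem).pd i.L.D.body.prod_univ (mk_mem_prod i.mem (mem_univ _)) _)⟩

theorem unifJet_φz : UnifJet Dp (fun i => i.L.φz) :=
  ⟨_, fun i => DerivBound.jetBound_graph (D := i.pt)
    (fun e => i.L.D.abs_pd_u_le i.mem e) i.L.D.M_nonneg
    ((i.L.D.φ_derivBound i.mem).pd i.L.D.body.prod_univ (mk_mem_prod i.mem (mem_univ _)) _)⟩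

theorem unifJet_sd (l : Fin P.n) : UnifJet Dp (fun i => i.L.sd l) :=
  (UnifJet.sum _ fun m _ => (unifJet_rd m).mul (unifJet_rdd l m)).mul unifJet_si

theorem unifJet_φt : UnifJet Dp (fun i => i.L.φt) := unifJet_s.mul unifJet_φu

theorem unifJet_ca (l m : Fin P.n) : UnifJet Dp (fun i => i.L.ca l m) :=
  ((unifJet_s.mul unifJet_φz).const_mul _).sub (unifJet_rdd l m)

theorem unifJet_cb (l : Fin P.n) : UnifJet Dp (fun i => i.L.cb l) :=
  (unifJet_s.mul (unifJet_φx l)).add (unifJet_φu.mul (unifJet_sd l))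

theorem abs_apply_le (i : LocalPoint P) (l : Fin P.n) : |i.ξ l| ≤ 1 :=
  (PiLp.norm_apply_le i.ξ l).trans i.norm_le

theorem unifJet_ξ (l : Fin P.n) : UnifJet Dp (fun i _ => i.ξ l) :=
  unifJet_const_of_bound fun i => abs_apply_le i l

theorem unifJet_θ : UnifJet Dp (fun i => i.L.θ i.ξ) :=
  (UnifJet.sum _ fun m _ => (unifJet_ξ m).mul (unifJet_rd m)).mul unifJet_qi

theorem unifJet_wa (m : Fin P.n) : UnifJet Dp (fun i => i.L.wa i.ξ m) :=
  (unifJet_θ.mul (UnifJet.sum _ fun l _ =>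
    ((unifJet_ξ l).sub (unifJet_θ.mul (unifJet_rd l))).mul (unifJet_ca l m))).const_mul 2

theorem unifJet_wb : UnifJet Dp (fun i => i.L.wb i.ξ) :=
  (unifJet_θ.mul (UnifJet.sum _ fun l _ =>
    ((unifJet_ξ l).sub (unifJet_θ.mul (unifJet_rd l))).mul (unifJet_cb l))).const_mul 2

end Uniform

/-- Uniform bounds for all the functions that enter the test functions. -/
structure JetConst (P : Params) where
  C : ℝ
  one_le : 1 ≤ C
  F : ∀ (D : Setup P) (x : E P.n) (hx : x ∈ D.S), JetBound (D.pt hx) C D.F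
  rd : ∀ l (i : LocalPoint P), JetBound i.pt C (i.L.rd l)
  s : ∀ i : LocalPoint P, JetBound i.pt C i.L.s
  φu : ∀ i : LocalPoint P, JetBound i.pt C i.L.φu
  φt : ∀ i : LocalPoint P, JetBound i.pt C i.L.φt
  ca : ∀ l m (i : LocalPoint P), JetBound i.pt C (i.L.ca l m)
  cb : ∀ l (i : LocalPoint P), JetBound i.pt C (i.L.cb l)
  θ : ∀ i : LocalPoint P, JetBound i.pt C (i.L.θ i.ξ)
  wa : ∀ m (i : LocalPoint P), JetBound i.pt C (i.L.wa i.ξ m)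
  wb : ∀ i : LocalPoint P, JetBound i.pt C (i.L.wb i.ξ)

theorem exists_jetBound_fintype {P : Params} {ι : Type*} [Fintype ι] {g : ι → LocalPoint P → E P.n → ℝ}
    (hg : ∀ l, UnifJet (LocalPoint.pt (P := P)) (g l)) :
    ∃ C, ∀ l i, JetBound (LocalPoint.pt i) C (g l i) := by
  choose C hC using hg
  refine ⟨∑ l, |C l|, fun l i => (hC l i).mono ?_⟩
  exact (le_abs_self _).trans (Finset.single_le_sum (f := fun l => |C l|)
    (fun _ _ => abs_nonneg _) (Finset.mem_univ l))

theorem exists_jetConst (P : Params) : Nonempty (JetConst P) := by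
  obtain ⟨c1, h1⟩ := exists_jetBound_F P
  obtain ⟨c2, h2⟩ := exists_jetBound_fintype (unifJet_rd (P := P))
  obtain ⟨c3, h3⟩ := unifJet_s (P := P)
  obtain ⟨c4, h4⟩ := unifJet_φu (P := P)
  obtain ⟨c5, h5⟩ := unifJet_φt (P := P)
  obtain ⟨c6, h6⟩ := exists_jetBound_fintype (ι := Fin P.n × Fin P.n)
    (fun lm => unifJet_ca (P := P) lm.1 lm.2)
  obtain ⟨c7, h7⟩ := exists_jetBound_fintype (unifJet_cb (P := P))
  obtain ⟨c8, h8⟩ := unifJet_θ (P := P)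
  obtain ⟨c9, h9⟩ := exists_jetBound_fintype (unifJet_wa (P := P))
  obtain ⟨c10, h10⟩ := unifJet_wb (P := P)
  have hle : ∀ c ∈ [1, c1, c2, c3, c4, c5, c6, c7, c8, c9, c10],
      c ≤ 1 + |c1| + |c2| + |c3| + |c4| + |c5| + |c6| + |c7| + |c8| + |c9| + |c10| := by
    have a1 := abs_nonneg c1; have a2 := abs_nonneg c2; have a3 := abs_nonneg c3
    have a4 := abs_nonneg c4; have a5 := abs_nonneg c5; have a6 := abs_nonneg c6
    have a7 := abs_nonneg c7; have a8 := abs_nonneg c8; have a9 := abs_nonneg c9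
    have a10 := abs_nonneg c10
    intro c hc
    simp only [List.mem_cons, List.not_mem_nil, or_false] at hc
    rcases hc with h | h | h | h | h | h | h | h | h | h | h <;> subst h <;>
      first | linarith | linarith [le_abs_self c]
  exact ⟨⟨_, hle 1 (by simp), fun D x hx => (h1 D x hx).mono (hle _ (by simp)),
    fun l i => (h2 l i).mono (hle _ (by simp)), fun i => (h3 i).mono (hle _ (by simp)),
    fun i => (h4 i).mono (hle _ (by simp)), fun i => (h5 i).mono (hle _ (by simp)),
    fun l m i => (h6 (l, m) i).mono (hle _ (by simp)), fun l i => (h7 l i).mono (hle _ (by simp)),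
    fun i => (h8 i).mono (hle _ (by simp)), fun l i => (h9 l i).mono (hle _ (by simp)),
    fun i => (h10 i).mono (hle _ (by simp))⟩⟩

end BoundaryFunctions
end HessianNeumann

namespace HessianNeumann

/-! ### Tangential differentiation of the boundary condition. -/

section BoundaryIdentities
open Filter Topology

theorem UnifJet.contDiff {V I : Type*} [NormedAddCommGroup V] [NormedSpace ℝ V]
    {D : I → PointData V} {g : I → V → ℝ} (h : UnifJet D g) (i : I) :
    ContDiffWithinAt ℝ 2 (g i) (D i).S (D i).x :=
  (h.choose_spec i).contDiff

namespace LocalSetup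

variable {P : Params} (L : LocalSetup P) {y : E P.n}

/-- A point near the base point, with the trivial direction. -/
def pointAt (hS : y ∈ L.D.S) (hb : y ∈ ball L.p P.r) : LocalPoint P :=
  ⟨L, y, hS, hb, 0, by simp⟩

variable (hS : y ∈ L.D.S) (hb : y ∈ ball L.p P.r)
include hS hb

theorem rd_two (l : Fin P.n) : ContDiffWithinAt ℝ 2 (L.rd l) L.D.S y :=
  (unifJet_rd l).contDiff (L.pointAt hS hb)

theorem s_two : ContDiffWithinAt ℝ 2 L.s L.D.S y := unifJet_s.contDiff (L.pointAt hS hb)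

theorem q_two : ContDiffWithinAt ℝ 2 L.q L.D.S y := unifJet_q.contDiff (L.pointAt hS hb)

theorem φu_two : ContDiffWithinAt ℝ 2 L.φu L.D.S y := unifJet_φu.contDiff (L.pointAt hS hb)

theorem φt_two : ContDiffWithinAt ℝ 2 L.φt L.D.S y := unifJet_φt.contDiff (L.pointAt hS hb)

theorem ca_two (l m : Fin P.n) : ContDiffWithinAt ℝ 2 (L.ca l m) L.D.S y :=
  (unifJet_ca l m).contDiff (L.pointAt hS hb)

theorem cb_two (l : Fin P.n) : ContDiffWithinAt ℝ 2 (L.cb l) L.D.S y :=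
  (unifJet_cb l).contDiff (L.pointAt hS hb)

theorem cc_two (l : Fin P.n) : ContDiffWithinAt ℝ 2 (L.cc l) L.D.S y :=
  (ContDiffWithinAt.sum fun m _ => (L.ca_two hS hb l m).mul (L.D.du_two hS m)).add
    (L.cb_two hS hb l)

theorem w_two : ContDiffWithinAt ℝ 2 L.w L.D.S y :=
  (ContDiffWithinAt.sum fun m _ => (L.rd_two hS hb m).mul (L.D.du_two hS m)).add
    (L.φt_two hS hb).neg

theorem pd_rd (e : E P.n) (m : Fin P.n) :
    pd L.D.S e (L.rd m) y = ∑ l, e l * L.rdd l m y := by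
  have h : DifferentiableAt ℝ (L.rd m) y := (L.pd_ρ_two hb _).differentiableAt two_ne_zero
  rw [pd_eq_pd_univ L.D.body hS h, L.pd_rd_eq_sum]

theorem pd_q (e : E P.n) :
    pd L.D.S e L.q y = 2 * ∑ m, L.rd m y * ∑ l, e l * L.rdd l m y := by
  have hd := fun m => (L.rd_two hS hb m).differentiableWithinAt two_ne_zero
  unfold q
  rw [pd_sum L.D.body hS e _ fun m _ => (hd m).fun_mul (hd m), Finset.mul_sum]
  refine Finset.sum_congr rfl fun m _ => ?_
  rw [pd_mul L.D.body hS e (hd m) (hd m), L.pd_rd hS hb]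
  ring

theorem pd_s (e : E P.n) : pd L.D.S e L.s y = ∑ l, e l * L.sd l y := by
  have hq : L.q y ≠ 0 := (lt_of_lt_of_le one_pos (L.one_le_q hb)).ne'
  unfold s
  rw [pd_comp L.D.body hS e (Θ := Real.sqrt) (Real.hasDerivAt_sqrt hq).differentiableAt
    ((L.q_two hS hb).differentiableWithinAt two_ne_zero), (Real.hasDerivAt_sqrt hq).deriv,
    L.pd_q hS hb]
  unfold sd si
  have h1 : ∑ l, e l * ((∑ m, L.rd m y * L.rdd l m y) * (√(L.q y))⁻¹)
      = (∑ m, L.rd m y * ∑ l, e l * L.rdd l m y) * (√(L.q y))⁻¹ := by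
    simp only [Finset.mul_sum, Finset.sum_mul]
    rw [Finset.sum_comm]
    exact Finset.sum_congr rfl fun _ _ => Finset.sum_congr rfl fun _ _ => by ring
  rw [h1]
  ring

omit hb in
theorem pd_φu (e : E P.n) :
    pd L.D.S e L.φu y = ∑ l, e l * (L.φx l y + L.φz y * L.D.du l y) := by
  unfold φu
  rw [pd_graph L.D.body hS ((L.D.u_two hS).differentiableWithinAt two_ne_zero)
    ((L.D.φ_derivBound hS).contDiff.differentiableWithinAt (by norm_num)), L.D.pd_u_eq_sum]
  have h1 : ((e, 0) : E P.n × ℝ)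
      = ∑ l, e l • ((EuclideanSpace.single l 1, 0) : E P.n × ℝ) := by
    refine Prod.ext ?_ ?_
    · rw [Prod.fst_sum]
      exact (Setup.sum_single e).symm
    · rw [Prod.snd_sum]; simp
  rw [h1, pd_sum_vec, Finset.sum_mul, ← Finset.sum_add_distrib]
  refine Finset.sum_congr rfl fun l _ => ?_
  rw [pd_smul_vec]
  unfold φx φz
  ring

theorem pd_φt (e : E P.n) : pd L.D.S e L.φt y =
    ∑ l, e l * (L.s y * (L.φx l y + L.φz y * L.D.du l y) + L.φu y * L.sd l y) := by
  unfold φt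
  rw [pd_mul L.D.body hS e ((L.s_two hS hb).differentiableWithinAt two_ne_zero)
    ((L.φu_two hS hb).differentiableWithinAt two_ne_zero), L.pd_s hS hb, L.pd_φu hS,
    Finset.mul_sum, Finset.sum_mul, ← Finset.sum_add_distrib]
  exact Finset.sum_congr rfl fun l _ => by ring

omit hS hb in
theorem sum_cc (e : E P.n) : ∑ l, e l * L.cc l y =
    ∑ l, e l * (L.s y * (L.φx l y + L.φz y * L.D.du l y) + L.φu y * L.sd l y)
      - ∑ m, (∑ l, e l * L.rdd l m y) * L.D.du m y := by
  have h1 : ∑ m, (∑ l, e l * L.rdd l m y) * L.D.du m y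
      = ∑ l, e l * ∑ m, L.rdd l m y * L.D.du m y := by
    simp only [Finset.mul_sum, Finset.sum_mul]
    rw [Finset.sum_comm]
    exact Finset.sum_congr rfl fun _ _ => Finset.sum_congr rfl fun _ _ => by ring
  rw [h1, ← Finset.sum_sub_distrib]
  refine Finset.sum_congr rfl fun l _ => ?_
  have h2 : ∑ m, L.ca l m y * L.D.du m y
      = L.s y * L.φz y * L.D.du l y - ∑ m, L.rdd l m y * L.D.du m y := by
    unfold ca
    simp only [sub_mul, Finset.sum_sub_distrib, ite_mul, one_mul, zero_mul,
      Finset.sum_ite_eq, Finset.mem_univ, if_true]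
  unfold cc cb
  rw [h2]
  ring

/-- Separates the second derivatives of u from those terms that involve u and Du only; `ca` and `cb`
are chosen to collect the latter. -/
theorem pd_w (e : E P.n) : pd L.D.S e L.w y =
    pd L.D.S e (pd L.D.S (L.grad y) L.D.u) y - ∑ l, e l * L.cc l y := by
  have hr := fun m => (L.rd_two hS hb m).differentiableWithinAt two_ne_zero
  have hu := fun m => (L.D.du_two hS m).differentiableWithinAt two_ne_zero
  have hφ := (L.φt_two hS hb).differentiableWithinAt two_ne_zero
  unfold w
  rw [pd_add L.D.body hS e (DifferentiableWithinAt.fun_sum fun m _ => (hr m).fun_mul (hu m)) hφ.fun_neg,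
    pd_sum L.D.body hS e _ fun m _ => (hr m).fun_mul (hu m)]
  have h1 : pd L.D.S e (fun y => -L.φt y) y = -pd L.D.S e L.φt y := by
    have := pd_const_mul L.D.body hS e (-1) hφ
    simpa using this
  rw [h1, L.pd_φt hS hb, L.sum_cc, L.D.hess_eq_sum hS e (L.grad y)]
  have h2 : ∑ m, pd L.D.S e (fun y => L.rd m y * L.D.du m y) y
      = ∑ m, L.grad y m * pd L.D.S e (L.D.du m) y
        + ∑ m, (∑ l, e l * L.rdd l m y) * L.D.du m y := by
    rw [← Finset.sum_add_distrib]
    refine Finset.sum_congr rfl fun m _ => ?_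
    rw [pd_mul L.D.body hS e (hr m) (hu m), L.pd_rd hS hb, L.grad_apply]
  rw [h2]
  ring

omit hS

theorem w_eq_zero (hf : y ∈ frontier L.D.Ω) : L.w y = 0 := by
  have h1 := L.D.solves.2 y hf (‖L.grad y‖⁻¹ • L.grad y)
    ⟨_, _, L.defining.of_mem_ball hb, rfl⟩
  have h2 : pd L.D.S (‖L.grad y‖⁻¹ • L.grad y) L.D.u y = L.φu y := h1
  have h0 : ‖L.grad y‖ ≠ 0 := (lt_of_lt_of_le one_pos (L.one_le_norm_grad hb)).ne'
  rw [pd_smul_vec, L.D.pd_u_eq_sum] at h2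
  unfold w φt
  rw [← h2, L.s_eq]
  simp only [L.grad_apply]
  field_simp
  ring

theorem exists_seq (hf : y ∈ frontier L.D.Ω) {τ : E P.n} (hτ : pd univ τ L.ρ y = 0) :
    ∃ (z : ℕ → E P.n) (t : ℕ → ℝ), (∀ j, 0 < t j) ∧ Tendsto t atTop (𝓝 0) ∧
      (∀ j, z j ∈ frontier L.D.Ω) ∧ Tendsto (fun j => (t j)⁻¹ • (z j - y)) atTop (𝓝 τ) ∧
      Tendsto z atTop (𝓝 y) := by
  have hd := L.defining.of_mem_ball hb
  obtain ⟨z, t, ht, ht0, hz, hzt⟩ := exists_seq_frontier_tangent hd.pos hd.mem_iff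
    (L.ρ_eq_zero hb hf) ((L.ρ_contDiffAt hb).differentiableAt (by norm_num))
    (L.defining.fderiv_ne y hb) (τ := τ) (by rw [← hτ, pd, fderivWithin_univ])
  refine ⟨z, t, ht, ht0, hz, hzt, ?_⟩
  have h1 : Tendsto (fun j => t j • ((t j)⁻¹ • (z j - y)) + y) atTop (𝓝 ((0:ℝ) • τ + y)) :=
    (ht0.smul hzt).add_const y
  rw [zero_smul, zero_add] at h1
  refine h1.congr fun j => ?_
  rw [smul_smul, mul_inv_cancel₀ (ht j).ne', one_smul, sub_add_cancel]

theorem pd_w_tangent (hf : y ∈ frontier L.D.Ω) {τ : E P.n} (hτ : pd univ τ L.ρ y = 0) :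
    pd L.D.S τ L.w y = 0 := by
  obtain ⟨z, t, ht, ht0, hz, hzt, hzy⟩ := L.exists_seq hb hf hτ
  have hS := L.D.frontier_subset hf
  refine (pd_eq_zero_of_seq L.D.body hS (L.w_two hS hb) (L.w_eq_zero hb hf) ht ht0
    (fun j => L.D.frontier_subset (hz j)) ?_ hzt).1
  filter_upwards [hzy (isOpen_ball.mem_nhds hb)] with j hj
  exact L.w_eq_zero hj (hz j)

/-- The proportionality factor between the differential of `w` and that of `ρ`. -/
def wn (y : E P.n) : ℝ := pd L.D.S (L.grad y) L.w y / L.q y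

omit hb in
theorem pd_ρ_grad (y : E P.n) : pd univ (L.grad y) L.ρ y = L.q y := by
  rw [← L.inner_grad, L.q_eq, real_inner_self_eq_norm_sq]

/-- Both w and ρ vanish on the boundary, so their differentials there are proportional. -/
theorem pd_w_eq (hf : y ∈ frontier L.D.Ω) (e : E P.n) :
    pd L.D.S e L.w y = L.wn y * pd univ e L.ρ y := by
  have hq : L.q y ≠ 0 := (lt_of_lt_of_le one_pos (L.one_le_q hb)).ne'
  set θ := pd univ e L.ρ y / L.q y with hθ
  have hτ : pd univ (e + (-θ) • L.grad y) L.ρ y = 0 := by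
    rw [pd_add_vec, pd_smul_vec, L.pd_ρ_grad, hθ]
    field_simp
    ring
  have h1 := L.pd_w_tangent hb hf hτ
  rw [pd_add_vec, pd_smul_vec] at h1
  have h2 : pd L.D.S e L.w y = θ * pd L.D.S (L.grad y) L.w y := by linarith
  rw [h2, hθ, wn]
  ring

/-- The function w - `wn y`·ρ vanishes on the boundary and has zero gradient at y, so its second
tangential derivatives vanish as well. The right-hand side is the curvature term that a boundary
parametrization would produce. -/
theorem pd_pd_w_tangent (hf : y ∈ frontier L.D.Ω) {τ : E P.n} (hτ : pd univ τ L.ρ y = 0) :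
    pd L.D.S τ (pd L.D.S τ L.w) y = L.wn y * pd univ τ (pd univ τ L.ρ) y := by
  obtain ⟨z, t, ht, ht0, hz, hzt, hzy⟩ := L.exists_seq hb hf hτ
  have hS := L.D.frontier_subset hf
  have hρ : ContDiffAt ℝ 2 L.ρ y := (L.ρ_contDiffAt hb).of_le (by norm_num)
  have hρS : ContDiffWithinAt ℝ 2 L.ρ L.D.S y := hρ.contDiffWithinAt
  have hw := L.w_two hS hb
  have hg : ContDiffWithinAt ℝ 2 (fun x => L.w x + (-L.wn y) * L.ρ x) L.D.S y :=
    hw.add (contDiffWithinAt_const.mul hρS)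
  have h1 := (pd_eq_zero_of_seq L.D.body hS hg
    (by rw [L.w_eq_zero hb hf, L.ρ_eq_zero hb hf]; ring) ht ht0
    (fun j => L.D.frontier_subset (hz j)) (by
      filter_upwards [hzy (isOpen_ball.mem_nhds hb)] with j hj
      rw [L.w_eq_zero hj (hz j), L.ρ_eq_zero hj (hz j)]; ring) hzt).2 (fun v => by
      rw [pd_add L.D.body hS v (hw.differentiableWithinAt two_ne_zero)
        ((contDiffWithinAt_const.mul hρS).differentiableWithinAt two_ne_zero),
        pd_const_mul L.D.body hS v _ (hρS.differentiableWithinAt two_ne_zero),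
        L.pd_w_eq hb hf, pd_eq_pd_univ L.D.body hS (hρ.differentiableAt two_ne_zero)]
      ring)
  rw [pd_pd_add L.D.body hS _ _ hw (contDiffWithinAt_const.mul hρS),
    pd_pd_const_mul L.D.body hS _ _ _ hρS, pd_pd_eq_pd_pd_univ L.D.body hS hρ] at h1
  linarith

/-- Mixed second derivatives on the boundary. -/
theorem hess_grad (hf : y ∈ frontier L.D.Ω) (e : E P.n) :
    pd L.D.S e (pd L.D.S (L.grad y) L.D.u) y =
      L.wn y * pd univ e L.ρ y + ∑ l, e l * L.cc l y := by
  rw [← L.pd_w_eq hb hf, L.pd_w (L.D.frontier_subset hf) hb]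
  ring

/-- The second derivative in the normal direction. -/
def nn (y : E P.n) : ℝ := pd L.D.S (L.grad y) (pd L.D.S (L.grad y) L.D.u) y / L.q y

theorem wn_eq (hf : y ∈ frontier L.D.Ω) :
    L.wn y = L.nn y - (∑ l, L.grad y l * L.cc l y) / L.q y := by
  have hq : L.q y ≠ 0 := (lt_of_lt_of_le one_pos (L.one_le_q hb)).ne'
  have := L.hess_grad hb hf (L.grad y)
  rw [L.pd_ρ_grad] at this
  rw [nn, this]
  field_simp
  ring

omit hb in
theorem φz_nonpos (hS : y ∈ L.D.S) : L.φz y ≤ 0 := by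
  refine pd_nonpos_of_eventually_le
    ((L.D.φ_derivBound hS).contDiff.differentiableWithinAt (by norm_num)) ?_
  filter_upwards [self_mem_nhdsWithin] with t ht
  have ht' : (0:ℝ) < t := ht
  refine ⟨by simpa using hS, ?_⟩
  have := L.D.φ_antitone y hS (show L.D.u y ≤ L.D.u y + t by linarith)
  simpa using this

/-- The second derivative in the normal direction does not depend on the defining function. -/
theorem nn_eq_of_mem {L' : LocalSetup P} (hD : L'.D = L.D) (hb' : y ∈ ball L'.p P.r)
    (hf : y ∈ frontier L.D.Ω) : L'.nn y = L.nn y := by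
  have hq : 0 < L.q y := lt_of_lt_of_le one_pos (L.one_le_q hb)
  have hq' : 0 < L'.q y := lt_of_lt_of_le one_pos (L'.one_le_q hb')
  have hf' : y ∈ frontier L'.D.Ω := hD ▸ hf
  -- Both defining functions vanish along the same tangential boundary sequences, so their gradients
  -- at y are parallel and the normalized second derivative agrees.
  have key : ∀ τ, pd univ τ L.ρ y = 0 → pd univ τ L'.ρ y = 0 := by
    intro τ hτ
    obtain ⟨z, t, ht, ht0, hz, hzt, hzy⟩ := L.exists_seq hb hf hτ
    refine (pd_eq_zero_of_seq convexBody_univ (mem_univ y)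
      ((L'.ρ_contDiffAt hb').of_le (by norm_num)).contDiffWithinAt (L'.ρ_eq_zero hb' hf') ht ht0
      (fun _ => mem_univ _) ?_ hzt).1
    filter_upwards [hzy (isOpen_ball.mem_nhds hb')] with j hj
    exact L'.ρ_eq_zero hj (hD ▸ hz j)
  set a := inner ℝ (L.grad y) (L'.grad y) / L.q y with ha
  have h1 : L'.grad y = a • L.grad y := by
    set τ := L'.grad y + (-a) • L.grad y with hτ
    have h2 : inner ℝ (L.grad y) τ = 0 := by
      rw [hτ, inner_add_right, inner_smul_right, real_inner_self_eq_norm_sq, ← L.q_eq, ha]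
      field_simp
      ring
    have h3 : inner ℝ (L'.grad y) τ = 0 := by
      rw [L'.inner_grad]; exact key τ (by rw [← L.inner_grad]; exact h2)
    have h4 : inner ℝ τ τ = 0 := by
      conv_lhs => rw [hτ]
      rw [inner_add_left, inner_smul_left, h2, h3]; simp
    have h5 := inner_self_eq_zero.1 h4
    rw [hτ] at h5
    rw [neg_smul] at h5
    exact sub_eq_zero.1 (by rw [sub_eq_add_neg]; exact h5)
  have h2 : L'.q y = a ^ 2 * L.q y := by
    rw [L'.q_eq, h1, norm_smul, mul_pow, ← L.q_eq, Real.norm_eq_abs, sq_abs]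
  have ha0 : a ≠ 0 := by
    rintro h0
    rw [h0] at h2
    simp at h2
    exact hq'.ne' h2
  unfold nn
  rw [h2, h1, hD, pd_pd_smul_vec L.D.body (L.D.frontier_subset hf) _ _
    (L.D.u_two (L.D.frontier_subset hf))]
  field_simp

end LocalSetup

/-- A bound for the second normal derivatives on the boundary. -/
def Setup.NormalBound {P : Params} (D : Setup P) (M' : ℝ) : Prop :=
  ∀ L : LocalSetup P, L.D = D → |L.nn L.p| ≤ M'

theorem Setup.NormalBound.abs_nn_le {P : Params} {L : LocalSetup P} {M' : ℝ}
    (h : L.D.NormalBound M') {y : E P.n} (hb : y ∈ ball L.p P.r) (hf : y ∈ frontier L.D.Ω) :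
    |L.nn y| ≤ M' := by
  obtain ⟨L', h1, h2⟩ := L.D.exists_local hf
  rw [← L.nn_eq_of_mem hb h1 (by rw [h2]; exact mem_ball_self P.r_pos) hf]
  have := h L' h1
  rwa [h2] at this

end BoundaryIdentities
end HessianNeumann

namespace HessianNeumann

/-! ### Boundary bounds for the auxiliary functions and the corrected second derivatives. -/

section BoundaryEstimates
open Filter Topology

namespace Setup

variable {P : Params} (D : Setup P) {x : E P.n}

theorem hess_comm (hx : x ∈ D.S) (a b : E P.n) :
    pd D.S a (pd D.S b D.u) x = pd D.S b (pd D.S a D.u) x :=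
  pd_pd_comm D.body hx a b (D.u_two hx)

theorem hess_add_right (hx : x ∈ D.S) (a b b' : E P.n) :
    pd D.S a (pd D.S (b + b') D.u) x =
      pd D.S a (pd D.S b D.u) x + pd D.S a (pd D.S b' D.u) x := by
  rw [D.hess_comm hx, pd_add_vec, D.hess_comm hx b, D.hess_comm hx b']

theorem hess_smul_right (hx : x ∈ D.S) (a b : E P.n) (t : ℝ) :
    pd D.S a (pd D.S (t • b) D.u) x = t * pd D.S a (pd D.S b D.u) x := by
  rw [D.hess_comm hx, pd_smul_vec, D.hess_comm hx b]

theorem hess_add_smul (hx : x ∈ D.S) (a b : E P.n) (t : ℝ) :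
    pd D.S (a + t • b) (pd D.S (a + t • b) D.u) x = pd D.S a (pd D.S a D.u) x
      + 2 * t * pd D.S a (pd D.S b D.u) x + t ^ 2 * pd D.S b (pd D.S b D.u) x := by
  rw [D.hess_add_right hx, D.hess_smul_right hx, pd_add_vec, pd_add_vec, pd_smul_vec, pd_smul_vec,
    D.hess_comm hx b a]
  ring

/-- A direction that maximizes the second derivatives among the directions orthogonal to a vector
diagonalizes the Hessian on the orthogonal complement. -/
theorem hess_eq_zero_of_max (hx : x ∈ D.S) {ν ξ ζ : E P.n} (hξ : ‖ξ‖ = 1)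
    (hξν : inner ℝ ν ξ = 0) (hζν : inner ℝ ν ζ = 0) (hζ : inner ℝ ξ ζ = 0)
    (hmax : ∀ η, ‖η‖ = 1 → inner ℝ ν η = 0 →
      pd D.S η (pd D.S η D.u) x ≤ pd D.S ξ (pd D.S ξ D.u) x) :
    pd D.S ξ (pd D.S ζ D.u) x = 0 := by
  set T := pd D.S ξ (pd D.S ξ D.u) x with hT
  have h1 : ∀ t : ℝ, 2 * t * pd D.S ξ (pd D.S ζ D.u) x + t ^ 2 * pd D.S ζ (pd D.S ζ D.u) x
      ≤ t ^ 2 * (T * ‖ζ‖ ^ 2) := by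
    intro t
    set η := ξ + t • ζ with hη
    have h2 : ‖η‖ ^ 2 = 1 + t ^ 2 * ‖ζ‖ ^ 2 := by
      rw [← real_inner_self_eq_norm_sq, hη, inner_add_left, inner_add_right, inner_add_right,
        inner_smul_left, inner_smul_right, inner_smul_left, inner_smul_right,
        real_inner_comm ξ ζ, hζ, real_inner_self_eq_norm_sq, real_inner_self_eq_norm_sq, hξ]
      simp
      ring
    have h3 : 0 < ‖η‖ := by
      have : 0 < ‖η‖ ^ 2 := by rw [h2]; positivity
      exact norm_pos_iff.2 fun h => by rw [h] at this; simp at this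
    have h4 := hmax (‖η‖⁻¹ • η) (by rw [norm_smul, norm_inv, norm_norm, inv_mul_cancel₀ h3.ne'])
      (by rw [inner_smul_right, hη, inner_add_right, inner_smul_right, hξν, hζν]; simp)
    rw [pd_pd_smul_vec D.body hx _ _ (D.u_two hx), inv_pow, inv_mul_le_iff₀ (by positivity), h2, hη,
      D.hess_add_smul hx] at h4
    rw [← hT] at h4
    linarith
  by_contra h0
  set a := pd D.S ξ (pd D.S ζ D.u) x with ha
  set b := T * ‖ζ‖ ^ 2 - pd D.S ζ (pd D.S ζ D.u) x with hb
  have h2 : ∀ t : ℝ, 2 * t * a ≤ t ^ 2 * b := fun t => by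
    have := h1 t
    rw [hb]; linarith
  -- If the linear coefficient a were nonzero, the variation 2ta ≤ t²b would fail for this small t.
  have h3 := h2 (a / (|b| + 1))
  have h5 : 0 < |b| + 1 := by positivity
  have h6 : 0 < a ^ 2 := by positivity
  rw [div_pow, mul_div_assoc', div_mul_eq_mul_div, div_mul_eq_mul_div,
    div_le_div_iff₀ h5 (by positivity)] at h3
  have h7 : a ^ 2 * (|b| + 1) * (2 * (|b| + 1) - b) ≤ 0 := by nlinarith
  have h8 : 0 < 2 * (|b| + 1) - b := by linarith [le_abs_self b, abs_nonneg b]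
  exact absurd h7 (not_le.2 (by positivity))

end Setup

section SecondDerivatives

variable {P : Params}

/-- The underlying point, with the zero function as reference function. -/
def LocalPoint.domainPt (i : LocalPoint P) : PointData (E P.n) :=
  ⟨i.L.D.S, fun _ => 0, i.x, i.L.D.body, i.mem, contDiffWithinAt_const⟩

/-- With the zero reference function the jet bound contains no multiple of D²u. The general bound
would allow a term of unknown sign in D²u, which cannot be tolerated at the boundary. -/
theorem exists_hess_s_le (P : Params) : ∃ C, ∀ (i : LocalPoint P) (e : E P.n),
    |pd i.L.D.S e (pd i.L.D.S e i.L.s) i.x| ≤ C * ‖e‖ ^ 2 := by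
  have h1 : ∀ l, UnifJet (LocalPoint.domainPt (P := P)) (fun i => i.L.rd l) := by
    intro l
    refine ⟨P.K1, fun i => DerivBound.jetBound ?_⟩
    have := ((i.L.ρ_derivBound i.near).pd convexBody_univ (mem_univ _)
      (EuclideanSpace.single l 1)).of_le (m' := 2) (by norm_num)
    rwa [norm_single_one, one_mul] at this
  have h2 : UnifJet (LocalPoint.domainPt (P := P)) (fun i => i.L.q) :=
    UnifJet.sum _ fun l _ => (h1 l).mul (h1 l)
  have h3 : UnifJet (LocalPoint.domainPt (P := P)) (fun i => i.L.s) :=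
    h2.comp one_pos (fun i => i.L.one_le_q i.near) (Θ := Real.sqrt)
      fun _ hx => (Real.contDiffAt_sqrt (ne_of_gt hx)).contDiffWithinAt
  obtain ⟨C, hC⟩ := h3
  refine ⟨C, fun i e => ?_⟩
  obtain ⟨β, -, h5⟩ := (hC i).hess
  have h6 := h5 e
  have h7 : pd i.domainPt.S e (pd i.domainPt.S e i.domainPt.u) i.domainPt.x = 0 := by
    have : pd i.domainPt.S e i.domainPt.u = fun _ => 0 := by
      funext y; exact pd_const _ _ _
    rw [this]; exact pd_const _ _ _
  rw [h7, mul_zero, sub_zero] at h6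
  exact h6

end SecondDerivatives

namespace LocalSetup

variable {P : Params} (L : LocalSetup P) {y : E P.n}

theorem norm_grad_le (hb : y ∈ ball L.p P.r) : ‖L.grad y‖ ≤ P.K1 := by
  have h1 := L.abs_pd_ρ_le hb (L.grad y)
  rw [L.pd_ρ_grad, L.q_eq, abs_of_nonneg (by positivity), pow_two] at h1
  exact le_of_mul_le_mul_right h1 (lt_of_lt_of_le one_pos (L.one_le_norm_grad hb))

theorem abs_rd_le_norm (l : Fin P.n) : |L.rd l y| ≤ ‖L.grad y‖ := by
  rw [← L.grad_apply]; exact PiLp.norm_apply_le (L.grad y) l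

theorem abs_rd_le (hb : y ∈ ball L.p P.r) (l : Fin P.n) : |L.rd l y| ≤ P.K1 :=
  L.abs_rd_le_norm l |>.trans (L.norm_grad_le hb)

theorem norm_grad_le_q (hb : y ∈ ball L.p P.r) : ‖L.grad y‖ ≤ L.q y := by
  rw [L.q_eq]; nlinarith [L.one_le_norm_grad hb]

theorem abs_sum_mul_le {n : ℕ} {a b : Fin n → ℝ} {A B : ℝ} (ha : ∀ l, |a l| ≤ A)
    (hb : ∀ l, |b l| ≤ B) (hA : 0 ≤ A) : |∑ l, a l * b l| ≤ n * (A * B) := by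
  refine (Finset.abs_sum_le_sum_abs _ _).trans ?_
  calc ∑ l, |a l * b l| ≤ ∑ _l : Fin n, A * B :=
        Finset.sum_le_sum fun l _ => by
          rw [abs_mul]; exact mul_le_mul (ha l) (hb l) (abs_nonneg _) hA
    _ = n * (A * B) := by simp

theorem abs_cc_le (J : JetConst P) (hS : y ∈ L.D.S) (hb : y ∈ ball L.p P.r) (l : Fin P.n) :
    |L.cc l y| ≤ P.n * (J.C * P.M) + J.C := by
  have h0 : 0 ≤ J.C := zero_le_one.trans J.one_le
  refine (abs_add_le _ _).trans (add_le_add ?_ (J.cb l (L.pointAt hS hb)).val)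
  exact abs_sum_mul_le (fun m => (J.ca l m (L.pointAt hS hb)).val) (fun m => L.D.abs_du_le hS m) h0

theorem abs_sum_cc_le {c : ℝ} (hc : ∀ l, |L.cc l y| ≤ c) (e : E P.n) :
    |∑ l, e l * L.cc l y| ≤ P.n * (‖e‖ * c) :=
  abs_sum_mul_le (fun l => PiLp.norm_apply_le e l) hc (norm_nonneg _)

theorem abs_wn_le {c M' : ℝ} (hb : y ∈ ball L.p P.r) (hf : y ∈ frontier L.D.Ω)
    (hc : ∀ l, |L.cc l y| ≤ c) (hc0 : 0 ≤ c) (hM : |L.nn y| ≤ M') :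
    |L.wn y| ≤ M' + P.n * c := by
  have hq := lt_of_lt_of_le one_pos (L.one_le_q hb)
  rw [L.wn_eq hb hf]
  refine (abs_sub _ _).trans (add_le_add hM ?_)
  rw [abs_div, abs_of_pos hq, div_le_iff₀ hq]
  refine (L.abs_sum_cc_le hc _).trans ?_
  rw [mul_assoc, mul_comm c]
  gcongr
  exact L.norm_grad_le_q hb

/-- The second derivatives on the boundary, corrected by the mixed terms. -/
theorem hess_sub_wx (hb : y ∈ ball L.p P.r) (hf : y ∈ frontier L.D.Ω) (ξ : E P.n) :
    pd L.D.S ξ (pd L.D.S ξ L.D.u) y - L.wx ξ y =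
      pd L.D.S (ξ - L.θ ξ y • L.grad y) (pd L.D.S (ξ - L.θ ξ y • L.grad y) L.D.u) y
        + L.θ ξ y ^ 2 * L.q y * L.nn y ∧ inner ℝ (L.grad y) (ξ - L.θ ξ y • L.grad y) = 0 := by
  have hS := L.D.frontier_subset hf
  have hq : L.q y ≠ 0 := (lt_of_lt_of_le one_pos (L.one_le_q hb)).ne'
  set τ := ξ - L.θ ξ y • L.grad y with hτ
  have h1 : inner ℝ (L.grad y) τ = 0 := by
    rw [hτ, inner_sub_right, inner_smul_right, real_inner_self_eq_norm_sq, ← L.q_eq, L.inner_grad,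
      L.pd_ρ_eq_sum]
    unfold θ qi
    field_simp
    ring
  refine ⟨?_, h1⟩
  have h2 : ξ = τ + L.θ ξ y • L.grad y := by rw [hτ]; abel
  have h3 := L.hess_grad hb hf τ
  rw [← L.inner_grad, h1, mul_zero, zero_add] at h3
  have h4 : L.wx ξ y = 2 * (L.θ ξ y * ∑ l, τ l * L.cc l y) := by
    rw [L.wx_eq]
    congr 2
    refine Finset.sum_congr rfl fun l _ => ?_
    rw [hτ]
    simp [L.grad_apply]
  have h5 := L.D.hess_add_smul hS τ (L.grad y) (L.θ ξ y)
  rw [← h2] at h5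
  rw [h4, h5, h3, nn]
  field_simp
  ring

/-- For tangential ξ the factor θ vanishes at y, so only its own derivative survives and no second
derivative of u appears. -/
theorem pd_wx_tangent (hS : y ∈ L.D.S) (hb : y ∈ ball L.p P.r) {ξ : E P.n}
    (hξ1 : ‖ξ‖ ≤ 1) (hξ : inner ℝ (L.grad y) ξ = 0) (e : E P.n) :
    pd L.D.S e (L.wx ξ) y = 2 * (pd L.D.S e (L.θ ξ) y * ∑ l, ξ l * L.cc l y) := by
  have hθ : DifferentiableWithinAt ℝ (L.θ ξ) L.D.S y :=
    (unifJet_θ.contDiff (⟨L, y, hS, hb, ξ, hξ1⟩ : LocalPoint P)).differentiableWithinAt two_ne_zero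
  have hr := fun l => (L.rd_two hS hb l).differentiableWithinAt two_ne_zero
  have hc := fun l => (L.cc_two hS hb l).differentiableWithinAt two_ne_zero
  have h0 : L.θ ξ y = 0 := by
    rw [L.inner_grad, L.pd_ρ_eq_sum] at hξ
    unfold θ
    rw [hξ, zero_mul]
  have h1 : ∀ l, DifferentiableWithinAt ℝ (fun y => (ξ l - L.θ ξ y * L.rd l y) * L.cc l y)
      L.D.S y := fun l => ((differentiableWithinAt_const _).fun_sub (hθ.fun_mul (hr l))).fun_mul (hc l)
  have h2 : L.wx ξ = fun y => 2 * (L.θ ξ y * ∑ l, (ξ l - L.θ ξ y * L.rd l y) * L.cc l y) :=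
    funext fun z => L.wx_eq ξ z
  have h3 : DifferentiableWithinAt ℝ (fun y => ∑ l, (ξ l - L.θ ξ y * L.rd l y) * L.cc l y) L.D.S y :=
    DifferentiableWithinAt.fun_sum fun l _ => h1 l
  rw [h2, pd_const_mul L.D.body hS e _ (hθ.fun_mul h3), pd_mul L.D.body hS e hθ h3, h0]
  simp

theorem eventually_mem (hb : y ∈ ball L.p P.r) (hf : y ∈ frontier L.D.Ω) {e : E P.n}
    (he : pd univ e L.ρ y < 0) : ∀ᶠ t in 𝓝[>] (0:ℝ), y + t • e ∈ L.D.Ω := by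
  have hd := (L.ρ_contDiffAt hb).differentiableAt (by norm_num)
  have h1 : HasDerivAt (fun t : ℝ => L.ρ (y + t • e)) (pd univ e L.ρ y) 0 := by
    have h2 : HasDerivAt (fun t : ℝ => y + t • e) e 0 := by
      simpa using ((hasDerivAt_id (0:ℝ)).smul_const e).const_add y
    have h3 : HasFDerivAt L.ρ (fderiv ℝ L.ρ y) (y + (0:ℝ) • e) := by
      rw [zero_smul, add_zero]; exact hd.hasFDerivAt
    have := h3.comp_hasDerivAt 0 h2
    rw [pd, fderivWithin_univ]
    exact this
  have h4 : ∀ᶠ t in 𝓝[>] (0:ℝ), slope (fun t : ℝ => L.ρ (y + t • e)) 0 t < 0 :=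
    (hasDerivAt_iff_tendsto_slope.1 h1 |>.mono_left (nhdsWithin_mono _ fun t (ht : 0 < t) => ht.ne'))
      (Iio_mem_nhds he)
  have h5 : ∀ᶠ t in 𝓝[>] (0:ℝ), y + t • e ∈ ball L.p P.r := by
    have : Tendsto (fun t : ℝ => y + t • e) (𝓝 0) (𝓝 y) := by
      have : ContinuousAt (fun t : ℝ => y + t • e) 0 := by fun_prop
      simpa [ContinuousAt] using this
    exact (this.mono_left nhdsWithin_le_nhds) (isOpen_ball.mem_nhds hb)
  filter_upwards [h4, h5, self_mem_nhdsWithin] with t ht htb ht0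
  have ht0' : (0:ℝ) < t := ht0
  rw [L.defining.mem_iff _ htb]
  rw [slope_def_field] at ht
  simp only [zero_smul, add_zero, sub_zero, L.ρ_eq_zero hb hf] at ht
  by_contra hcon
  exact absurd ht (not_lt.2 (div_nonneg (not_lt.1 hcon) ht0'.le))

end LocalSetup

end BoundaryEstimates
end HessianNeumann

namespace HessianNeumann

/-! ### The derivative of tangential second derivatives along ∇ρ. -/

section TangentialEstimate
open Filter Topology

namespace LocalSetup

variable {P : Params} (L : LocalSetup P) {y : E P.n}

theorem abs_pd_pd_rd_le (hS : y ∈ L.D.S) (hb : y ∈ ball L.p P.r) {ξ : E P.n} (hξ : ‖ξ‖ = 1)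
    (l : Fin P.n) : |pd L.D.S ξ (pd L.D.S ξ (L.rd l)) y| ≤ P.K1 := by
  have h : ContDiffAt ℝ 2 (L.rd l) y := L.pd_ρ_two hb _
  rw [pd_pd_eq_pd_pd_univ L.D.body hS h]
  have h1 := (((L.ρ_derivBound hb).pd convexBody_univ (mem_univ _)
    (EuclideanSpace.single l 1)).pd convexBody_univ (mem_univ _) ξ)
  rw [norm_single_one, one_mul, hξ, one_mul] at h1
  have h2 := (h1.of_le (m' := 0 + 1) (by norm_num)).abs_pd_le convexBody_univ (mem_univ _) ξ
  rwa [hξ, mul_one] at h2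

theorem abs_pd_rd_le (hS : y ∈ L.D.S) (hb : y ∈ ball L.p P.r) {ξ : E P.n} (hξ : ‖ξ‖ = 1)
    (l : Fin P.n) : |pd L.D.S ξ (L.rd l) y| ≤ P.K1 := by
  have h : ContDiffAt ℝ 2 (L.rd l) y := L.pd_ρ_two hb _
  rw [pd_eq_pd_univ L.D.body hS (h.differentiableAt two_ne_zero)]
  have := L.abs_pd_pd_ρ_le hb ξ (EuclideanSpace.single l 1)
  rwa [norm_single_one, hξ, mul_one, mul_one] at this

/-- The only second derivative of u comes with the coefficient φ_z ≤ 0. As u_ξξ ≥ 0, this term can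
be dropped; this is where monotonicity of φ enters. -/
theorem pd_pd_φt_le {C C' : ℝ} (J : JetConst P) (hC : J.C ≤ C)
    (hC' : ∀ (i : LocalPoint P) (e : E P.n),
      |pd i.L.D.S e (pd i.L.D.S e i.L.s) i.x| ≤ C' * ‖e‖ ^ 2)
    (hS : y ∈ L.D.S) (hb : y ∈ ball L.p P.r) {ξ : E P.n} (hξ : ‖ξ‖ = 1)
    (h0 : 0 ≤ pd L.D.S ξ (pd L.D.S ξ L.D.u) y) :
    pd L.D.S ξ (pd L.D.S ξ L.φt) y ≤ C * (|P.B| * (1 + P.M) ^ 2) + 2 * (C * C) + |C'| * C := by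
  set i := L.pointAt hS hb
  have hC0 : 0 ≤ C := (zero_le_one.trans J.one_le).trans hC
  have hs := (J.s i).mono hC
  have hφ := (J.φu i).mono hC
  have h1 := DerivBound.abs_hess_graph_le (D := L.D.pt hS) (M := P.M)
    (fun e => L.D.abs_pd_u_le hS e) ((L.D.φ_derivBound hS).of_le (m' := 2) (by norm_num)) ξ
  rw [hξ, one_pow, mul_one] at h1
  have h1' : pd L.D.S ξ (pd L.D.S ξ L.φu) y ≤ |P.B| * (1 + P.M) ^ 2 := by
    have h2 : pd L.D.S ξ (pd L.D.S ξ L.φu) y - L.φz y * pd L.D.S ξ (pd L.D.S ξ L.D.u) y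
      ≤ P.B * (1 + P.M) ^ 2 := (le_abs_self _).trans h1
    have h3 : P.B * (1 + P.M) ^ 2 ≤ |P.B| * (1 + P.M) ^ 2 := by gcongr; exact le_abs_self _
    nlinarith [L.φz_nonpos hS]
  have hs0 : 0 ≤ L.s y := Real.sqrt_nonneg _
  have hsC : L.s y ≤ C := (le_abs_self _).trans hs.val
  have e1 : |pd L.D.S ξ L.s y| ≤ C := by
    have := hs.der ξ
    rw [hξ, mul_one] at this
    exact this
  have e2 : |pd L.D.S ξ L.φu y| ≤ C := by
    have := hφ.der ξ
    rw [hξ, mul_one] at this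
    exact this
  have e3 : |pd L.D.S ξ (pd L.D.S ξ L.s) y| ≤ |C'| := by
    have := hC' i ξ
    rw [hξ, one_pow, mul_one] at this
    exact this.trans (le_abs_self _)
  have e4 : |L.φu y| ≤ C := hφ.val
  unfold φt
  rw [pd_pd_mul L.D.body hS ξ ξ (L.s_two hS hb) (L.φu_two hS hb)]
  have f1 : L.s y * pd L.D.S ξ (pd L.D.S ξ L.φu) y ≤ C * (|P.B| * (1 + P.M) ^ 2) :=
    (mul_le_mul_of_nonneg_left h1' hs0).trans
      (mul_le_mul_of_nonneg_right hsC (by positivity))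
  have f2 : pd L.D.S ξ L.s y * pd L.D.S ξ L.φu y ≤ C * C :=
    (le_abs_self _).trans (by rw [abs_mul]; exact mul_le_mul e1 e2 (abs_nonneg _) hC0)
  have f3 : pd L.D.S ξ (pd L.D.S ξ L.s) y * L.φu y ≤ |C'| * C :=
    (le_abs_self _).trans (by rw [abs_mul]; exact mul_le_mul e3 e4 (abs_nonneg _) (abs_nonneg _))
  linarith

/-- Expand w_ξξ by the product rule in w = Σ ρ_l u_l - `φt`, and evaluate it on the boundary by
`pd_pd_w_tangent`. -/
theorem pd_third_eq (hb : y ∈ ball L.p P.r) (hf : y ∈ frontier L.D.Ω) {ξ : E P.n}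
    (hξ : inner ℝ (L.grad y) ξ = 0) :
    pd L.D.S (L.grad y) (pd L.D.S ξ (pd L.D.S ξ L.D.u)) y =
      L.wn y * pd univ ξ (pd univ ξ L.ρ) y
        - 2 * ∑ l, pd L.D.S ξ (L.rd l) y * pd L.D.S ξ (L.D.du l) y
        - ∑ l, pd L.D.S ξ (pd L.D.S ξ (L.rd l)) y * L.D.du l y
        + pd L.D.S ξ (pd L.D.S ξ L.φt) y := by
  have hS := L.D.frontier_subset hf
  have h1 := L.pd_pd_w_tangent hb hf (τ := ξ) (by rw [← L.inner_grad]; exact hξ)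
  have hr := fun l => L.rd_two hS hb l
  have hu := fun l => L.D.du_two hS l
  have hw : pd L.D.S ξ (pd L.D.S ξ L.w) y =
      ∑ l, pd L.D.S ξ (pd L.D.S ξ (fun y => L.rd l y * L.D.du l y)) y
        - pd L.D.S ξ (pd L.D.S ξ L.φt) y := by
    have h2 := pd_pd_const_mul L.D.body hS ξ ξ (-1) (L.φt_two hS hb)
    simp only [neg_one_mul] at h2
    unfold w
    rw [pd_pd_add L.D.body hS ξ ξ (ContDiffWithinAt.sum fun l _ => (hr l).mul (hu l))
      (L.φt_two hS hb).neg, pd_pd_sum L.D.body hS ξ ξ _ fun l _ => (hr l).mul (hu l), h2]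
    ring
  have h3 : ∑ l, pd L.D.S ξ (pd L.D.S ξ (fun y => L.rd l y * L.D.du l y)) y =
      pd L.D.S (L.grad y) (pd L.D.S ξ (pd L.D.S ξ L.D.u)) y
        + 2 * ∑ l, pd L.D.S ξ (L.rd l) y * pd L.D.S ξ (L.D.du l) y
        + ∑ l, pd L.D.S ξ (pd L.D.S ξ (L.rd l)) y * L.D.du l y := by
    have h4 : pd L.D.S (L.grad y) (pd L.D.S ξ (pd L.D.S ξ L.D.u)) y =
        ∑ l, L.rd l y * pd L.D.S ξ (pd L.D.S ξ (L.D.du l)) y := by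
      conv_lhs => rw [← Setup.sum_single (L.grad y)]
      rw [pd_sum_vec]
      refine Finset.sum_congr rfl fun l _ => ?_
      rw [pd_smul_vec, L.grad_apply, pd_third_comm L.D.body hS (L.D.u_three hS)]
      rfl
    rw [h4, Finset.mul_sum, ← Finset.sum_add_distrib, ← Finset.sum_add_distrib]
    refine Finset.sum_congr rfl fun l _ => ?_
    rw [pd_pd_mul L.D.body hS ξ ξ (hr l) (hu l)]
    ring
  linarith

/-- The sum is D²u(ξ, ζ) with ζ = D²ρ ξ. Write ζ = Rξ + b∇ρ + ζ' with ζ' orthogonal to ξ and ∇ρ.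
Maximality of ξ among tangential directions kills the ζ' part, the ∇ρ part is a known mixed
derivative, and R = D²ρ(ξ, ξ) ≥ κ by uniform convexity. -/
theorem hess_normal_part_ge {c : ℝ} (hb : y ∈ ball L.p P.r) (hf : y ∈ frontier L.D.Ω)
    (hc : ∀ l, |L.cc l y| ≤ c) {ξ : E P.n} (hξ1 : ‖ξ‖ = 1)
    (hξ : inner ℝ (L.grad y) ξ = 0) (h0 : 0 ≤ pd L.D.S ξ (pd L.D.S ξ L.D.u) y)
    (hmax : ∀ η, ‖η‖ = 1 → inner ℝ (L.grad y) η = 0 →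
      pd L.D.S η (pd L.D.S η L.D.u) y ≤ pd L.D.S ξ (pd L.D.S ξ L.D.u) y) :
    P.κ * pd L.D.S ξ (pd L.D.S ξ L.D.u) y - (P.n * P.K1) * (P.n * c) ≤
      ∑ l, pd L.D.S ξ (L.rd l) y * pd L.D.S ξ (L.D.du l) y := by
  have hS := L.D.frontier_subset hf
  have hq := lt_of_lt_of_le one_pos (L.one_le_q hb)
  have hτ : pd univ ξ L.ρ y = 0 := by rw [← L.inner_grad]; exact hξ
  set T := pd L.D.S ξ (pd L.D.S ξ L.D.u) y with hT
  set ζ : E P.n := WithLp.toLp 2 fun l => pd L.D.S ξ (L.rd l) y with hζ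
  have e1 : ∑ l, pd L.D.S ξ (L.rd l) y * pd L.D.S ξ (L.D.du l) y
      = pd L.D.S ξ (pd L.D.S ζ L.D.u) y := (L.D.hess_eq_sum hS ξ ζ).symm
  set R := pd univ ξ (pd univ ξ L.ρ) y with hR
  have e2 : inner ℝ ξ ζ = R := by
    have h1 : pd univ ξ L.ρ = fun x => ∑ l, ξ l * L.rd l x := funext fun x => L.pd_ρ_eq_sum ξ x
    have hd : ∀ l, DifferentiableAt ℝ (L.rd l) y := fun l =>
      (L.pd_ρ_two hb (EuclideanSpace.single l 1)).differentiableAt two_ne_zero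
    rw [hR, h1, pd_sum convexBody_univ (mem_univ _) ξ _ fun l _ =>
      ((differentiableAt_const _).fun_mul (hd l)).differentiableWithinAt]
    rw [PiLp.inner_apply]
    refine Finset.sum_congr rfl fun l _ => ?_
    rw [pd_const_mul convexBody_univ (mem_univ _) ξ _ (hd l).differentiableWithinAt,
      ← pd_eq_pd_univ L.D.body hS (hd l)]
    simp [hζ, mul_comm]
  set b := inner ℝ (L.grad y) ζ / L.q y with hbdef
  set ζ' := ζ + (-R) • ξ + (-b) • L.grad y with hζ'
  have hξg : inner ℝ ξ (L.grad y) = 0 := by rw [real_inner_comm]; exact hξ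
  have e3 : pd L.D.S ξ (pd L.D.S ζ' L.D.u) y = 0 := by
    refine L.D.hess_eq_zero_of_max hS (ν := L.grad y) hξ1 hξ ?_ ?_ hmax
    · rw [hζ', inner_add_right, inner_add_right, inner_smul_right, inner_smul_right, hξ,
        real_inner_self_eq_norm_sq, ← L.q_eq, hbdef]
      field_simp
      ring
    · rw [hζ', inner_add_right, inner_add_right, inner_smul_right, inner_smul_right, hξg,
        real_inner_self_eq_norm_sq, e2, hξ1]
      ring
  rw [hζ', L.D.hess_add_right hS, L.D.hess_add_right hS, L.D.hess_smul_right hS,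
    L.D.hess_smul_right hS, L.hess_grad hb hf, hτ] at e3
  have e4 : |∑ l, ξ l * L.cc l y| ≤ P.n * c := by
    have := L.abs_sum_cc_le hc ξ
    rwa [hξ1, one_mul] at this
  have e5 : |b| ≤ P.n * P.K1 := by
    rw [hbdef, abs_div, abs_of_pos hq, div_le_iff₀ hq]
    have h1 : inner ℝ (L.grad y) ζ = ∑ l, pd L.D.S ξ (L.rd l) y * L.rd l y := by
      rw [PiLp.inner_apply]
      refine Finset.sum_congr rfl fun l _ => ?_
      rw [L.grad_apply]
      simp [hζ]
    rw [h1]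
    refine (abs_sum_mul_le (fun l => L.abs_pd_rd_le hS hb hξ1 l)
      (fun l => (L.abs_rd_le_norm l).trans (L.norm_grad_le_q hb))
      (zero_le_one.trans P.one_le_K1)).trans (le_of_eq (by ring))
  have e6 : P.κ ≤ R := by
    have := L.le_pd_pd_ρ_of_tangent hb hf hτ
    rw [hξ1, one_pow, mul_one] at this
    nlinarith [L.one_le_norm_grad hb, P.κ_pos]
  have e7 : |b * ∑ l, ξ l * L.cc l y| ≤ (P.n * P.K1) * (P.n * c) := by
    rw [abs_mul]
    exact mul_le_mul e5 e4 (abs_nonneg _)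
      (mul_nonneg (Nat.cast_nonneg _) (zero_le_one.trans P.one_le_K1))
  rw [e1]
  have e8 := neg_le_of_abs_le e7
  nlinarith

end LocalSetup

end TangentialEstimate
end HessianNeumann

namespace HessianNeumann

/-! ### Interior maximum principles for the second derivatives. -/

section TestFunction
open Filter Topology

namespace Setup

variable {P : Params} {D : Setup P}

theorem InteriorFrame.sum_mul_abs_le {x : E P.n} {e : OrthonormalBasis (Fin P.n) ℝ (E P.n)}
    {lam G : Fin P.n → ℝ} (h : D.InteriorFrame x e lam G) {C : ℝ} {b : Fin P.n → ℝ}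
    (hb : ∀ i, |b i| ≤ C) :
    |2 * ∑ i, G i * lam i * b i| ≤ ∑ i, G i * lam i ^ 2 + C ^ 2 * ∑ i, G i := by
  rw [Finset.mul_sum, Finset.mul_sum, ← Finset.sum_add_distrib]
  refine (Finset.abs_sum_le_sum_abs _ _).trans (Finset.sum_le_sum fun i _ => ?_)
  have hG := h.pos i
  have h1 : |lam i * b i| * 2 ≤ lam i ^ 2 + C ^ 2 := by
    have h2 : b i ^ 2 ≤ C ^ 2 := by
      rw [← sq_abs (b i)]
      exact pow_le_pow_left₀ (abs_nonneg _) (hb i) 2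
    rw [abs_mul]
    nlinarith [sq_nonneg (|lam i| - |b i|), sq_abs (lam i), sq_abs (b i)]
  have h2 : |2 * (G i * lam i * b i)| = G i * (|lam i * b i| * 2) := by
    rw [show 2 * (G i * lam i * b i) = G i * (lam i * b i * 2) by ring, abs_mul, abs_of_pos hG,
      abs_mul (lam i * b i), abs_two]
  rw [h2]
  nlinarith

/-- Concavity leaves F_ξξ, which contains a bounded multiple of u_ξξ. That is at most n times the
largest eigenvalue, hence controlled by Σ G_i λ_i². -/
theorem InteriorFrame.lin_hess_ge {x : E P.n} {e : OrthonormalBasis (Fin P.n) ℝ (E P.n)}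
    {lam G : Fin P.n → ℝ} (h : D.InteriorFrame x e lam G) {C : ℝ}
    (hF : JetBound (D.pt h.memS) C D.F) {ξ : E P.n} (hξ : ‖ξ‖ = 1) :
    -(C * P.n ^ 2) * ∑ i, G i * lam i ^ 2 - C ≤
      ∑ i, G i * pd D.S (e i) (pd D.S (e i) (pd D.S ξ (pd D.S ξ D.u))) x := by
  refine le_trans ?_ (h.fourth ξ)
  obtain ⟨a, ha⟩ := Setup.InteriorFrame.exists_max lam
  obtain ⟨β, hβ, h1⟩ := hF.hess
  have h2 : |pd D.S ξ (pd D.S ξ D.F) x - β * pd D.S ξ (pd D.S ξ D.u) x| ≤ C * ‖ξ‖ ^ 2 := h1 ξ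
  rw [hξ, one_pow, mul_one] at h2
  have h3 := h.abs_hess_le ha ξ
  rw [hξ, one_pow, mul_one] at h3
  have h4 := h.lam_max_le ha
  have hC := hF.nonneg
  have h5 : |β * pd D.S ξ (pd D.S ξ D.u) x| ≤ C * (P.n * (P.n * ∑ i, G i * lam i ^ 2)) := by
    rw [abs_mul]
    refine mul_le_mul hβ (h3.trans ?_) (abs_nonneg _) hC
    gcongr
  have h6 := neg_le_of_abs_le h2
  have h7 := neg_le_of_abs_le h5
  nlinarith

/-- A bound for the second derivatives at an interior maximum of `u_ξξ + K |Du|²`. -/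
theorem exists_le_of_isLocalMax (P : Params) (J : JetConst P) :
    ∃ C, ∀ (D : Setup P) (x : E P.n), x ∈ D.Ω → ∀ ξ : E P.n, ‖ξ‖ = 1 →
      IsLocalMax (fun y => pd D.S ξ (pd D.S ξ D.u) y + (1 + J.C * P.n ^ 2) * D.gradSq y) x →
      pd D.S ξ (pd D.S ξ D.u) x ≤ C := by
  set K2 := 1 + J.C * P.n ^ 2 with hK2
  have hJ : 0 ≤ J.C := zero_le_one.trans J.one_le
  refine ⟨P.n * (J.C + K2 * (2 * (P.n * (P.M * J.C)))), fun D x hx ξ hξ hm => ?_⟩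
  obtain ⟨e, lam, G, h⟩ := D.exists_interiorFrame hx
  have hS := D.subset_S hx
  obtain ⟨a, ha⟩ := Setup.InteriorFrame.exists_max lam
  have h1 := h.lin_hess_ge (J.F D x hS) hξ
  have h2 := h.lin_gradSq_ge (J.F D x hS)
  have h3 : ∑ i, G i * (pd D.S (e i) (pd D.S (e i) (pd D.S ξ (pd D.S ξ D.u))) x
      + K2 * pd D.S (e i) (pd D.S (e i) D.gradSq) x) ≤ 0 := by
    refine Finset.sum_nonpos fun i _ => mul_nonpos_of_nonneg_of_nonpos (h.pos i).le ?_
    have h4 := pd_pd_nonpos_of_isLocalMax D.body (D.subset_interior hx)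
      ((D.pd_pd_u_two hx ξ ξ).add (contDiffWithinAt_const.mul (D.gradSq_two hS))) hm (e i)
    rwa [pd_pd_add D.body hS _ _ (D.pd_pd_u_two hx ξ ξ)
      (contDiffWithinAt_const.mul (D.gradSq_two hS)),
      pd_pd_const_mul D.body hS _ _ _ (D.gradSq_two hS)] at h4
  have h5 : ∑ i, G i * (pd D.S (e i) (pd D.S (e i) (pd D.S ξ (pd D.S ξ D.u))) x
      + K2 * pd D.S (e i) (pd D.S (e i) D.gradSq) x)
      = ∑ i, G i * pd D.S (e i) (pd D.S (e i) (pd D.S ξ (pd D.S ξ D.u))) x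
        + K2 * ∑ i, G i * pd D.S (e i) (pd D.S (e i) D.gradSq) x := by
    rw [Finset.mul_sum, ← Finset.sum_add_distrib]
    exact Finset.sum_congr rfl fun i _ => by ring
  rw [h5] at h3
  have h6 : 0 ≤ ∑ i, G i * lam i ^ 2 :=
    Finset.sum_nonneg fun i _ => mul_nonneg (h.pos i).le (sq_nonneg _)
  have hK : 1 ≤ K2 := by
    have : 0 ≤ J.C * (P.n:ℝ) ^ 2 := by positivity
    linarith
  have h7 := mul_le_mul_of_nonneg_left h2 (zero_le_one.trans hK)
  -- `K2` is chosen so that 2·`K2` exceeds the loss `J.C`·n² from F_ξξ by more than 1.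
  have h8 : ∑ i, G i * lam i ^ 2 ≤ J.C + K2 * (2 * (P.n * (P.M * J.C))) := by
    nlinarith
  have h9 := h.hess_le ha ξ
  rw [hξ, one_pow, mul_one] at h9
  refine h9.trans ((h.lam_max_le ha).trans ?_)
  gcongr

end Setup

namespace LocalSetup

variable {P : Params} (L : LocalSetup P) {y : E P.n}

/-- The test function for the second derivatives. -/
def testFn (K₂ K₃ : ℝ) (B : BarrierConst P) (ξ y : E P.n) : ℝ :=
  pd L.D.S ξ (pd L.D.S ξ L.D.u) y +
    ((-1) * L.wx ξ y + (K₂ * L.D.gradSq y + K₃ * L.H B.Λ B.c y))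

theorem wx_two {ξ : E P.n} (hξ : ‖ξ‖ ≤ 1) (hS : y ∈ L.D.S) (hb : y ∈ ball L.p P.r) :
    ContDiffWithinAt ℝ 2 (L.wx ξ) L.D.S y := by
  let i : LocalPoint P := ⟨L, y, hS, hb, ξ, hξ⟩
  exact (ContDiffWithinAt.sum fun m _ =>
    ((unifJet_wa m).contDiff i).mul (L.D.du_two hS m)).add (unifJet_wb.contDiff i)

theorem abs_wx_le (J : JetConst P) {ξ : E P.n} (hξ : ‖ξ‖ ≤ 1) (hS : y ∈ L.D.S)
    (hb : y ∈ ball L.p P.r) : |L.wx ξ y| ≤ P.n * (J.C * P.M) + J.C := by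
  let i : LocalPoint P := ⟨L, y, hS, hb, ξ, hξ⟩
  refine (abs_add_le _ _).trans (add_le_add ?_ (J.wb i).val)
  exact abs_sum_mul_le (fun m => (J.wa m i).val) (fun m => L.D.abs_du_le hS m)
    (zero_le_one.trans J.one_le)

theorem correction_two (K₂ K₃ : ℝ) (B : BarrierConst P) {ξ : E P.n} (hξ : ‖ξ‖ ≤ 1) (hS : y ∈ L.D.S)
    (hb : y ∈ ball L.p P.r) : ContDiffWithinAt ℝ 2
      (fun y => (-1) * L.wx ξ y + (K₂ * L.D.gradSq y + K₃ * L.H B.Λ B.c y)) L.D.S y :=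
  (contDiffWithinAt_const.mul (L.wx_two hξ hS hb)).add
    ((contDiffWithinAt_const.mul (L.D.gradSq_two hS)).add
      (contDiffWithinAt_const.mul (L.H_contDiffAt _ _ hb).contDiffWithinAt))

/-- The linearized operator is strictly positive on the test function. Losses of order Σ G_i λ_i²,
from F_ξξ and from the cross terms of the correction, are covered by K₂|Du|²; losses of order Σ G_i
are covered by K₃H. -/
theorem exists_not_isLocalMax (J : JetConst P) (B : BarrierConst P) :
    ∃ K₀, ∀ K₃ ≥ K₀, ∀ (L : LocalSetup P) (x : E P.n), x ∈ L.D.Ω → ‖x - L.p‖ ≤ B.δ →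
      ∀ ξ : E P.n, ‖ξ‖ = 1 → ¬ IsLocalMax (L.testFn (1 + J.C * P.n ^ 2) K₃ B ξ) x := by
  set K₂ := 1 + J.C * P.n ^ 2 with hK2
  have hJ : 0 ≤ J.C := zero_le_one.trans J.one_le
  set c1 := P.n * (J.C * J.C) + (P.n * P.M + 1) * J.C * P.k with hc1
  set c2 := (P.n * P.M + 1) * J.C with hc2
  set g0 := Real.exp (-|Real.log P.A|) with hg0
  have hg0' : 0 < g0 := Real.exp_pos _
  set W := J.C + c1 + K₂ * (2 * (P.n * (P.M * J.C))) with hW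
  -- As Σ G_i ≥ `g0`, the bounded losses W are at most |W|/`g0` · Σ G_i; the extra 1 makes the
  -- inequality strict.
  refine ⟨(|W| / g0 + 1 + c2 + (P.n * J.C) ^ 2) / B.c, fun K₃ hK₃ L x hx hxδ ξ hξ hm => ?_⟩
  have hKc : |W| / g0 + 1 + c2 + (P.n * J.C) ^ 2 ≤ K₃ * B.c := (div_le_iff₀ B.c_pos).1 hK₃
  have hS := L.D.subset_S hx
  have hb : x ∈ ball L.p P.r := by
    rw [mem_ball, dist_eq_norm]; exact hxδ.trans_lt B.δ_lt
  obtain ⟨e, lam, G, h⟩ := L.D.exists_interiorFrame hx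
  let i : LocalPoint P := ⟨L, x, hS, hb, ξ, hξ.le⟩
  have t1 := h.lin_hess_ge (J.F L.D x hS) hξ
  have t2 := h.lin_gradSq_ge (J.F L.D x hS)
  have t3 := h.abs_lin_first_order_le (J.F L.D x hS) (a := L.wa ξ) (b := L.wb ξ)
    (fun l => J.wa l i) (J.wb i)
  have t4 := h.sum_mul_abs_le (C := P.n * J.C)
    (b := fun j => ∑ l, e j l * pd L.D.S (e j) (L.wa ξ l) x) (fun j => by
      have := abs_sum_mul_le (a := fun l => e j l)
        (b := fun l => pd L.D.S (e j) (L.wa ξ l) x) (A := 1) (B := J.C)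
        (fun l => Setup.InteriorFrame.abs_coord_le e j l) (fun l => by
          have h1 := (J.wa l i).der (e j)
          rw [e.norm_eq_one, mul_one] at h1
          exact h1) zero_le_one
      rwa [one_mul] at this)
  have hwx2 := L.wx_two hξ.le hS hb
  have hH2 : ContDiffWithinAt ℝ 2 (L.H B.Λ B.c) L.D.S x := (L.H_contDiffAt _ _ hb).contDiffWithinAt
  have hg2 := L.D.gradSq_two hS
  have h3 : ∑ i, G i * (pd L.D.S (e i) (pd L.D.S (e i) (pd L.D.S ξ (pd L.D.S ξ L.D.u))) x
      + ((-1) * pd L.D.S (e i) (pd L.D.S (e i) (L.wx ξ)) x +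
        (K₂ * pd L.D.S (e i) (pd L.D.S (e i) L.D.gradSq) x
          + K₃ * pd L.D.S (e i) (pd L.D.S (e i) (L.H B.Λ B.c)) x))) ≤ 0 := by
    refine Finset.sum_nonpos fun i _ => mul_nonpos_of_nonneg_of_nonpos (h.pos i).le ?_
    have h4 := pd_pd_nonpos_of_isLocalMax L.D.body (L.D.subset_interior hx)
      ((L.D.pd_pd_u_two hx ξ ξ).add (L.correction_two K₂ K₃ B hξ.le hS hb)) hm (e i)
    have hp := L.D.pd_pd_u_two hx ξ ξ
    rw [pd_pd_add L.D.body hS _ _ hp (L.correction_two K₂ K₃ B hξ.le hS hb),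
      pd_pd_add L.D.body hS _ _ (contDiffWithinAt_const.mul hwx2)
        ((contDiffWithinAt_const.mul hg2).add (contDiffWithinAt_const.mul hH2)),
      pd_pd_add L.D.body hS _ _ (contDiffWithinAt_const.mul hg2)
        (contDiffWithinAt_const.mul hH2),
      pd_pd_const_mul L.D.body hS _ _ _ hwx2, pd_pd_const_mul L.D.body hS _ _ _ hg2,
      pd_pd_const_mul L.D.body hS _ _ _ hH2] at h4
    exact h4
  have h5 : ∑ i, G i * (pd L.D.S (e i) (pd L.D.S (e i) (pd L.D.S ξ (pd L.D.S ξ L.D.u))) x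
      + ((-1) * pd L.D.S (e i) (pd L.D.S (e i) (L.wx ξ)) x +
        (K₂ * pd L.D.S (e i) (pd L.D.S (e i) L.D.gradSq) x
          + K₃ * pd L.D.S (e i) (pd L.D.S (e i) (L.H B.Λ B.c)) x)))
      = ∑ i, G i * pd L.D.S (e i) (pd L.D.S (e i) (pd L.D.S ξ (pd L.D.S ξ L.D.u))) x
        - ∑ i, G i * pd L.D.S (e i) (pd L.D.S (e i) (L.wx ξ)) x
        + K₂ * ∑ i, G i * pd L.D.S (e i) (pd L.D.S (e i) L.D.gradSq) x
        + K₃ * ∑ i, G i * pd L.D.S (e i) (pd L.D.S (e i) (L.H B.Λ B.c)) x := by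
    rw [Finset.mul_sum, Finset.mul_sum, ← Finset.sum_sub_distrib, ← Finset.sum_add_distrib,
      ← Finset.sum_add_distrib]
    exact Finset.sum_congr rfl fun i _ => by ring
  rw [h5] at h3
  have hsum := h.sum_ge
  have t5 : B.c * ∑ i, G i ≤ ∑ i, G i * pd L.D.S (e i) (pd L.D.S (e i) (L.H B.Λ B.c)) x := by
    rw [Finset.mul_sum]
    refine Finset.sum_le_sum fun i _ => ?_
    have := B.convex L x hS hxδ (e i)
    rw [e.norm_eq_one, one_pow, mul_one] at this
    rw [mul_comm]
    exact mul_le_mul_of_nonneg_left this (h.pos i).le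
  have hM := L.D.M_nonneg
  have hc2' : 0 ≤ c2 := by positivity
  have hWn : 0 ≤ |W| / g0 := by positivity
  have hK3 : 0 ≤ K₃ := by
    have : 0 ≤ K₃ * B.c := le_trans (by positivity) hKc
    exact nonneg_of_mul_nonneg_left this B.c_pos
  have t6 := mul_le_mul_of_nonneg_left t5 hK3
  have hq : 0 ≤ ∑ i, G i * lam i ^ 2 :=
    Finset.sum_nonneg fun i _ => mul_nonneg (h.pos i).le (sq_nonneg _)
  have hK : 1 ≤ K₂ := by
    have : 0 ≤ J.C * (P.n:ℝ) ^ 2 := by positivity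
    linarith
  have t7 := mul_le_mul_of_nonneg_left t2 (zero_le_one.trans hK)
  have t8 : ∑ i, G i * pd L.D.S (e i) (pd L.D.S (e i) (L.wx ξ)) x ≤
      ∑ i, G i * lam i ^ 2 + (P.n * J.C) ^ 2 * ∑ i, G i + c1 + c2 * ∑ i, G i := by
    have u1 := (le_abs_self _).trans t3
    have u2 := (le_abs_self _).trans t4
    have u3 : L.wx ξ = fun y => ∑ l, L.wa ξ l y * L.D.du l y + L.wb ξ y := rfl
    rw [u3]
    linarith
  set 𝓖 := ∑ i, G i with h𝓖
  have t9 : (|W| / g0 + 1 + c2 + (P.n * J.C) ^ 2) * 𝓖 ≤ K₃ * (B.c * 𝓖) := by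
    rw [← mul_assoc]
    exact mul_le_mul_of_nonneg_right hKc (hg0'.le.trans hsum)
  have t10 : W + g0 ≤ (|W| / g0 + 1) * 𝓖 := by
    calc W + g0 ≤ |W| + g0 := by linarith [le_abs_self W]
      _ = (|W| / g0 + 1) * g0 := by field_simp
      _ ≤ _ := by gcongr
  have t11 : 0 ≤ (2 * K₂ - J.C * P.n ^ 2 - 1) * ∑ i, G i * lam i ^ 2 :=
    mul_nonneg (by linarith) hq
  nlinarith

end LocalSetup

end TestFunction
end HessianNeumann

namespace HessianNeumann

/-! ### Boundary maxima of the corrected second derivatives. -/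

section SecondDerivativeEstimate
open Filter Topology

namespace LocalSetup

variable {P : Params}

/-- M' enters only through the factor `wn` of the curvature term, and the good term -2κ u_ξξ comes
from `hess_normal_part_ge`. -/
theorem exists_third_le (P : Params) (J : JetConst P) :
    ∃ C, 0 ≤ C ∧ ∀ (L : LocalSetup P) (M' : ℝ) (y : E P.n), y ∈ ball L.p P.r →
      y ∈ frontier L.D.Ω → |L.nn y| ≤ M' → ∀ ξ : E P.n, ‖ξ‖ = 1 → inner ℝ (L.grad y) ξ = 0 →
      0 ≤ pd L.D.S ξ (pd L.D.S ξ L.D.u) y →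
      (∀ η, ‖η‖ = 1 → inner ℝ (L.grad y) η = 0 →
        pd L.D.S η (pd L.D.S η L.D.u) y ≤ pd L.D.S ξ (pd L.D.S ξ L.D.u) y) →
      pd L.D.S (L.grad y) (pd L.D.S ξ (pd L.D.S ξ L.D.u)) y ≤
        C * (1 + M') - 2 * P.κ * pd L.D.S ξ (pd L.D.S ξ L.D.u) y := by
  obtain ⟨C', hC'⟩ := exists_hess_s_le P
  have hJ : 0 ≤ J.C := zero_le_one.trans J.one_le
  have hK1 := zero_le_one.trans P.one_le_K1
  set c := P.n * (J.C * |P.M|) + J.C with hc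
  have hc0 : 0 ≤ c := by positivity
  set C4 := J.C * (|P.B| * (1 + P.M) ^ 2) + 2 * (J.C * J.C) + |C'| * J.C with hC4
  have hC40 : 0 ≤ C4 := by positivity
  refine ⟨P.K1 + P.n * c * P.K1 + 2 * ((P.n * P.K1) * (P.n * c)) + P.n * (P.K1 * |P.M|) + C4,
    by positivity, ?_⟩
  intro L M' y hb hf hM ξ hξ1 hξ h0 hmax
  have hS := L.D.frontier_subset hf
  have hMa : |P.M| = P.M := abs_of_nonneg L.D.M_nonneg
  have hM' : 0 ≤ M' := (abs_nonneg _).trans hM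
  have hcc : ∀ l, |L.cc l y| ≤ c := fun l => by
    rw [hc, hMa]; exact L.abs_cc_le J hS hb l
  rw [L.pd_third_eq hb hf hξ]
  have h1 := L.hess_normal_part_ge hb hf hcc hξ1 hξ h0 hmax
  have h2 := L.pd_pd_φt_le J le_rfl hC' hS hb hξ1 h0
  have h3 : |L.wn y * pd univ ξ (pd univ ξ L.ρ) y| ≤ (M' + P.n * c) * P.K1 := by
    rw [abs_mul]
    refine mul_le_mul (L.abs_wn_le hb hf hcc hc0 hM) ?_ (abs_nonneg _) (by positivity)
    have := L.abs_pd_pd_ρ_le hb ξ ξ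
    rwa [hξ1, mul_one, mul_one] at this
  have h4 : |∑ l, pd L.D.S ξ (pd L.D.S ξ (L.rd l)) y * L.D.du l y| ≤ P.n * (P.K1 * |P.M|) := by
    rw [hMa]
    exact abs_sum_mul_le (fun l => L.abs_pd_pd_rd_le hS hb hξ1 l) (fun l => L.D.abs_du_le hS l) hK1
  have h5 := (le_abs_self _).trans h3
  have h6 := neg_le_of_abs_le h4
  have h7 : 0 ≤ (P.n * c * P.K1 + 2 * ((P.n * P.K1) * (P.n * c)) + P.n * (P.K1 * |P.M|) + C4) * M' :=
    by positivity
  nlinarith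

/-- A Hopf-type comparison: the test function does not increase along -∇ρ, so its derivative along
∇ρ is nonnegative, while `exists_third_le` makes that derivative very negative when u_ξξ is large.
On the boundary the other terms are at most linear in M'. -/
theorem exists_tangential_le (J : JetConst P) (B : BarrierConst P) {K₂ K₃ : ℝ} (hK₂ : 0 ≤ K₂)
    (hK₃ : 0 ≤ K₃) :
    ∃ C, 0 ≤ C ∧ ∀ (L : LocalSetup P) (M' : ℝ) (y : E P.n), y ∈ ball L.p P.r →
      y ∈ frontier L.D.Ω → ‖y - L.p‖ ≤ B.δ → |L.nn y| ≤ M' →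
      ∀ ξ : E P.n, ‖ξ‖ = 1 → inner ℝ (L.grad y) ξ = 0 →
      (∀ η, ‖η‖ = 1 → inner ℝ (L.grad y) η = 0 →
        pd L.D.S η (pd L.D.S η L.D.u) y ≤ pd L.D.S ξ (pd L.D.S ξ L.D.u) y) →
      (∀ᶠ t in 𝓝[>] (0:ℝ), L.testFn K₂ K₃ B ξ (y + t • (-L.grad y)) ≤ L.testFn K₂ K₃ B ξ y) →
      pd L.D.S ξ (pd L.D.S ξ L.D.u) y ≤ C * (1 + M') := by
  obtain ⟨C0, hC0, hthird⟩ := exists_third_le P J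
  have hJ : 0 ≤ J.C := zero_le_one.trans J.one_le
  have hK1 := zero_le_one.trans P.one_le_K1
  have hκ := P.κ_pos
  set c := P.n * (J.C * |P.M|) + J.C with hc
  have hc0 : 0 ≤ c := by positivity
  set a0 := 2 * (J.C * P.K1 * (P.n * c)) with ha0
  set a1 := P.n * (|P.M| * (P.K1 + P.n * c * P.K1 + c)) with ha1
  set a2 := (2 * P.K1 + 1) * P.K1 with ha2
  have ha00 : 0 ≤ a0 := by positivity
  have ha10 : 0 ≤ a1 := by positivity
  have ha20 : 0 ≤ a2 := by positivity
  refine ⟨(C0 + a0 + 2 * K₂ * a1 + K₃ * a2) / P.κ, by positivity, ?_⟩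
  intro L M' y hb hf hδ hM ξ hξ1 hξ hmax hv
  have hM' : 0 ≤ M' := (abs_nonneg _).trans hM
  by_cases h0 : 0 ≤ pd L.D.S ξ (pd L.D.S ξ L.D.u) y
  swap
  · exact (not_le.1 h0).le.trans (by positivity)
  have hS := L.D.frontier_subset hf
  have hMa : |P.M| = P.M := abs_of_nonneg L.D.M_nonneg
  have hcc : ∀ l, |L.cc l y| ≤ c := fun l => by
    rw [hc, hMa]; exact L.abs_cc_le J hS hb l
  have h1 := hthird L M' y hb hf hM ξ hξ1 hξ h0 hmax
  have hwx := (L.wx_two hξ1.le hS hb).differentiableWithinAt two_ne_zero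
  have hH : DifferentiableWithinAt ℝ (L.H B.Λ B.c) L.D.S y :=
    (L.H_contDiffAt _ _ hb).contDiffWithinAt.differentiableWithinAt two_ne_zero
  have hg := (L.D.gradSq_two hS).differentiableWithinAt two_ne_zero
  have hp := (L.D.pd_pd_u_one hS ξ ξ).differentiableWithinAt one_ne_zero
  have hcor := (L.correction_two K₂ K₃ B hξ1.le hS hb).differentiableWithinAt two_ne_zero
  have hq := lt_of_lt_of_le one_pos (L.one_le_q hb)
  have h2 : pd L.D.S (-L.grad y) (L.testFn K₂ K₃ B ξ) y ≤ 0 := by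
    refine pd_nonpos_of_eventually_le (hp.add hcor) ?_
    have h3 := L.eventually_mem hb hf (e := -L.grad y) (by rw [pd_neg_vec, L.pd_ρ_grad]; linarith)
    filter_upwards [hv, h3] with t ht1 ht2
    exact ⟨L.D.subset_S ht2, ht1⟩
  have h3 : pd L.D.S (L.grad y) (L.testFn K₂ K₃ B ξ) y =
      pd L.D.S (L.grad y) (pd L.D.S ξ (pd L.D.S ξ L.D.u)) y
        + ((-1) * pd L.D.S (L.grad y) (L.wx ξ) y + (K₂ * pd L.D.S (L.grad y) L.D.gradSq y
          + K₃ * pd L.D.S (L.grad y) (L.H B.Λ B.c) y)) := by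
    unfold testFn
    rw [pd_add L.D.body hS _ hp hcor,
      pd_add L.D.body hS _ ((differentiableWithinAt_const _).fun_mul hwx)
        (((differentiableWithinAt_const _).fun_mul hg).fun_add
          ((differentiableWithinAt_const _).fun_mul hH)),
      pd_add L.D.body hS _ ((differentiableWithinAt_const _).fun_mul hg)
        ((differentiableWithinAt_const _).fun_mul hH),
      pd_const_mul L.D.body hS _ _ hwx, pd_const_mul L.D.body hS _ _ hg,
      pd_const_mul L.D.body hS _ _ hH]
  rw [pd_neg_vec, h3] at h2
  have h4 : |pd L.D.S (L.grad y) (L.wx ξ) y| ≤ a0 := by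
    rw [L.pd_wx_tangent hS hb hξ1.le hξ, abs_mul, abs_two, abs_mul, ha0]
    have e1 := (J.θ ⟨L, y, hS, hb, ξ, hξ1.le⟩).der (L.grad y)
    have e2 := L.abs_sum_cc_le hcc ξ
    rw [hξ1, one_mul] at e2
    have e3 : |pd L.D.S (L.grad y) (L.θ ξ) y| ≤ J.C * P.K1 :=
      e1.trans (mul_le_mul_of_nonneg_left (L.norm_grad_le hb) hJ)
    exact mul_le_mul_of_nonneg_left (mul_le_mul e3 e2 (abs_nonneg _) (by positivity)) zero_le_two
  have h5 : |pd L.D.S (L.grad y) L.D.gradSq y| ≤ 2 * (a1 * (1 + M')) := by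
    rw [L.D.pd_gradSq hS, abs_mul, abs_two]
    refine mul_le_mul_of_nonneg_left ?_ zero_le_two
    have e1 : ∀ l, |pd L.D.S (L.grad y) (L.D.du l) y| ≤ (M' + P.n * c) * P.K1 + c := by
      intro l
      have e2 := L.hess_grad hb hf (EuclideanSpace.single l 1)
      have e3 : ∑ m, (EuclideanSpace.single l (1:ℝ) : E P.n) m * L.cc m y = L.cc l y := by
        simp [Finset.sum_ite_eq']
      rw [e3] at e2
      rw [L.D.pd_du hS, e2]
      refine (abs_add_le _ _).trans (add_le_add ?_ (hcc l))
      rw [abs_mul]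
      exact mul_le_mul (L.abs_wn_le hb hf hcc hc0 hM) (L.abs_rd_le hb l) (abs_nonneg _)
        (by positivity)
    refine (abs_sum_mul_le (fun l => L.D.abs_du_le hS l) e1 L.D.M_nonneg).trans ?_
    rw [ha1, mul_assoc, mul_assoc, hMa]
    have hM0 := L.D.M_nonneg
    gcongr
    have : 0 ≤ (P.n * c * P.K1 + c) * M' := by positivity
    linarith
  have h6 : |pd L.D.S (L.grad y) (L.H B.Λ B.c) y| ≤ a2 :=
    (B.abs_pd_le L y hS hδ _).trans (by rw [ha2]; gcongr; exact L.norm_grad_le hb)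
  have h7 := neg_le_of_abs_le h4
  have h8 := mul_le_mul_of_nonneg_left ((le_abs_self _).trans h5) hK₂
  have h9 := mul_le_mul_of_nonneg_left ((le_abs_self _).trans h6) hK₃
  rw [div_mul_eq_mul_div, le_div_iff₀ hκ]
  have h10 : 0 ≤ (a0 + K₃ * a2) * M' := by positivity
  have h11 : 0 ≤ P.κ * pd L.D.S ξ (pd L.D.S ξ L.D.u) y := by positivity
  nlinarith

/-- At a boundary point, a maximizing direction of the corrected second derivatives may be taken
to be tangential, unless the maximum is controlled by the second normal derivative. -/
theorem exists_tangential_or_le (L : LocalSetup P) {y ξ : E P.n} {M' : ℝ} (hb : y ∈ ball L.p P.r)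
    (hf : y ∈ frontier L.D.Ω) (hM : |L.nn y| ≤ M') (hξ : ‖ξ‖ = 1)
    (hmax : ∀ η, ‖η‖ = 1 → pd L.D.S η (pd L.D.S η L.D.u) y - L.wx η y ≤
      pd L.D.S ξ (pd L.D.S ξ L.D.u) y - L.wx ξ y) :
    pd L.D.S ξ (pd L.D.S ξ L.D.u) y - L.wx ξ y ≤ M' ∨
      ∃ η, ‖η‖ = 1 ∧ inner ℝ (L.grad y) η = 0 ∧ L.wx η y = 0 ∧
        pd L.D.S η (pd L.D.S η L.D.u) y = pd L.D.S ξ (pd L.D.S ξ L.D.u) y - L.wx ξ y := by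
  have hS := L.D.frontier_subset hf
  obtain ⟨h1, h2⟩ := L.hess_sub_wx hb hf ξ
  set Q := pd L.D.S ξ (pd L.D.S ξ L.D.u) y - L.wx ξ y with hQ
  set τ := ξ - L.θ ξ y • L.grad y with hτ
  -- Thus Q is a convex combination of the second derivative along τ/‖τ‖ and the normal one. If Q
  -- exceeds M', it exceeds the normal one, so the tangential one is at least Q.
  have h3 : ‖τ‖ ^ 2 + L.θ ξ y ^ 2 * L.q y = 1 := by
    have e1 : ξ = τ + L.θ ξ y • L.grad y := by rw [hτ]; abel
    have e2 : ‖ξ‖ ^ 2 = ‖τ‖ ^ 2 + ‖L.θ ξ y • L.grad y‖ ^ 2 := by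
      conv_lhs => rw [e1]
      rw [pow_two, pow_two, pow_two]
      apply norm_add_sq_eq_norm_sq_add_norm_sq_real
      rw [inner_smul_right, real_inner_comm, h2, mul_zero]
    rw [hξ, norm_smul, mul_pow, ← L.q_eq, Real.norm_eq_abs, sq_abs] at e2
    linarith
  by_cases hle : Q ≤ M'
  · exact Or.inl hle
  have hlt := not_le.1 hle
  have hnn : L.nn y < Q := ((le_abs_self _).trans hM).trans_lt hlt
  have hq := lt_of_lt_of_le one_pos (L.one_le_q hb)
  have hτ0 : 0 < ‖τ‖ := by
    rcases (norm_nonneg τ).eq_or_lt with h0 | h0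
    · exfalso
      have e0 : τ = 0 := norm_eq_zero.1 h0.symm
      have e1 : L.θ ξ y ^ 2 * L.q y = 1 := by rw [← h0] at h3; linarith
      have e2 : pd L.D.S τ (pd L.D.S τ L.D.u) y = 0 := by rw [e0]; simp [pd]
      rw [e1, e2] at h1
      linarith
    · exact h0
  set η := ‖τ‖⁻¹ • τ with hη
  have hη1 : ‖η‖ = 1 := by rw [hη, norm_smul, norm_inv, norm_norm, inv_mul_cancel₀ hτ0.ne']
  have hηg : inner ℝ (L.grad y) η = 0 := by rw [hη, inner_smul_right, h2, mul_zero]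
  have hwx0 : L.wx η y = 0 := by
    rw [L.wx_eq]
    have : L.θ η y = 0 := by
      unfold θ
      rw [← L.pd_ρ_eq_sum, ← L.inner_grad, hηg, zero_mul]
    rw [this]; ring
  have e1 : pd L.D.S η (pd L.D.S η L.D.u) y = (‖τ‖ ^ 2)⁻¹ * pd L.D.S τ (pd L.D.S τ L.D.u) y := by
    rw [hη, pd_pd_smul_vec L.D.body hS _ _ (L.D.u_two hS), inv_pow]
  have h4 := hmax η hη1
  rw [hwx0, sub_zero] at h4
  refine Or.inr ⟨η, hη1, hηg, hwx0, le_antisymm h4 ?_⟩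
  rw [e1, le_inv_mul_iff₀ (by positivity)]
  have h5 : 0 ≤ (L.θ ξ y ^ 2 * L.q y) * (Q - L.nn y) :=
    mul_nonneg (by positivity) (by linarith)
  have h6 : ‖τ‖ ^ 2 * Q + L.θ ξ y ^ 2 * L.q y * Q = Q := by rw [← add_mul, h3, one_mul]
  linarith

end LocalSetup

end SecondDerivativeEstimate
end HessianNeumann

namespace HessianNeumann

/-! ### Global reduction to the second normal derivatives on the boundary. -/

section ReductionToNormal
open Filter Topology

variable {P : Params}

theorem Setup.continuousOn_hess (D : Setup P) :
    ContinuousOn (fun z : E P.n × E P.n => pd D.S z.2 (pd D.S z.2 D.u) z.1) (D.S ×ˢ univ) := by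
  have h1 : ContinuousOn (fun z : E P.n × E P.n => ∑ l, z.2 l *
      ∑ m, z.2 m * pd D.S (EuclideanSpace.single m 1) (D.du l) z.1) (D.S ×ˢ univ) := by
    refine continuousOn_finsetSum _ fun l _ => ContinuousOn.mul (by fun_prop) ?_
    refine continuousOn_finsetSum _ fun m _ => ContinuousOn.mul (by fun_prop) ?_
    have h2 : ContinuousOn (pd D.S (EuclideanSpace.single m 1) (D.du l)) D.S := fun x hx =>
      (D.pd_pd_u_one hx _ _).continuousWithinAt
    exact h2.comp continuousOn_fst fun z hz => hz.1
  refine h1.congr fun z hz => ?_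
  show pd D.S z.2 (pd D.S z.2 D.u) z.1 = _
  rw [D.hess_eq_sum hz.1]
  refine Finset.sum_congr rfl fun l _ => ?_
  congr 1
  conv_lhs => rw [← Setup.sum_single z.2]
  rw [pd_sum_vec]
  exact Finset.sum_congr rfl fun m _ => pd_smul_vec _ _ _ _

theorem LocalSetup.continuousOn_wx (L : LocalSetup P) :
    ContinuousOn (fun z : E P.n × E P.n => L.wx z.2 z.1) ((L.D.S ∩ ball L.p P.r) ×ˢ univ) := by
  have h0 : ∀ {g : E P.n → ℝ}, (∀ y (_ : y ∈ L.D.S) (_ : y ∈ ball L.p P.r),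
      ContDiffWithinAt ℝ 2 g L.D.S y) → ContinuousOn (fun z : E P.n × E P.n => g z.1)
        ((L.D.S ∩ ball L.p P.r) ×ˢ univ) := by
    intro g hg
    have h2 : ContinuousOn g (L.D.S ∩ ball L.p P.r) := fun x hx =>
      (hg x hx.1 hx.2).continuousWithinAt.mono inter_subset_left
    exact h2.comp continuousOn_fst fun z hz => hz.1
  have hr := fun l => h0 fun y hS hb => L.rd_two hS hb l
  have hc := fun l => h0 fun y hS hb => L.cc_two hS hb l
  have hq := h0 (g := L.qi) fun y hS hb => unifJet_qi.contDiff (L.pointAt hS hb)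
  have hθ : ContinuousOn (fun z : E P.n × E P.n => L.θ z.2 z.1)
      ((L.D.S ∩ ball L.p P.r) ×ˢ univ) :=
    (continuousOn_finsetSum _ fun l _ => ContinuousOn.mul (by fun_prop) (hr l)).mul hq
  have h3 : ContinuousOn (fun z : E P.n × E P.n => 2 * (L.θ z.2 z.1 *
      ∑ l, (z.2 l - L.θ z.2 z.1 * L.rd l z.1) * L.cc l z.1)) ((L.D.S ∩ ball L.p P.r) ×ˢ univ) :=
    continuousOn_const.mul (hθ.mul (continuousOn_finsetSum _ fun l _ =>
      (ContinuousOn.sub (by fun_prop) (hθ.mul (hr l))).mul (hc l)))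
  exact h3.congr fun z _ => L.wx_eq z.2 z.1

theorem LocalSetup.continuousOn_testFn (L : LocalSetup P) (K₂ K₃ : ℝ) (B : BarrierConst P) :
    ContinuousOn (fun z : E P.n × E P.n => L.testFn K₂ K₃ B z.2 z.1)
      ((L.D.S ∩ ball L.p P.r) ×ˢ univ) := by
  have h1 : ContinuousOn L.D.gradSq (L.D.S ∩ ball L.p P.r) := fun x hx =>
    (L.D.gradSq_two hx.1).continuousWithinAt.mono inter_subset_left
  have h2 : ContinuousOn (L.H B.Λ B.c) (L.D.S ∩ ball L.p P.r) := fun x hx =>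
    (L.H_contDiffAt _ _ hx.2).continuousAt.continuousWithinAt
  exact (L.D.continuousOn_hess.mono (prod_mono inter_subset_left subset_rfl)).add
    ((continuousOn_const.mul L.continuousOn_wx).add
      ((continuousOn_const.mul (h1.comp continuousOn_fst fun z hz => hz.1)).add
        (continuousOn_const.mul (h2.comp continuousOn_fst fun z hz => hz.1))))

theorem sphere_nonempty (P : Params) : (sphere (0 : E P.n) 1).Nonempty :=
  ⟨EuclideanSpace.single ⟨0, P.one_le_k.trans P.k_le_n⟩ 1, by simp⟩

theorem LocalSetup.H_p (L : LocalSetup P) (B : BarrierConst P) : L.H B.Λ B.c L.p = 0 := by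
  have := B.abs_H_le L L.p L.p_mem (by simp [B.δ_pos.le])
  simpa using this

/-- The second derivatives are controlled by the second normal derivatives on the boundary. -/
theorem exists_hess_le_normal (P : Params) :
    ∃ C, 0 ≤ C ∧ ∀ (D : Setup P) (M' : ℝ), 0 ≤ M' → D.NormalBound M' → ∀ x ∈ D.S,
      ∀ ξ : E P.n, ‖ξ‖ = 1 → pd D.S ξ (pd D.S ξ D.u) x ≤ C * (1 + M') := by
  obtain ⟨J⟩ := exists_jetConst P
  obtain ⟨B⟩ := exists_barrierConst P
  have hJ : 0 ≤ J.C := zero_le_one.trans J.one_le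
  have hc := B.c_pos
  have hδ := B.δ_pos
  obtain ⟨K₀, hK₀⟩ := LocalSetup.exists_not_isLocalMax J B
  obtain ⟨C2, hC2⟩ := Setup.exists_le_of_isLocalMax P J
  set K₂ := 1 + J.C * P.n ^ 2 with hK2
  have hK2' : 0 ≤ K₂ := by positivity
  set Cw := P.n * (J.C * |P.M|) + J.C with hCw
  have hCw0 : 0 ≤ Cw := by positivity
  -- The first summand excludes interior maxima of the test function; the second makes it too small
  -- on the sphere of radius `B.δ` about p.
  set K₃ := |K₀| + (2 * Cw + 1) / (B.c * B.δ ^ 2) with hK3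
  have hK3' : 0 ≤ K₃ := by positivity
  have hK30 : K₀ ≤ K₃ := (le_abs_self _).trans (le_add_of_nonneg_right (by positivity))
  have hK3c : 2 * Cw + 1 ≤ K₃ * (B.c * B.δ ^ 2) := by
    rw [← div_le_iff₀ (by positivity)]
    exact le_add_of_nonneg_left (abs_nonneg _)
  obtain ⟨C1, hC1, htan⟩ := LocalSetup.exists_tangential_le J B hK2' hK3'
  refine ⟨|C2| + K₂ * (P.n * P.M ^ 2) + Cw + C1 + 1, by positivity, ?_⟩
  intro D M' hM' hN x hx ξ hξ
  have hMa : |P.M| = P.M := abs_of_nonneg D.M_nonneg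
  have hsph : IsCompact (sphere (0 : E P.n) 1) := isCompact_sphere _ _
  have hcont : ContinuousOn (fun z : E P.n × E P.n =>
      pd D.S z.2 (pd D.S z.2 D.u) z.1 + K₂ * D.gradSq z.1) (D.S ×ˢ sphere 0 1) := by
    have h1 : ContinuousOn D.gradSq D.S := fun x hx => (D.gradSq_two hx).continuousWithinAt
    exact (D.continuousOn_hess.mono (prod_mono subset_rfl (subset_univ _))).add
      (continuousOn_const.mul (h1.comp continuousOn_fst fun z hz => hz.1))
  -- The correction `wx` exists only near a boundary point, so a global maximum without it is
  -- located first. If that lies on the boundary, the corrected test function is maximized again in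
  -- a small ball about it.
  obtain ⟨⟨p, ξ₀⟩, ⟨hpS', hξ₀'⟩, hmax⟩ := (D.isCompact_S.prod hsph).exists_isMaxOn
    (Nonempty.prod ⟨x, hx⟩ (sphere_nonempty P)) hcont
  have hξ₀ : ‖ξ₀‖ = 1 := mem_sphere_zero_iff_norm.1 hξ₀'
  have hpS : p ∈ D.S := hpS'
  have hmax' : ∀ z ∈ D.S, ∀ η : E P.n, ‖η‖ = 1 → pd D.S η (pd D.S η D.u) z + K₂ * D.gradSq z ≤
      pd D.S ξ₀ (pd D.S ξ₀ D.u) p + K₂ * D.gradSq p := fun z hz η hη =>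
    hmax (show (z, η) ∈ D.S ×ˢ sphere 0 1 from ⟨hz, mem_sphere_zero_iff_norm.2 hη⟩)
  clear hmax hcont hpS' hξ₀'
  suffices hV : pd D.S ξ₀ (pd D.S ξ₀ D.u) p + K₂ * D.gradSq p ≤
      (|C2| + K₂ * (P.n * P.M ^ 2) + Cw + C1 + 1) * (1 + M') by
    have h1 := hmax' x hx ξ hξ
    have h2 := mul_nonneg hK2' (D.gradSq_nonneg x)
    linarith
  have hM'2 : 0 ≤ (|C2| + K₂ * (P.n * P.M ^ 2) + Cw) * M' := by positivity
  rcases D.mem_or_frontier hpS with hp | hp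
  · have h1 := hC2 D p hp ξ₀ hξ₀ (by
      filter_upwards [D.isOpen.mem_nhds hp] with z hz
      exact hmax' z (D.subset_S hz) ξ₀ hξ₀)
    have h2 := mul_le_mul_of_nonneg_left (D.gradSq_le hpS) hK2'
    have h3 : 0 ≤ (C1 + 1) * M' := by positivity
    linarith [le_abs_self C2]
  obtain ⟨L, rfl, rfl⟩ := D.exists_local hp
  have hsub : L.D.S ∩ closedBall L.p B.δ ⊆ L.D.S ∩ ball L.p P.r :=
    inter_subset_inter_right _ (closedBall_subset_ball B.δ_lt)
  have hcont : ContinuousOn (fun z : E P.n × E P.n => L.testFn K₂ K₃ B z.2 z.1)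
      ((L.D.S ∩ closedBall L.p B.δ) ×ˢ sphere 0 1) :=
    (L.continuousOn_testFn K₂ K₃ B).mono (prod_mono hsub (subset_univ _))
  obtain ⟨⟨y, η⟩, ⟨⟨hyS', hyδ''⟩, hη'⟩, hmx⟩ :=
    ((L.D.isCompact_S.inter_right isClosed_closedBall).prod hsph).exists_isMaxOn
    (Nonempty.prod ⟨L.p, hpS, mem_closedBall_self hδ.le⟩ (sphere_nonempty P)) hcont
  have hη : ‖η‖ = 1 := mem_sphere_zero_iff_norm.1 hη'
  have hyS : y ∈ L.D.S := hyS'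
  have hyδ : y ∈ closedBall L.p B.δ := hyδ''
  have hyb : y ∈ ball L.p P.r := closedBall_subset_ball B.δ_lt hyδ
  have hyδ' : ‖y - L.p‖ ≤ B.δ := by rwa [mem_closedBall, dist_eq_norm] at hyδ
  have hmx' : ∀ z ∈ L.D.S, z ∈ closedBall L.p B.δ → ∀ ζ : E P.n, ‖ζ‖ = 1 →
      L.testFn K₂ K₃ B ζ z ≤ L.testFn K₂ K₃ B η y := fun z hz hzb ζ hζ =>
    hmx (show (z, ζ) ∈ (L.D.S ∩ closedBall L.p B.δ) ×ˢ sphere 0 1 from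
      ⟨⟨hz, hzb⟩, mem_sphere_zero_iff_norm.2 hζ⟩)
  clear hmx hcont hyS' hyδ'' hη'
  have hwx : ∀ z ∈ L.D.S, z ∈ ball L.p P.r → ∀ ζ : E P.n, ‖ζ‖ = 1 → |L.wx ζ z| ≤ Cw :=
    fun z hz hzb ζ hζ => by
      have := L.abs_wx_le J hζ.le hz hzb
      rwa [hCw, hMa]
  set V := pd L.D.S ξ₀ (pd L.D.S ξ₀ L.D.u) L.p + K₂ * L.D.gradSq L.p with hVdef
  have hlow : V - Cw ≤ L.testFn K₂ K₃ B η y := by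
    refine le_trans ?_ (hmx' L.p hpS (mem_closedBall_self hδ.le) ξ₀ hξ₀)
    have := (le_abs_self _).trans (hwx L.p hpS (mem_ball_self P.r_pos) ξ₀ hξ₀)
    unfold LocalSetup.testFn
    rw [L.H_p B]
    linarith
  have hHle := B.H_le L y hyS hyδ'
  have hwy := neg_le_of_abs_le (hwx y hyS hyb η hη)
  -- On the sphere the barrier loses at least 2·`Cw` + 1, whereas inserting and removing the
  -- correction costs at most 2·`Cw` relative to the global maximum at p.
  have hlt : ‖y - L.p‖ < B.δ := by
    refine lt_of_le_of_ne hyδ' fun heq => ?_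
    have h1 := hmax' y hyS η hη
    have h2 : K₃ * L.H B.Λ B.c y ≤ -(2 * Cw + 1) := by
      have := mul_le_mul_of_nonneg_left hHle hK3'
      rw [heq] at this
      linarith
    unfold LocalSetup.testFn at hlow
    linarith
  have hopen : ball L.p B.δ ∈ 𝓝 y := isOpen_ball.mem_nhds (by rwa [mem_ball, dist_eq_norm])
  rcases L.D.mem_or_frontier hyS with hy | hy
  · refine absurd ?_ (hK₀ K₃ hK30 L y hy hyδ' η hη)
    filter_upwards [L.D.isOpen.mem_nhds hy, hopen] with z hz hzb
    exact hmx' z (L.D.subset_S hz) (ball_subset_closedBall hzb) η hη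
  have hnn := hN.abs_nn_le hyb hy
  have hgr := mul_le_mul_of_nonneg_left (L.D.gradSq_le hyS) hK2'
  have hH0 : K₃ * L.H B.Λ B.c y ≤ 0 := mul_nonpos_of_nonneg_of_nonpos hK3' (hHle.trans (by
    have : 0 ≤ B.c * ‖y - L.p‖ ^ 2 := by positivity
    linarith))
  have hVQ : V ≤ pd L.D.S η (pd L.D.S η L.D.u) y - L.wx η y + K₂ * (P.n * P.M ^ 2) + Cw := by
    unfold LocalSetup.testFn at hlow
    linarith
  have hQmax : ∀ ζ, ‖ζ‖ = 1 → pd L.D.S ζ (pd L.D.S ζ L.D.u) y - L.wx ζ y ≤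
      pd L.D.S η (pd L.D.S η L.D.u) y - L.wx η y := by
    intro ζ hζ
    have := hmx' y hyS hyδ ζ hζ
    unfold LocalSetup.testFn at this
    linarith
  rcases L.exists_tangential_or_le hyb hy hnn hη hQmax with h1 | ⟨ζ, hζ1, hζg, hζw, hζQ⟩
  · have : 0 ≤ |C2| + C1 + C1 * M' := by positivity
    linarith
  have hζtest : L.testFn K₂ K₃ B ζ y = L.testFn K₂ K₃ B η y := by
    unfold LocalSetup.testFn
    rw [hζw, hζQ]; ring
  have h1 := htan L M' y hyb hy hyδ' hnn ζ hζ1 hζg (fun ω hω hωg => by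
      have h2 := hQmax ω hω
      have h3 : L.wx ω y = 0 := by
        rw [L.wx_eq]
        have : L.θ ω y = 0 := by
          unfold LocalSetup.θ
          rw [← L.pd_ρ_eq_sum, ← L.inner_grad, hωg, zero_mul]
        rw [this]; ring
      rw [h3, sub_zero] at h2
      rw [hζQ]; exact h2) (by
    have hq := lt_of_lt_of_le one_pos (L.one_le_q hyb)
    have h2 := L.eventually_mem hyb hy (e := -L.grad y)
      (by rw [pd_neg_vec, L.pd_ρ_grad]; linarith)
    have h3 : ∀ᶠ t in 𝓝[>] (0:ℝ), y + t • (-L.grad y) ∈ ball L.p B.δ := by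
      have : Tendsto (fun t : ℝ => y + t • (-L.grad y)) (𝓝 0) (𝓝 y) := by
        have : ContinuousAt (fun t : ℝ => y + t • (-L.grad y)) 0 := by fun_prop
        simpa [ContinuousAt] using this
      exact (this.mono_left nhdsWithin_le_nhds) hopen
    filter_upwards [h2, h3] with t ht1 ht2
    rw [hζtest]
    exact hmx' _ (L.D.subset_S ht1) (ball_subset_closedBall ht2) ζ hζ1)
  have : 0 ≤ |C2| + 1 + M' := by positivity
  linarith

end ReductionToNormal
end HessianNeumann

namespace HessianNeumann

/-! ### The test function for the normal derivatives and its differential inequality. -/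

section NormalEstimate
open Filter Topology

theorem JetBound.neg {V : Type*} [NormedAddCommGroup V] [NormedSpace ℝ V] {D : PointData V}
    {C : ℝ} {g : V → ℝ} (h : JetBound D C g) : JetBound D C (fun y => -g y) := by
  refine ⟨h.contDiff.neg, by rw [abs_neg]; exact h.val, fun e => ?_, ?_⟩
  · have h1 := pd_const_mul D.body D.mem e (-1) (h.contDiff.differentiableWithinAt two_ne_zero)
    simp only [neg_one_mul] at h1
    rw [h1, abs_neg]
    exact h.der e
  · obtain ⟨b, hb1, hb2⟩ := h.hess
    refine ⟨-b, by rwa [abs_neg], fun e => ?_⟩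
    have h1 := pd_pd_const_mul D.body D.mem e e (-1) h.contDiff
    simp only [neg_one_mul] at h1
    rw [h1, ← abs_neg]
    refine le_trans (le_of_eq ?_) (hb2 e)
    congr 1
    ring

variable {P : Params}

/-- The squared length of a gradient in an orthonormal frame. -/
theorem sq_pd_le_sum {n : ℕ} {S : Set (E n)} (e : OrthonormalBasis (Fin n) ℝ (E n)) (g : E n → ℝ)
    (x v : E n) : pd S v g x ^ 2 ≤ ‖v‖ ^ 2 * ∑ i, pd S (e i) g x ^ 2 := by
  have h1 : pd S v g x = ∑ i, inner ℝ (e i) v * pd S (e i) g x := by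
    conv_lhs => rw [← e.sum_repr' v]
    rw [pd_sum_vec]
    exact Finset.sum_congr rfl fun i _ => pd_smul_vec _ _ _ _
  have h2 : ∑ i, inner ℝ (e i) v ^ 2 = ‖v‖ ^ 2 := by
    rw [← e.sum_sq_norm_inner_right v]
    exact Finset.sum_congr rfl fun i _ => by rw [Real.norm_eq_abs, sq_abs]
  rw [h1, ← h2]
  exact Finset.sum_mul_sq_le_sq_mul_sq _ _ _

namespace LocalSetup

/-- The test function for the second normal derivatives. -/
def normalFn (L : LocalSetup P) (B : BarrierConst P) (σ β K : ℝ) (y : E P.n) : ℝ :=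
  σ * ((1 + (-β) * L.H B.Λ B.c y) * L.w y) + K * L.H B.Λ B.c y

theorem abs_w_le (L : LocalSetup P) (J : JetConst P) {y : E P.n} (hS : y ∈ L.D.S)
    (hb : y ∈ ball L.p P.r) : |L.w y| ≤ P.n * (P.K1 * P.M) + J.C := by
  refine (abs_add_le _ _).trans (add_le_add ?_ ?_)
  · exact abs_sum_mul_le (fun l => L.abs_rd_le hb l) (fun l => L.D.abs_du_le hS l)
      (zero_le_one.trans P.one_le_K1)
  · rw [abs_neg]; exact (J.φt (L.pointAt hS hb)).val

theorem pd_normalFn (L : LocalSetup P) (B : BarrierConst P) (σ β K : ℝ) {y : E P.n}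
    (hS : y ∈ L.D.S) (hb : y ∈ ball L.p P.r) (e : E P.n) :
    pd L.D.S e (L.normalFn B σ β K) y =
      σ * ((1 + (-β) * L.H B.Λ B.c y) * pd L.D.S e L.w y
        + (-β) * pd L.D.S e (L.H B.Λ B.c) y * L.w y) + K * pd L.D.S e (L.H B.Λ B.c) y := by
  have hH : DifferentiableWithinAt ℝ (L.H B.Λ B.c) L.D.S y :=
    (L.H_contDiffAt _ _ hb).contDiffWithinAt.differentiableWithinAt two_ne_zero
  have hw := (L.w_two hS hb).differentiableWithinAt two_ne_zero
  have h1 : DifferentiableWithinAt ℝ (fun y => (-β) * L.H B.Λ B.c y) L.D.S y :=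
    (differentiableWithinAt_const _).fun_mul hH
  have hg : DifferentiableWithinAt ℝ (fun y => 1 + (-β) * L.H B.Λ B.c y) L.D.S y :=
    (differentiableWithinAt_const _).fun_add h1
  unfold normalFn
  rw [pd_add L.D.body hS e ((differentiableWithinAt_const _).fun_mul (hg.fun_mul hw))
    ((differentiableWithinAt_const _).fun_mul hH), pd_const_mul L.D.body hS e _ (hg.fun_mul hw),
    pd_const_mul L.D.body hS e _ hH, pd_mul L.D.body hS e hg hw,
    pd_add L.D.body hS e (differentiableWithinAt_const _) h1, pd_const,
    pd_const_mul L.D.body hS e _ hH, zero_add]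

theorem normalFn_two (L : LocalSetup P) (B : BarrierConst P) (σ β K : ℝ) {y : E P.n}
    (hS : y ∈ L.D.S) (hb : y ∈ ball L.p P.r) :
    ContDiffWithinAt ℝ 2 (L.normalFn B σ β K) L.D.S y := by
  have hH : ContDiffWithinAt ℝ 2 (L.H B.Λ B.c) L.D.S y := (L.H_contDiffAt _ _ hb).contDiffWithinAt
  exact (contDiffWithinAt_const.mul ((contDiffWithinAt_const.add
    (contDiffWithinAt_const.mul hH)).mul (L.w_two hS hb))).add (contDiffWithinAt_const.mul hH)

theorem pd_pd_normalFn (L : LocalSetup P) (B : BarrierConst P) (σ β K : ℝ) {y : E P.n}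
    (hS : y ∈ L.D.S) (hb : y ∈ ball L.p P.r) (e : E P.n) :
    pd L.D.S e (pd L.D.S e (L.normalFn B σ β K)) y =
      σ * ((1 + (-β) * L.H B.Λ B.c y) * pd L.D.S e (pd L.D.S e L.w) y
        + 2 * ((-β) * pd L.D.S e (L.H B.Λ B.c) y * pd L.D.S e L.w y)
        + (-β) * pd L.D.S e (pd L.D.S e (L.H B.Λ B.c)) y * L.w y)
        + K * pd L.D.S e (pd L.D.S e (L.H B.Λ B.c)) y := by
  have hH : ContDiffWithinAt ℝ 2 (L.H B.Λ B.c) L.D.S y := (L.H_contDiffAt _ _ hb).contDiffWithinAt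
  have hw := L.w_two hS hb
  have h1 : ContDiffWithinAt ℝ 2 (fun y => (-β) * L.H B.Λ B.c y) L.D.S y :=
    contDiffWithinAt_const.mul hH
  have hg : ContDiffWithinAt ℝ 2 (fun y => 1 + (-β) * L.H B.Λ B.c y) L.D.S y :=
    contDiffWithinAt_const.add h1
  have hd : pd L.D.S e (fun y => 1 + (-β) * L.H B.Λ B.c y) y
      = (-β) * pd L.D.S e (L.H B.Λ B.c) y := by
    rw [pd_add L.D.body hS e (differentiableWithinAt_const _)
      (h1.differentiableWithinAt two_ne_zero), pd_const,
      pd_const_mul L.D.body hS e _ (hH.differentiableWithinAt two_ne_zero), zero_add]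
  have hdd : pd L.D.S e (pd L.D.S e (fun y => 1 + (-β) * L.H B.Λ B.c y)) y
      = (-β) * pd L.D.S e (pd L.D.S e (L.H B.Λ B.c)) y := by
    have h0 : pd L.D.S e (pd L.D.S e (fun _ : E P.n => (1:ℝ))) y = 0 := by
      have : pd L.D.S e (fun _ : E P.n => (1:ℝ)) = fun _ => 0 := by
        funext z; exact pd_const _ _ _
      rw [this]; exact pd_const _ _ _
    rw [pd_pd_add L.D.body hS e e contDiffWithinAt_const h1, h0,
      pd_pd_const_mul L.D.body hS e e _ hH, zero_add]
  unfold normalFn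
  rw [pd_pd_add L.D.body hS e e (contDiffWithinAt_const.mul (hg.mul hw))
    (contDiffWithinAt_const.mul hH), pd_pd_const_mul L.D.body hS e e _ (hg.mul hw),
    pd_pd_const_mul L.D.body hS e e _ hH, pd_pd_mul L.D.body hS e e hg hw, hd, hdd]
  ring

/-- The differential inequality at an interior maximum of the test function. -/
theorem normalFn_max_ineq (L : LocalSetup P) (J : JetConst P) (B : BarrierConst P) {σ β K : ℝ}
    (hσ : |σ| = 1) (hβ : 0 ≤ β) {x : E P.n} (hx : x ∈ L.D.Ω) (hxδ : ‖x - L.p‖ ≤ B.δ)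
    (hβH : β * |L.H B.Λ B.c x| ≤ 1) (hK0 : 0 ≤ K) (hK : 2 * (β * |L.w x|) ≤ K)
    {e : OrthonormalBasis (Fin P.n) ℝ (E P.n)} {lam G : Fin P.n → ℝ}
    (h : L.D.InteriorFrame x e lam G) (hm : IsLocalMax (L.normalFn B σ β K) x) :
    K / 2 * (B.c * ∑ i, G i + β * ∑ i, G i * pd L.D.S (e i) (L.H B.Λ B.c) x ^ 2) ≤
      2 * (P.n * (J.C * J.C) + (P.n * P.M + 1) * J.C * P.k)
        + 2 * ((P.n * P.M + 1) * J.C) * ∑ i, G i + 4 * (P.n * J.C) * ∑ i, G i * |lam i| := by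
  have hJ : 0 ≤ J.C := zero_le_one.trans J.one_le
  have hS := L.D.subset_S hx
  have hb : x ∈ ball L.p P.r := by
    rw [mem_ball, dist_eq_norm]; exact hxδ.trans_lt B.δ_lt
  set i0 := L.pointAt hS hb
  set H := L.H B.Λ B.c with hH
  set g := 1 + (-β) * H x with hg
  -- The total coefficient of the derivatives of H. The assumption on K keeps it at least K/2.
  set m := K - σ * (β * L.w x) with hmdef
  have hHle : H x ≤ 0 := (B.H_le L x hS hxδ).trans (by
    have : 0 ≤ B.c * ‖x - L.p‖ ^ 2 := mul_nonneg B.c_pos.le (by positivity)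
    linarith)
  have hg1 : 1 ≤ g := by
    have : β * H x ≤ 0 := mul_nonpos_of_nonneg_of_nonpos hβ hHle
    rw [hg]; linarith
  have hg2 : g ≤ 2 := by
    rw [abs_of_nonpos hHle] at hβH
    rw [hg]; linarith
  have hm2 : K / 2 ≤ m := by
    have h1 : |σ * (β * L.w x)| = β * |L.w x| := by
      rw [abs_mul, hσ, one_mul, abs_mul, abs_of_nonneg hβ]
    have := le_abs_self (σ * (β * L.w x))
    rw [hmdef]; linarith
  have hm0 : 0 ≤ m := le_trans (by linarith) hm2
  have hfirst : ∀ i, σ * (g * pd L.D.S (e i) L.w x) = -m * pd L.D.S (e i) H x := by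
    intro i
    have h1 := pd_eq_zero_of_isLocalMax (L.D.subset_interior hx) hm (e i)
    rw [L.pd_normalFn B σ β K hS hb] at h1
    rw [hmdef]
    linarith
  -- At the critical point Dw is a multiple of DH, so the cross term of the product becomes a
  -- positive multiple of H_i². This gain is the purpose of the factor 1 - βH.
  have hcross : ∀ i, β * m * pd L.D.S (e i) H x ^ 2 ≤
      σ * (2 * ((-β) * pd L.D.S (e i) H x * pd L.D.S (e i) L.w x)) := by
    intro i
    have h1 := hfirst i
    have hgp : 0 < g := lt_of_lt_of_le one_pos hg1
    refine le_of_mul_le_mul_left ?_ hgp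
    have h2 : g * (σ * (2 * ((-β) * pd L.D.S (e i) H x * pd L.D.S (e i) L.w x)))
        = 2 * (β * m * pd L.D.S (e i) H x ^ 2) := by
      linear_combination (-2 * β * pd L.D.S (e i) H x) * h1
    rw [h2]
    exact mul_le_mul_of_nonneg_right hg2 (by positivity)
  have h2 : ∑ i, G i * (σ * (g * pd L.D.S (e i) (pd L.D.S (e i) L.w) x)
      + (β * m * pd L.D.S (e i) H x ^ 2 + m * pd L.D.S (e i) (pd L.D.S (e i) H) x)) ≤ 0 := by
    refine Finset.sum_nonpos fun i _ => mul_nonpos_of_nonneg_of_nonpos (h.pos i).le ?_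
    have h3 := pd_pd_nonpos_of_isLocalMax L.D.body (L.D.subset_interior hx)
      (L.normalFn_two B σ β K hS hb) hm (e i)
    rw [L.pd_pd_normalFn B σ β K hS hb] at h3
    have h4 := hcross i
    rw [hmdef] at h4 ⊢
    linarith
  have h3 : ∑ i, G i * (σ * (g * pd L.D.S (e i) (pd L.D.S (e i) L.w) x)
      + (β * m * pd L.D.S (e i) H x ^ 2 + m * pd L.D.S (e i) (pd L.D.S (e i) H) x))
      = σ * (g * ∑ i, G i * pd L.D.S (e i) (pd L.D.S (e i) L.w) x)
        + m * (β * ∑ i, G i * pd L.D.S (e i) H x ^ 2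
          + ∑ i, G i * pd L.D.S (e i) (pd L.D.S (e i) H) x) := by
    simp only [Finset.mul_sum, ← Finset.sum_add_distrib]
    exact Finset.sum_congr rfl fun i _ => by ring
  rw [h3] at h2
  have t5 : B.c * ∑ i, G i ≤ ∑ i, G i * pd L.D.S (e i) (pd L.D.S (e i) H) x := by
    rw [Finset.mul_sum]
    refine Finset.sum_le_sum fun i _ => ?_
    have := B.convex L x hS hxδ (e i)
    rw [e.norm_eq_one, one_pow, mul_one] at this
    rw [mul_comm]
    exact mul_le_mul_of_nonneg_left this (h.pos i).le
  have hQ : 0 ≤ ∑ i, G i * pd L.D.S (e i) H x ^ 2 :=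
    Finset.sum_nonneg fun i _ => mul_nonneg (h.pos i).le (sq_nonneg _)
  have t6 : K / 2 * (B.c * ∑ i, G i + β * ∑ i, G i * pd L.D.S (e i) H x ^ 2) ≤
      m * (β * ∑ i, G i * pd L.D.S (e i) H x ^ 2
          + ∑ i, G i * pd L.D.S (e i) (pd L.D.S (e i) H) x) := by
    refine mul_le_mul hm2 (by linarith) ?_ hm0
    exact add_nonneg (mul_nonneg B.c_pos.le h.sum_nonneg) (mul_nonneg hβ hQ)
  have t7 : |∑ i, G i * pd L.D.S (e i) (pd L.D.S (e i) L.w) x| ≤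
      (P.n * (J.C * J.C) + (P.n * P.M + 1) * J.C * P.k) + (P.n * P.M + 1) * J.C * ∑ i, G i
        + 2 * ((P.n * J.C) * ∑ i, G i * |lam i|) := by
    have hφ : JetBound (L.D.pt h.memS) J.C (fun y => -L.φt y) := (J.φt i0).neg
    have t3 := h.abs_lin_first_order_le (J.F L.D x hS) (a := fun l => L.rd l)
      (b := fun y => -L.φt y) (fun l => J.rd l i0) hφ
    have t4 : |∑ i, G i * lam i * ∑ l, e i l * pd L.D.S (e i) (L.rd l) x| ≤
        (P.n * J.C) * ∑ i, G i * |lam i| := by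
      rw [Finset.mul_sum]
      refine (Finset.abs_sum_le_sum_abs _ _).trans (Finset.sum_le_sum fun i _ => ?_)
      have h4 := abs_sum_mul_le (a := fun l => e i l)
        (b := fun l => pd L.D.S (e i) (L.rd l) x) (A := 1) (B := J.C)
        (fun l => Setup.InteriorFrame.abs_coord_le e i l) (fun l => by
          have h1 := (J.rd l i0).der (e i)
          rw [e.norm_eq_one, mul_one] at h1
          exact h1) zero_le_one
      rw [one_mul] at h4
      rw [abs_mul, abs_mul, abs_of_pos (h.pos i), mul_comm]
      exact mul_le_mul_of_nonneg_right h4 (mul_nonneg (h.pos i).le (abs_nonneg _))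
    have u : (fun y => ∑ l, L.rd l y * L.D.du l y + -L.φt y) = L.w := rfl
    rw [u] at t3
    rw [abs_le] at t3 t4 ⊢
    constructor <;> linarith [t3.1, t3.2, t4.1, t4.2]
  have t8 : -(2 * |∑ i, G i * pd L.D.S (e i) (pd L.D.S (e i) L.w) x|) ≤
      σ * (g * ∑ i, G i * pd L.D.S (e i) (pd L.D.S (e i) L.w) x) := by
    refine neg_le_of_abs_le ?_
    rw [abs_mul, hσ, one_mul, abs_mul, abs_of_pos (lt_of_lt_of_le one_pos hg1)]
    exact mul_le_mul_of_nonneg_right hg2 (abs_nonneg _)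
  linarith

end LocalSetup

end NormalEstimate
end HessianNeumann

namespace HessianNeumann

/-! ### Self-improving bound for the second normal derivatives. -/

section NormalBound
open Filter Topology

variable {P : Params}

set_option maxHeartbeats 1000000 in
-- Only Σ G_i |λ_i| can compete with K ≥ (1 + M')/2, since |λ_i| is known only to be O(1 + M'). It
-- is beaten by the convexity of H when the least eigenvalue is not too negative, and by the
-- gradient term otherwise. The threshold and β do not depend on M', which is why the small factor
-- 1/2 in K suffices.
theorem LocalSetup.exists_normalFn_not_isLocalMax (J : JetConst P) (B : BarrierConst P) {C₁ : ℝ}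
    (hC₁ : 0 ≤ C₁) :
    ∃ β A₀, 0 ≤ β ∧ 1 ≤ A₀ ∧ ∀ A ≥ A₀, ∀ (L : LocalSetup P) (M' : ℝ), 0 ≤ M' →
      (∀ x ∈ L.D.S, ∀ ξ : E P.n, ‖ξ‖ = 1 → pd L.D.S ξ (pd L.D.S ξ L.D.u) x ≤ C₁ * (1 + M')) →
      ∀ x ∈ L.D.Ω, ‖x - L.p‖ ≤ B.δ → β * |L.H B.Λ B.c x| ≤ 1 → 2 * (β * |L.w x|) ≤ A →
      ∀ σ, |σ| = 1 → ¬ IsLocalMax (L.normalFn B σ β (A + M' / 2)) x := by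
  have hJ : 0 ≤ J.C := zero_le_one.trans J.one_le
  have hc := B.c_pos
  set c1 := P.n * (J.C * J.C) + (P.n * |P.M| + 1) * J.C * P.k with hc1
  set c2 := (P.n * |P.M| + 1) * J.C with hc2
  set c3 := P.n * J.C with hc3
  have hc10 : 0 ≤ c1 := by positivity
  have hc20 : 0 ≤ c2 := by positivity
  have hc30 : 0 ≤ c3 := by positivity
  set g0 := Real.exp (-|Real.log P.A|) with hg0
  have hg0' : 0 < g0 := Real.exp_pos _
  -- Small enough that negative eigenvalues above -δ₁(1 + M') cost at most half of the convexity
  -- term.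
  set δ₁ := B.c / (64 * (c3 + 1)) with hδ₁
  have hδ₁0 : 0 < δ₁ := by positivity
  have hδ₁c : 64 * c3 * δ₁ ≤ B.c := by
    have h1 : 64 * (c3 + 1) * δ₁ = B.c := by rw [hδ₁]; field_simp
    have h2 : 0 ≤ 64 * δ₁ := by positivity
    linarith
  set ε := δ₁ / (C₁ + 1) with hε
  have hε0 : 0 < ε := by positivity
  set Θ : ℝ := P.n * (1 + 2 * P.n ^ 2 / ε ^ 2) with hΘ
  have hΘ0 : 0 ≤ Θ := by positivity
  set W := 2 * c1 + 4 * c3 * P.k + 1 with hW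
  have hW0 : 0 ≤ W := by positivity
  refine ⟨64 * Θ * (c3 * (P.n * C₁)), 1 + 4 / B.c * (2 * c2 + W / g0), by positivity, ?_, ?_⟩
  · have : 0 ≤ 4 / B.c * (2 * c2 + W / g0) := by positivity
    linarith
  intro A hA L M' hM' hC x hx hxδ hβH hβw σ hσ hm
  set β := 64 * Θ * (c3 * (P.n * C₁)) with hβ
  have hβ0 : 0 ≤ β := by positivity
  have hS := L.D.subset_S hx
  have hMa : |P.M| = P.M := abs_of_nonneg L.D.M_nonneg
  obtain ⟨e, lam, G, h⟩ := L.D.exists_interiorFrame hx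
  set N := 1 + M' with hN
  set K := A + M' / 2 with hK
  have hA1 : 1 ≤ A := by
    have : 0 ≤ 4 / B.c * (2 * c2 + W / g0) := by positivity
    linarith
  have hKA : A ≤ K := by rw [hK]; linarith
  have hKN : N / 2 ≤ K := by rw [hK, hN]; linarith
  have hN0 : 0 ≤ N := by rw [hN]; linarith
  have key := L.normalFn_max_ineq J B hσ hβ0 hx hxδ hβH (by linarith) (by linarith) h hm
  rw [← hMa, ← hc1, ← hc2, ← hc3] at key
  set 𝓖 := ∑ i, G i with h𝓖
  set Q := ∑ i, G i * pd L.D.S (e i) (L.H B.Λ B.c) x ^ 2 with hQ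
  set T := ∑ i, G i * |lam i| with hT
  have hQ0 : 0 ≤ Q := Finset.sum_nonneg fun i _ => mul_nonneg (h.pos i).le (sq_nonneg _)
  have hG0 : g0 ≤ 𝓖 := h.sum_ge
  have hG00 : 0 ≤ 𝓖 := hg0'.le.trans hG0
  have hAc : 2 * c2 * 𝓖 + W ≤ K * B.c / 4 * 𝓖 := by
    have h1 : 2 * c2 + W / g0 ≤ K * B.c / 4 := by
      have h2 : 4 / B.c * (2 * c2 + W / g0) ≤ K := by linarith
      rw [div_mul_eq_mul_div, div_le_iff₀ hc] at h2
      linarith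
    have h3 : W ≤ W / g0 * 𝓖 := by
      rw [div_mul_eq_mul_div, le_div_iff₀ hg0']
      exact mul_le_mul_of_nonneg_left hG0 hW0
    calc 2 * c2 * 𝓖 + W ≤ (2 * c2 + W / g0) * 𝓖 := by linarith
      _ ≤ _ := mul_le_mul_of_nonneg_right h1 hG00
  obtain ⟨a, ha⟩ := Setup.InteriorFrame.exists_max lam
  obtain ⟨b, hb⟩ := Setup.InteriorFrame.exists_min lam
  have hlam : lam a ≤ C₁ * N := by
    have h1 := hC x hS (e a) (e.norm_eq_one a)
    rwa [h.diag, if_pos rfl] at h1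
  have hlam0 := h.lam_max_pos ha
  have hkn : (0:ℝ) ≤ P.k := Nat.cast_nonneg _
  -- In the first case |λ_i| ≤ λ_i + 2δ₁N, and Σ G_i λ_i = k makes the sum small relative to N Σ
  -- G_i. In the second, the least eigenvalue is at most -ε times the largest, so all G_i are
  -- comparable and |DH| ≥ 1/2 makes Q comparable to Σ G_i.
  by_cases hcase : -(δ₁ * N) ≤ lam b
  · have h1 : T ≤ P.k + 2 * (δ₁ * N) * 𝓖 := by
      rw [hT, ← h.sum_mul, h𝓖, Finset.mul_sum, ← Finset.sum_add_distrib]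
      refine Finset.sum_le_sum fun i _ => ?_
      have h2 : |lam i| ≤ lam i + 2 * (δ₁ * N) := by
        have h3 := hb i
        rcases abs_cases (lam i) with ⟨h4, _⟩ | ⟨h4, _⟩ <;> rw [h4] <;>
          linarith [mul_nonneg hδ₁0.le hN0]
      calc G i * |lam i| ≤ G i * (lam i + 2 * (δ₁ * N)) := mul_le_mul_of_nonneg_left h2 (h.pos i).le
        _ = _ := by ring
    have h2 : 4 * c3 * T ≤ 4 * c3 * P.k + 8 * c3 * δ₁ * N * 𝓖 :=
      (mul_le_mul_of_nonneg_left h1 (by positivity)).trans (le_of_eq (by ring))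
    have h3 : 8 * c3 * δ₁ * N * 𝓖 ≤ K * B.c / 4 * 𝓖 := by
      refine mul_le_mul_of_nonneg_right ?_ hG00
      have h4 := mul_le_mul_of_nonneg_right hδ₁c hN0
      have h5 := mul_le_mul_of_nonneg_right hKN hc.le
      linarith
    have h4 : 0 ≤ K / 2 * (β * Q) := by
      have : 0 ≤ K := by linarith
      positivity
    linarith
  · have hlt := not_le.1 hcase
    have h1 : lam b ≤ -ε * lam a := by
      have h2 : ε * lam a ≤ δ₁ * N := by
        have h3 : lam a ≤ (C₁ + 1) * N := by linarith
        have h4 : ε * (C₁ + 1) = δ₁ := by rw [hε]; field_simp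
        calc ε * lam a ≤ ε * ((C₁ + 1) * N) := mul_le_mul_of_nonneg_left h3 hε0.le
          _ = δ₁ * N := by rw [← mul_assoc, h4]
      linarith
    have h2 := h.sum_le ε hε0 a b ha hb h1
    rw [← hΘ] at h2
    have h3 : 𝓖 / 4 ≤ Θ * Q := by
      obtain ⟨v, hv1, hv⟩ := B.grad_ge L x hS hxδ
      have h4 := sq_pd_le_sum (S := L.D.S) e (L.H B.Λ B.c) x v
      rw [hv1, one_pow, one_mul] at h4
      have h5 : 1 / 4 ≤ ∑ i, pd L.D.S (e i) (L.H B.Λ B.c) x ^ 2 := by nlinarith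
      calc 𝓖 / 4 = 𝓖 * (1 / 4) := by ring
        _ ≤ 𝓖 * ∑ i, pd L.D.S (e i) (L.H B.Λ B.c) x ^ 2 := mul_le_mul_of_nonneg_left h5 hG00
        _ ≤ Θ * Q := by
          rw [hQ, Finset.mul_sum, Finset.mul_sum]
          refine Finset.sum_le_sum fun i _ => ?_
          rw [← mul_assoc]
          exact mul_le_mul_of_nonneg_right (h2 i) (sq_nonneg _)
    have h4 : T ≤ P.n * (C₁ * N) * 𝓖 := by
      rw [hT, h𝓖, Finset.mul_sum]
      refine Finset.sum_le_sum fun i _ => ?_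
      rw [mul_comm]
      refine mul_le_mul_of_nonneg_right ((h.abs_lam_le ha i).trans ?_) (h.pos i).le
      gcongr
    have hX : 0 ≤ c3 * (P.n * C₁) := by positivity
    have h5 : 4 * c3 * T ≤ K / 2 * (β * Q) := by
      calc 4 * c3 * T ≤ 4 * c3 * (P.n * (C₁ * N) * 𝓖) := mul_le_mul_of_nonneg_left h4 (by positivity)
        _ = 32 * (c3 * (P.n * C₁)) * (N / 2) * (𝓖 / 4) := by ring
        _ ≤ 32 * (c3 * (P.n * C₁)) * K * (Θ * Q) := by
          refine mul_le_mul ?_ h3 (by positivity) (by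
            have : 0 ≤ K := by linarith
            positivity)
          exact mul_le_mul_of_nonneg_left hKN (by positivity)
        _ = _ := by rw [hβ]; ring
    have h6 : 0 ≤ K * B.c / 4 * 𝓖 := by
      have : 0 ≤ K := by linarith
      positivity
    have h7 : 0 ≤ c3 * P.k := by positivity
    linarith

/-- The second normal derivatives are controlled by half of their supremum. -/
theorem exists_normal_le (P : Params) :
    ∃ C, ∀ (D : Setup P) (M' : ℝ), 0 ≤ M' → D.NormalBound M' →
      D.NormalBound (C + M' / 2) := by
  obtain ⟨J⟩ := exists_jetConst P
  obtain ⟨B⟩ := exists_barrierConst P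
  obtain ⟨C₁, hC₁, hstep⟩ := exists_hess_le_normal P
  obtain ⟨β, A₀, hβ, hA₀, hint⟩ := LocalSetup.exists_normalFn_not_isLocalMax J B hC₁
  have hJ : 0 ≤ J.C := zero_le_one.trans J.one_le
  have hc := B.c_pos
  have hδ := B.δ_pos
  have hK1 := zero_le_one.trans P.one_le_K1
  -- The radius shrinks so that β|H| ≤ 1, keeping the factor 1 - βH between 1 and 2.
  set δ' := min B.δ (1 / (β * (2 * P.K1 + 1) + 1)) with hδ'
  have hδ'0 : 0 < δ' := lt_min hδ (by positivity)
  have hδ'le : δ' ≤ B.δ := min_le_left _ _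
  have hβδ : β * ((2 * P.K1 + 1) * δ') ≤ 1 := by
    have h1 : δ' ≤ 1 / (β * (2 * P.K1 + 1) + 1) := min_le_right _ _
    rw [le_div_iff₀ (by positivity)] at h1
    linarith
  set W := P.n * (P.K1 * |P.M|) + J.C with hW
  have hW0 : 0 ≤ W := by positivity
  -- The summands serve, in turn, the absence of interior maxima, the condition 2β|w| ≤ A, and
  -- negativity on the sphere of radius δ'.
  set A := A₀ + 2 * (β * W) + 2 * W / (B.c * δ' ^ 2) with hA
  have hAA₀ : A₀ ≤ A := by
    have : 0 ≤ 2 * (β * W) + 2 * W / (B.c * δ' ^ 2) := by positivity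
    linarith
  have hAβ : 2 * (β * W) ≤ A := by
    have : 0 ≤ 2 * W / (B.c * δ' ^ 2) := by positivity
    linarith
  have hAδ : 2 * W ≤ A * (B.c * δ' ^ 2) := by
    rw [← div_le_iff₀ (by positivity)]
    have : 0 ≤ 2 * (β * W) := by positivity
    linarith
  set c := P.n * (J.C * |P.M|) + J.C with hcdef
  have hc0 : 0 ≤ c := by positivity
  refine ⟨A + P.n * c, ?_⟩
  rintro D M' hM' hN L rfl
  have hMa : |P.M| = P.M := abs_of_nonneg L.D.M_nonneg
  have hC := hstep L.D M' hM' hN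
  set K := A + M' / 2 with hK
  have hKA : A ≤ K := by rw [hK]; linarith
  have hK0 : 0 ≤ K := by linarith
  have hwle : ∀ y ∈ L.D.S, y ∈ ball L.p P.r → |L.w y| ≤ W := fun y hS hb => by
    have := L.abs_w_le J hS hb
    rwa [hW, hMa]
  have hsub : closedBall L.p δ' ⊆ ball L.p P.r :=
    closedBall_subset_ball (hδ'le.trans_lt B.δ_lt)
  have hneg : ∀ σ, |σ| = 1 → ∀ y ∈ L.D.S, y ∈ closedBall L.p δ' → L.normalFn B σ β K y ≤ 0 := by
    intro σ hσ
    have hcont : ContinuousOn (L.normalFn B σ β K) (L.D.S ∩ closedBall L.p δ') := fun y hy =>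
      (L.normalFn_two B σ β K hy.1 (hsub hy.2)).continuousWithinAt.mono inter_subset_left
    obtain ⟨x, ⟨hxS, hxδ⟩, hmax⟩ := (L.D.isCompact_S.inter_right isClosed_closedBall).exists_isMaxOn
      ⟨L.p, L.p_mem, mem_closedBall_self hδ'0.le⟩ hcont
    suffices hx0 : L.normalFn B σ β K x ≤ 0 from fun y hyS hyδ => (hmax ⟨hyS, hyδ⟩).trans hx0
    have hxb := hsub hxδ
    have hxδ' : ‖x - L.p‖ ≤ δ' := by rwa [mem_closedBall, dist_eq_norm] at hxδ
    have hxδB := hxδ'.trans hδ'le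
    have hHle := B.H_le L x hxS hxδB
    have hH0 : L.H B.Λ B.c x ≤ 0 := hHle.trans (by
      have : 0 ≤ B.c * ‖x - L.p‖ ^ 2 := by positivity
      linarith)
    have hβH : β * |L.H B.Λ B.c x| ≤ 1 := by
      refine le_trans (mul_le_mul_of_nonneg_left ((B.abs_H_le L x hxS hxδB).trans ?_) hβ) hβδ
      gcongr
    rcases L.D.mem_or_frontier hxS with hxΩ | hxf
    · rcases hxδ'.lt_or_eq with hlt | heq
      · refine absurd ?_ (hint A hAA₀ L M' hM' hC x hxΩ hxδB hβH ?_ σ hσ)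
        · filter_upwards [L.D.isOpen.mem_nhds hxΩ,
            isOpen_ball.mem_nhds (show x ∈ ball L.p δ' by rwa [mem_ball, dist_eq_norm])] with z hz hzb
          exact hmax ⟨L.D.subset_S hz, ball_subset_closedBall hzb⟩
        · refine le_trans ?_ hAβ
          have := mul_le_mul_of_nonneg_left (hwle x hxS hxb) hβ
          linarith
      · have h1 : |σ * ((1 + (-β) * L.H B.Λ B.c x) * L.w x)| ≤ 2 * W := by
          rw [abs_mul, hσ, one_mul, abs_mul]
          refine mul_le_mul ?_ (hwle x hxS hxb) (abs_nonneg _) zero_le_two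
          have h2 : |(-β) * L.H B.Λ B.c x| ≤ 1 := by
            rw [abs_mul, abs_neg, abs_of_nonneg hβ]; exact hβH
          calc |1 + (-β) * L.H B.Λ B.c x| ≤ |(1:ℝ)| + |(-β) * L.H B.Λ B.c x| := abs_add_le _ _
            _ ≤ 2 := by rw [abs_one]; linarith
        have h2 := (le_abs_self _).trans h1
        have h3 : K * L.H B.Λ B.c x ≤ -(2 * W) := by
          have h4 := mul_le_mul_of_nonneg_left hHle hK0
          rw [heq] at h4
          have h5 : A * (B.c * δ' ^ 2) ≤ K * (B.c * δ' ^ 2) :=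
            mul_le_mul_of_nonneg_right hKA (by positivity)
          linarith
        unfold LocalSetup.normalFn
        linarith
    · unfold LocalSetup.normalFn
      rw [L.w_eq_zero hxb hxf, mul_zero, mul_zero, zero_add]
      exact mul_nonpos_of_nonneg_of_nonpos hK0 hH0
  have hpb := L.p_mem_ball
  have hq := lt_of_lt_of_le one_pos (L.one_le_q hpb)
  -- The test function vanishes at p and is nonpositive nearby, so its derivative along ∇ρ at p,
  -- which is (σ·`wn` + K)·`q`, is nonnegative. The two signs of σ give both bounds.
  have hwn : ∀ σ, |σ| = 1 → -(σ * L.wn L.p) ≤ K := by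
    intro σ hσ
    have hw0 : L.w L.p = 0 := L.w_eq_zero hpb L.mem_frontier
    have h1 : pd L.D.S (-L.grad L.p) (L.normalFn B σ β K) L.p ≤ 0 := by
      refine pd_nonpos_of_eventually_le
        ((L.normalFn_two B σ β K L.p_mem hpb).differentiableWithinAt two_ne_zero) ?_
      have h2 := L.eventually_mem hpb L.mem_frontier (e := -L.grad L.p)
        (by rw [pd_neg_vec, L.pd_ρ_grad]; linarith)
      have h3 : ∀ᶠ t in 𝓝[>] (0:ℝ), L.p + t • (-L.grad L.p) ∈ ball L.p δ' := by
        have : Tendsto (fun t : ℝ => L.p + t • (-L.grad L.p)) (𝓝 0) (𝓝 L.p) := by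
          have : ContinuousAt (fun t : ℝ => L.p + t • (-L.grad L.p)) 0 := by fun_prop
          simpa [ContinuousAt] using this
        exact (this.mono_left nhdsWithin_le_nhds) (ball_mem_nhds _ hδ'0)
      filter_upwards [h2, h3] with t ht1 ht2
      refine ⟨L.D.subset_S ht1, (hneg σ hσ _ (L.D.subset_S ht1) (ball_subset_closedBall ht2)).trans ?_⟩
      unfold LocalSetup.normalFn
      rw [hw0, L.H_p B]
      simp
    have hHg : pd L.D.S (L.grad L.p) (L.H B.Λ B.c) L.p = L.q L.p := by
      rw [pd_eq_pd_univ L.D.body L.p_mem ((L.H_contDiffAt _ _ hpb).differentiableAt two_ne_zero),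
        L.pd_H_univ _ _ hpb, L.pd_ρ_grad, L.ρ_p]
      simp
    rw [pd_neg_vec, L.pd_normalFn B σ β K L.p_mem hpb, hw0, L.H_p B,
      L.pd_w_eq hpb L.mem_frontier, L.pd_ρ_grad, hHg] at h1
    have h2 : 0 ≤ (σ * L.wn L.p + K) * L.q L.p := by linarith
    have h3 := nonneg_of_mul_nonneg_left h2 hq
    linarith
  have h1 : |L.wn L.p| ≤ K := by
    have e1 := hwn 1 (by simp)
    have e2 := hwn (-1) (by simp)
    exact abs_le.2 ⟨by linarith, by linarith⟩
  have hcc : ∀ l, |L.cc l L.p| ≤ c := fun l => by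
    rw [hcdef, hMa]; exact L.abs_cc_le J L.p_mem hpb l
  have h2 : |(∑ l, L.grad L.p l * L.cc l L.p) / L.q L.p| ≤ P.n * c := by
    rw [abs_div, abs_of_pos hq, div_le_iff₀ hq]
    refine (L.abs_sum_cc_le hcc _).trans ?_
    rw [mul_assoc, mul_comm c]
    gcongr
    exact L.norm_grad_le_q hpb
  have h3 := L.wn_eq hpb L.mem_frontier
  have h4 : L.nn L.p = L.wn L.p + (∑ l, L.grad L.p l * L.cc l L.p) / L.q L.p := by linarith
  rw [h4]
  refine (abs_add_le _ _).trans ?_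
  linarith

end NormalBound
end HessianNeumann

namespace HessianNeumann

/-! ### Absorption and the full Hessian norm. -/

section GlobalEstimate
open Filter Topology

variable {P : Params}

/-- The supremum of the second normal derivatives on the boundary. -/
theorem Setup.exists_sup_normalBound (D : Setup P) :
    ∃ M', 0 ≤ M' ∧ D.NormalBound M' ∧ ∀ c, 0 ≤ c → D.NormalBound c → M' ≤ c := by
  set R : Set ℝ := {t | ∃ L : LocalSetup P, L.D = D ∧ t = |L.nn L.p|} with hR
  -- Only finiteness is needed, and it follows from continuity of D²u on the compact closure; the
  -- bound itself depends on the solution and disappears in the absorption.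
  have hbdd : BddAbove R := by
    have hcont : ContinuousOn (fun z : E P.n × E P.n => |pd D.S z.2 (pd D.S z.2 D.u) z.1|)
        (D.S ×ˢ sphere 0 1) :=
      (D.continuousOn_hess.mono (prod_mono subset_rfl (subset_univ _))).abs
    obtain ⟨b, hb⟩ := ((D.isCompact_S.prod (isCompact_sphere _ _)).bddAbove_image hcont)
    refine ⟨b, ?_⟩
    rintro t ⟨L, rfl, rfl⟩
    have hg : 0 < ‖L.grad L.p‖ := lt_of_lt_of_le one_pos (L.one_le_norm_grad L.p_mem_ball)
    refine hb ⟨(L.p, ‖L.grad L.p‖⁻¹ • L.grad L.p), ⟨L.p_mem, mem_sphere_zero_iff_norm.2 ?_⟩, ?_⟩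
    · rw [norm_smul, norm_inv, norm_norm, inv_mul_cancel₀ hg.ne']
    · simp only
      rw [pd_pd_smul_vec L.D.body L.p_mem _ _ (L.D.u_two L.p_mem), LocalSetup.nn, L.q_eq, inv_pow]
      congr 1
      rw [div_eq_inv_mul]
  refine ⟨sSup R, Real.sSup_nonneg ?_, fun L hL => le_csSup hbdd ⟨L, hL, rfl⟩, fun c hc hN =>
    Real.sSup_le ?_ hc⟩
  · rintro t ⟨L, -, rfl⟩; exact abs_nonneg _
  · rintro t ⟨L, hL, rfl⟩; exact hN L hL

/-- The least bound M' for the normal derivatives satisfies M' ≤ |C| + M'/2, hence M' ≤ 2|C|. Upper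
bounds for u_ξξ give two-sided ones in the interior because the Laplacian is positive, and
continuity carries these to the boundary. -/
theorem exists_hess_le (P : Params) : ∃ C, 0 ≤ C ∧ ∀ (D : Setup P), ∀ x ∈ D.S, ∀ ξ : E P.n,
    |pd D.S ξ (pd D.S ξ D.u) x| ≤ C * ‖ξ‖ ^ 2 := by
  obtain ⟨C₁, hC₁, h1⟩ := exists_hess_le_normal P
  obtain ⟨C, hC⟩ := exists_normal_le P
  refine ⟨P.n * (C₁ * (1 + 2 * |C|)), by positivity, fun D => ?_⟩
  obtain ⟨M', hM', hN, hsup⟩ := D.exists_sup_normalBound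
  have h2 : M' ≤ |C| + M' / 2 := hsup _ (by positivity) fun L hL =>
    (hC D M' hM' hN L hL).trans (by linarith [le_abs_self C])
  have h3 : M' ≤ 2 * |C| := by linarith
  have hint : ∀ x ∈ D.Ω, ∀ ξ : E P.n, |pd D.S ξ (pd D.S ξ D.u) x| ≤
      P.n * (C₁ * (1 + 2 * |C|)) * ‖ξ‖ ^ 2 := by
    intro x hx ξ
    obtain ⟨e, lam, G, h⟩ := D.exists_interiorFrame hx
    obtain ⟨a, ha⟩ := Setup.InteriorFrame.exists_max lam
    have h4 := h1 D M' hM' hN x (D.subset_S hx) (e a) (e.norm_eq_one a)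
    rw [h.diag, if_pos rfl] at h4
    refine (h.abs_hess_le ha ξ).trans ?_
    have h5 : lam a ≤ C₁ * (1 + 2 * |C|) := h4.trans (by gcongr)
    gcongr
  intro x hx ξ
  have hcont : ContinuousOn (fun x => |pd D.S ξ (pd D.S ξ D.u) x|) (closure D.Ω) := fun z hz =>
    (D.pd_pd_u_one hz ξ ξ).continuousWithinAt.abs
  exact le_on_closure (fun z hz => hint z hz ξ) hcont continuousOn_const hx

/-- Polarization; the parallelogram law keeps the same constant for the bilinear form. -/
theorem exists_norm_hess_le (P : Params) : ∃ C, ∀ (D : Setup P), ∀ x ∈ D.S,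
    ‖iteratedFDerivWithin ℝ 2 D.u D.S x‖ ≤ C := by
  obtain ⟨C, hC, h⟩ := exists_hess_le P
  refine ⟨C, fun D x hx => ContinuousMultilinearMap.opNorm_le_bound hC fun m => ?_⟩
  have h1 : iteratedFDerivWithin ℝ 2 D.u D.S x m = pd D.S (m 0) (pd D.S (m 1) D.u) x := by
    rw [iteratedFDerivWithin_two_apply D.u D.body.uniqueDiffOn hx,
      pd_pd_eq D.body hx _ _ (D.u_two hx)]
  have hunit : ∀ a b : E P.n, ‖a‖ = 1 → ‖b‖ = 1 → |pd D.S a (pd D.S b D.u) x| ≤ C := by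
    intro a b ha hb
    have e1 := D.hess_add_smul hx a b 1
    have e2 := D.hess_add_smul hx a b (-1)
    rw [one_smul] at e1
    rw [neg_one_smul] at e2
    have e3 := parallelogram_law_with_norm ℝ a b
    rw [ha, hb] at e3
    have e4 := abs_le.1 (h D x hx (a + b))
    have e5 := abs_le.1 (h D x hx (a + -b))
    rw [← sub_eq_add_neg] at e2 e5
    have e6 : C * ‖a + b‖ ^ 2 + C * ‖a - b‖ ^ 2 = 4 * C := by
      rw [← mul_add, e3]; ring
    exact abs_le.2 ⟨by linarith [e4.1, e5.2], by linarith [e4.2, e5.1]⟩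
  rw [h1, Fin.prod_univ_two, Real.norm_eq_abs]
  generalize m 0 = a
  generalize m 1 = b
  rcases eq_or_ne a 0 with rfl | ha
  · simp [pd]
  rcases eq_or_ne b 0 with rfl | hb
  · rw [D.hess_comm hx]; simp [pd]
  have ha' := norm_pos_iff.2 ha
  have hb' := norm_pos_iff.2 hb
  have h2 := hunit (‖a‖⁻¹ • a) (‖b‖⁻¹ • b)
    (by rw [norm_smul, norm_inv, norm_norm, inv_mul_cancel₀ ha'.ne'])
    (by rw [norm_smul, norm_inv, norm_norm, inv_mul_cancel₀ hb'.ne'])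
  rw [pd_smul_vec, D.hess_smul_right hx, abs_mul, abs_mul, abs_of_pos (inv_pos.2 ha'),
    abs_of_pos (inv_pos.2 hb'), inv_mul_le_iff₀ ha', inv_mul_le_iff₀ hb'] at h2
  linarith

end GlobalEstimate
end HessianNeumann

end

theorem theorem4p1 (n k : ℕ) (hk : 1 ≤ k) (hkn : k ≤ n)
    -- bounds for the convexity and the `C⁴` size of the boundary of the domain
    (κ r K : ℝ) (hκ : 0 < κ) (hr : 0 < r)
    -- bounds for the norms of `u`, `f`, `φ` and for the minimum of `f`
    (M A B m : ℝ) (hm : 0 < m) :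
    ∃ C : ℝ, ∀ (Ω : Set (E n)) (f φ : E n → ℝ → ℝ) (u : E n → ℝ) (M₀ : ℝ),
      IsOpen Ω → Ω.Nonempty → Bornology.IsBounded Ω →
      HasC4Boundary Ω r K → UniformlyConvexWith Ω κ →
      -- the data
      ContDiffOn ℝ 2 (Function.uncurry f) (closure Ω ×ˢ univ) →
      (∀ x ∈ closure Ω, ∀ z, 0 < f x z) →
      ContDiffOn ℝ 3 (Function.uncurry φ) (closure Ω ×ˢ univ) →
      (∀ x ∈ closure Ω, Antitone (φ x)) →
      -- the solution
      ContDiffOn ℝ 4 u Ω → ContDiffOn ℝ 3 u (closure Ω) →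
      KAdmissible k Ω u → SolvesNeumann k Ω f φ u →
      -- the quantities on which the constant depends, with `M₀ = sup |u|`
      IsLUB ((fun x => |u x|) '' Ω) M₀ →
      CNormLE 1 u (closure Ω) (closure Ω) M →
      CNormLE 2 (Function.uncurry f) (closure Ω ×ˢ univ) (closure Ω ×ˢ Icc (-M₀) M₀) A →
      (∀ x ∈ closure Ω, ∀ z ∈ Icc (-M₀) M₀, m ≤ f x z) →
      CNormLE 3 (Function.uncurry φ) (closure Ω ×ˢ univ) (closure Ω ×ˢ Icc (-M₀) M₀) B →
      ∀ x ∈ closure Ω, ‖iteratedFDerivWithin ℝ 2 u (closure Ω) x‖ ≤ C := by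
  obtain ⟨C, hC⟩ := exists_norm_hess_le ⟨n, k, κ, r, K, M, A, B, m, hk, hkn, hκ, hr, hm⟩
  exact ⟨C, fun Ω f φ u M₀ h1 h2 h3 h4 h5 h6 _ h8 h9 h10 h11 h12 h13 h14 h15 h16 h17 h18 =>
    hC ⟨Ω, f, φ, u, M₀, h1, h2, h3, h4, h5, h6, h8, h9, h10, h11, h12, h13, h14, h15, h16, h17,
      h18⟩⟩
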